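/- **Conventions.** Let $V$ be a category. A *$V$-graph* $X$ is a set $X_0$ of objects with an object $X(a,b)$ of $V$ for all $a,b\in X_0$; a morphism $f:X\to Y$ is a function $f:X_0\to Y_0$ with maps $X(a,b)\to Y(fa,fb)$; $\mathcal GV$ is the category of $V$-graphs. A functor $H$ induces $\mathcal G(H)$ by $(\mathcal G(H)X)_0=X_0$, $\mathcal G(H)X(a,b)=H(X(a,b))$, and a monad $(T,\eta,\mu)$ on $V$ induces a monad $\mathcal G(T)$ on $\mathcal GV$. Let $MV=\coprod_{n\ge 0}V^n$. A *multitensor* $(E,u,\sigma)$ on $V$ is a functor $E:MV\to V$, with values written $\mathop{E}_{i}X_i=E(X_1,\dots,X_n)$ and restriction $E_n$ to $V^n$, together with natural maps $u_X:X\to E_1X$ and $\sigma:\mathop{E}_i\mathop{E}_jX_{ij}\to \mathop{E}_{ij}X_{ij}$ (for all sequences of sequences, with $\mathop{E}_{ij}X_{ij}$ the value of $E$ at the concatenated sequence) such that $\sigma\circ u_{E_iX_i}=\mathrm{id}$, $\sigma\circ \mathop{E}_iu_{X_i}=\mathrm{id}$ and $\sigma\circ\mathop{E}_i\sigma=\sigma\circ\sigma$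 as maps $\mathop{E}_i\mathop{E}_j\mathop{E}_kX_{ijk}\to\mathop{E}_{ijk}X_{ijk}$. A *multitensor map* $E\to F$ is a natural family $E(X_i)\to F(X_i)$ compatible with units and substitutions. The functor $E_1$ is a monad on $V$, with unit $u$ and multiplication given by $\sigma$. $E$ is *distributive* if each $E_n$ preserves coproducts in each variable. An *$E$-category* is a $V$-graph $X$ with maps $\kappa_x:\mathop{E}_iX(x_{i-1},x_i)\to X(x_0,x_n)$ for all $n\geq 0$ and all sequences $x=(x_0,\dots,x_n)$ of objects, such that $\kappa_{(a,b)}u_{X(a,b)}=\mathrm{id}$ and, for every $(x_0,\dots,x_m)$ and all sequences from $x_{i-1}$ to $x_i$ $(1\le i\le m)$, the maps $\kappa\circ\mathop{E}_i\kappa$ and $\kappa\circ\sigma$ agree, where the last $\kappa$ is that of the concatenated sequence. $E$-functors are the morphisms of graphs commuting with the $\kappa$'s; $E\text{-Cat}$ is the resulting category and $U^E:E\text{-Cat}\to\mathcal GV$ is the forgetful functor. If $V$ has coproducts and $E$ is distributive, $\Gamma(E)$ denotes the monad on $\mathcal GV$ with $\Gamma(E)(X)_0=X_0$ and $\Gamma(E)(X)(a,b)=\coprod_{a=x_0,\dots,x_n=b}\mathop{E}_iX(x_{i-1},x_i)$,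 with coproduct inclusions $k_x$. Its unit is the identity on objects and is $k_{(a,b)}u$ on homs. Its multiplication is the identity on objects and, on homs, is the unique map whose composite with $k\circ\mathop{E}_i k$ on each summand $\mathop{E}_i\mathop{E}_jX(x_{ij-1},x_{ij})$ is $k\sigma$. **Theorem.** Let $(E,u,\sigma)$ be a multitensor and $(T,\eta,\mu)$ a monad on a category $V$. The following data are in bijection. 1. Monoidal monad coherences for $T$: natural maps $\tau:\mathop{E}_iTX_i\to T\mathop{E}_iX_i$ (for all finite sequences) with $$\tau\circ uT=Tu,\qquad T\sigma\circ\tau E_j\circ \mathop{E}_i\tau=\tau\circ\sigma T,\qquad \tau\circ \mathop{E}_i\eta=\eta \mathop{E}_i,\qquad \tau\circ \mathop{E}_i\mu=\mu \mathop{E}_i\circ T\tau\circ\tau T .$$ 2. Natural maps $\sigma':T\mathop{E}_iT\mathop{E}_jX_{ij}\to T\mathop{E}_{ij}X_{ij}$ making $(TE,u',\sigma')$, with $u'_X=\eta_{E_1X}u_X$, a multitensor such that $\eta E:E\to TE$ is a multitensor map, $Tu:T\to TE_1$ is a morphism of monads, and the composite $T\mathop{E}_i\xrightarrow{Tu\eta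 \mathop{E}_i}TE_1T\mathop{E}_i\xrightarrow{\sigma'}T\mathop{E}_i$ is the identity. The bijection sends $\tau$ to $\sigma'=(\mu\sigma)\circ(T\tau E)$, that is, to $T\mathop{E}_iT\mathop{E}_jX_{ij}\xrightarrow{T\tau}TT\mathop{E}_i\mathop{E}_jX_{ij}\xrightarrow{\mu}T\mathop{E}_i\mathop{E}_jX_{ij}\xrightarrow{T\sigma}T\mathop{E}_{ij}X_{ij}$. If in addition $V$ has coproducts and $E$ is distributive, then these data are also in bijection with 3. natural families of morphisms $\lambda_X:\Gamma(E)\mathcal G(T)(X)\to\mathcal G(T)\Gamma(E)(X)$ of $\mathcal GV$, each the identity on objects, that form a distributive law of the monad $\mathcal G(T)$ over the monad $\Gamma(E)$ (compatibility with both units and both multiplications); 4. liftings of $\mathcal G(T)$ to $E\text{-Cat}$: monads $(T',\eta',\mu')$ on $E\text{-Cat}$ with $\mathcal G(T)U^E=U^ET'$, $\eta U^E=U^E\eta'$ and $\mu U^E=U^E\mu'$, where $\eta,\mu$ here denote the unit and multiplication of $\mathcal G(T)$. The bijection from 1 to 3 sends $\tau$ to the $\lambda$ whose restriction to the summand of $x=(x_0,\dots,x_n)$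 is $T(k_x)\circ\tau:\mathop{E}_iTX(x_{i-1},x_i)\to T\coprod_{x}\mathop{E}_iX(x_{i-1},x_i)$. The bijection from 1 to 4 sends $\tau$ to a lifting for which $T'X$, for $X$ an $E$-category with compositions $\kappa$, is the $V$-graph $\mathcal G(T)(X)$ with compositions $T(\kappa_x)\circ\tau:\mathop{E}_iTX(x_{i-1},x_i)\to TX(x_0,x_n)$. For any corresponding $\sigma'$ and $T'$, there is an isomorphism of categories $$(TE)\text{-Cat}\;\cong\;(E\text{-Cat})^{T'}$$ between categories enriched in $(TE,u',\sigma')$ and $T'$-algebras, commuting with the forgetful functors to $\mathcal GV$. -/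

import Mathlib

open CategoryTheory CategoryTheory.Limits

universe w v u

namespace EnrichedMultitensor

/-! ### Sequences of sequences and their concatenation -/

/-- Concatenation of a sequence of sequences: `(Z_{ij})_{ij}` in lexicographic order. -/
abbrev flat {α : Sort*} {m : ℕ} {n : Fin m → ℕ} (Z : ∀ i, Fin (n i) → α) :
    Fin (∑ i, n i) → α :=
  fun l => Z (finSigmaFinEquiv.symm l).1 (finSigmaFinEquiv.symm l).2

theorem flat_apply {α : Sort*} {m : ℕ} {n : Fin m → ℕ} (Z : ∀ i, Fin (n i) → α)
    (s : (i : Fin m) × Fin (n i)) : flat Z (finSigmaFinEquiv s) = Z s.1 s.2 := by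
  have h := finSigmaFinEquiv.symm_apply_apply s
  exact congrArg (fun t : (i : Fin m) × Fin (n i) => Z t.1 t.2) h

theorem sum_castLE_mono {m : ℕ} (n : Fin m → ℕ) {k k' : ℕ} (h : k ≤ k') (h' : k' ≤ m) :
    ∑ x : Fin k, n (Fin.castLE (h.trans h') x) ≤ ∑ x : Fin k', n (Fin.castLE h' x) := by
  obtain ⟨d, rfl⟩ := Nat.exists_eq_add_of_le h
  rw [Fin.sum_univ_add]
  exact Nat.le_add_right _ _

theorem finSigma_lt {m : ℕ} {n : Fin m → ℕ} {i i' : Fin m} (h : i < i')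
    (j : Fin (n i)) (j' : Fin (n i')) :
    finSigmaFinEquiv (⟨i, j⟩ : (i : Fin m) × Fin (n i)) < finSigmaFinEquiv ⟨i', j'⟩ := by
  rw [Fin.lt_def, finSigmaFinEquiv_apply, finSigmaFinEquiv_apply]
  have h1 := sum_castLE_mono n (show i.1 + 1 ≤ i'.1 from h) i'.2.le
  rw [Fin.sum_univ_castSucc] at h1
  have h2 := j.2
  have h3 : n (Fin.castLE (show i.1 + 1 ≤ m by omega) (Fin.last i.1)) = n i := rfl
  have h4 : ∑ x : Fin i.1, n (Fin.castLE (show i.1 + 1 ≤ m by omega) x.castSucc)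
    = ∑ x : Fin i.1, n (Fin.castLE i.2.le x) := rfl
  dsimp only at *
  omega

theorem finSigma_lt' {m : ℕ} {n : Fin m → ℕ} {i : Fin m}
    {j j' : Fin (n i)} (h : j < j') :
    finSigmaFinEquiv (⟨i, j⟩ : (i : Fin m) × Fin (n i)) < finSigmaFinEquiv ⟨i, j'⟩ := by
  rw [Fin.lt_def, finSigmaFinEquiv_apply, finSigmaFinEquiv_apply]
  have : j.1 < j'.1 := h
  dsimp only
  omega

theorem finSigma_symm_lt {m : ℕ} {n : Fin m → ℕ} {l l' : Fin (∑ i, n i)} (h : l < l') :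
    (finSigmaFinEquiv.symm l).1 < (finSigmaFinEquiv.symm l').1 ∨
      ∃ (i : Fin m) (j j' : Fin (n i)), j < j' ∧ finSigmaFinEquiv.symm l = ⟨i, j⟩ ∧
        finSigmaFinEquiv.symm l' = ⟨i, j'⟩ := by
  obtain ⟨⟨i, j⟩, rfl⟩ := finSigmaFinEquiv.surjective l
  obtain ⟨⟨i', j'⟩, rfl⟩ := finSigmaFinEquiv.surjective l'
  rw [Equiv.symm_apply_apply, Equiv.symm_apply_apply]
  rcases lt_trichotomy i i' with h1 | h1 | h1
  · exact Or.inl h1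
  · subst h1
    rcases lt_trichotomy j j' with h2 | h2 | h2
    · exact Or.inr ⟨i, j, j', h2, rfl, rfl⟩
    · subst h2; exact absurd h (lt_irrefl _)
    · exact absurd h (finSigma_lt' h2).asymm
  · exact absurd h (finSigma_lt h1 _ _).asymm

theorem strictMono_fin_eq {N N' : ℕ} (h : N = N') (f : Fin N → Fin N') (hf : StrictMono f) :
    f = Fin.cast h := by
  subst h
  have e : f = (StrictMono.orderIsoOfSurjective f hf
    (Finite.surjective_of_injective hf.injective) : Fin N → Fin N) := rfl
  rw [e, Subsingleton.elim (StrictMono.orderIsoOfSurjective f hf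
    (Finite.surjective_of_injective hf.injective)) (OrderIso.refl _)]
  rfl

theorem sum_flat {m : ℕ} {n : Fin m → ℕ} (p : ∀ i, Fin (n i) → ℕ) :
    ∑ l, flat p l = ∑ i, ∑ j, p i j := by
  rw [← Equiv.sum_comp finSigmaFinEquiv, Fintype.sum_sigma]
  exact Finset.sum_congr rfl fun i _ => Finset.sum_congr rfl fun j _ => flat_apply p ⟨i, j⟩

/-- Concatenation is associative. -/
theorem flat_flat {α : Sort*} {m : ℕ} {n : Fin m → ℕ} (p : ∀ i, Fin (n i) → ℕ)
    (Z : ∀ i (j : Fin (n i)), Fin (p i j) → α) (l : Fin (∑ i, ∑ j, p i j)) :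
    flat (fun i => flat (Z i)) l =
      flat (n := flat p)
        (fun r => Z (finSigmaFinEquiv.symm r).1 (finSigmaFinEquiv.symm r).2)
        (Fin.cast (sum_flat p).symm l) := by
  let g : Fin (∑ r, flat p r) → Fin (∑ i, ∑ j, p i j) := fun t =>
    finSigmaFinEquiv (⟨(finSigmaFinEquiv.symm (finSigmaFinEquiv.symm t).1).1,
      finSigmaFinEquiv (⟨(finSigmaFinEquiv.symm (finSigmaFinEquiv.symm t).1).2,
        (finSigmaFinEquiv.symm t).2⟩ : (j : Fin (n _)) × Fin (p _ j))⟩ :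
          (i : Fin m) × Fin (∑ j, p i j))
  have hg : StrictMono g := by
    intro t t' htt
    rcases finSigma_symm_lt htt with h | ⟨r, k, k', hk, h1, h2⟩
    · rcases finSigma_symm_lt h with h' | ⟨i, j, j', hj, h1, h2⟩
      · exact finSigma_lt h' _ _
      · have aux : ∀ (s s' : (i : Fin m) × Fin (n i)) (k : Fin (p s.1 s.2))
            (k' : Fin (p s'.1 s'.2)), s = ⟨i, j⟩ → s' = ⟨i, j'⟩ →
            finSigmaFinEquiv (⟨s.1, finSigmaFinEquiv
              (⟨s.2, k⟩ : (j : Fin (n _)) × Fin (p _ j))⟩ : (i : Fin m) × Fin (∑ j, p i j)) <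
            finSigmaFinEquiv ⟨s'.1, finSigmaFinEquiv ⟨s'.2, k'⟩⟩ := by
          intro s s' k k' hs hs'
          subst hs hs'
          exact finSigma_lt' (finSigma_lt hj _ _)
        exact aux _ _ _ _ h1 h2
    · simp only [g]
      rw [h1, h2]
      exact finSigma_lt' (finSigma_lt' hk)
  have key := strictMono_fin_eq (sum_flat p) g hg
  have hl : l = g (Fin.cast (sum_flat p).symm l) := by rw [key]; rfl
  conv_lhs => rw [hl]
  simp only [g]
  rw [flat_apply, flat_apply]

theorem flat_unit_left {α : Sort*} {n : ℕ} (Z : Fin n → α) (l : Fin (∑ _i : Fin 1, n)) :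
    flat (fun _ : Fin 1 => Z) l = Z (Fin.cast (by simp) l) := by
  obtain ⟨s, rfl⟩ := finSigmaFinEquiv.surjective l
  rw [flat_apply]
  congr 1
  ext
  exact (finSigmaFinEquiv_one s).symm

theorem flat_unit_right {α : Sort*} {n : ℕ} (Z : Fin n → α) (l : Fin (∑ _i : Fin n, 1)) :
    flat (fun (i : Fin n) (_ : Fin 1) => Z i) l = Z (Fin.cast (by simp) l) := by
  obtain ⟨s, rfl⟩ := finSigmaFinEquiv.surjective l
  rw [flat_apply]
  congr 1
  ext
  simp

/-! ### Finite sequences of objects with prescribed end points -/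

/-- A sequence `a = x_0, …, x_n = b` of elements of `O`, for some `n : ℕ`. -/
structure ObjSeq (O : Type w) (a b : O) : Type w where
  /-- the length `n` -/
  len : ℕ
  /-- the entries `x_0, …, x_n` -/
  vtx : Fin (len + 1) → O
  head : vtx 0 = a
  last : vtx (Fin.last len) = b

namespace ObjSeq

variable {O : Type w}

theorem ext_of {a b : O} {p q : ObjSeq O a b} (h : p.len = q.len)
    (hv : ∀ i : Fin p.len, p.vtx i.succ = q.vtx (Fin.cast h i).succ) : p = q := by
  obtain ⟨n, x, hx, hx'⟩ := p
  obtain ⟨m, y, hy, hy'⟩ := q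
  dsimp only at h
  subst h
  have : x = y := by
    funext i
    refine Fin.cases ?_ (fun i => ?_) i
    · rw [hx, hy]
    · exact hv i
  subst this
  rfl

/-- The sequence `(a, b)` of length one. -/
def single (a b : O) : ObjSeq O a b where
  len := 1
  vtx := ![a, b]
  head := rfl
  last := rfl

/-- Image of a sequence under a function. -/
def map {O' : Type w} (f : O → O') {a b : O} (p : ObjSeq O a b) : ObjSeq O' (f a) (f b) where
  len := p.len
  vtx i := f (p.vtx i)
  head := congrArg f p.head
  last := congrArg f p.last

/-- Change of the end points along equalities. -/
def copy {a b a' b' : O} (p : ObjSeq O a b) (ha : a = a') (hb : b = b') : ObjSeq O a' b' where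
  len := p.len
  vtx := p.vtx
  head := p.head.trans ha
  last := p.last.trans hb

/-- The underlying vertices of the concatenation `x_{ij}` of a doubly nested sequence. -/
def concatVtx {a b : O} (x : ObjSeq O a b)
    (y : ∀ i : Fin x.len, ObjSeq O (x.vtx i.castSucc) (x.vtx i.succ)) :
    Fin ((∑ i, (y i).len) + 1) → O :=
  Fin.cons a (flat fun i j => (y i).vtx j.succ)

theorem psum_lt {m : ℕ} (n : Fin m → ℕ) (k : Fin (m + 1)) :
    ∑ t : Fin k.1, n (Fin.castLE (Nat.le_of_lt_succ k.2) t) < (∑ i, n i) + 1 := by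
  have h := sum_castLE_mono n (Nat.le_of_lt_succ k.2) le_rfl
  exact Nat.lt_succ_of_le h

theorem concatVtx_succ {a b : O} (x : ObjSeq O a b)
    (y : ∀ i : Fin x.len, ObjSeq O (x.vtx i.castSucc) (x.vtx i.succ)) (i : Fin x.len)
    (j : Fin (y i).len) :
    x.concatVtx y (finSigmaFinEquiv
      (⟨i, j⟩ : (i : Fin x.len) × Fin (y i).len)).succ = (y i).vtx j.succ := by
  unfold concatVtx
  rw [Fin.cons_succ, flat_apply]

theorem concatVtx_psum {a b : O} (x : ObjSeq O a b)
    (y : ∀ i : Fin x.len, ObjSeq O (x.vtx i.castSucc) (x.vtx i.succ)) (k : Fin (x.len + 1)) :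
    x.concatVtx y ⟨_, psum_lt (fun i => (y i).len) k⟩ = x.vtx k := by
  induction k using Fin.induction with
  | zero => exact x.head.symm
  | succ i ih =>
    have hs : ∑ t : Fin (i.1 + 1), (y (Fin.castLE (Nat.le_of_lt_succ i.succ.2) t)).len
        = (∑ t : Fin i.1, (y (Fin.castLE i.2.le t)).len) + (y i).len := by
      rw [Fin.sum_univ_castSucc]
      rfl
    rcases Nat.eq_zero_or_pos (y i).len with h0 | h0
    · have e : (⟨_, psum_lt (fun i => (y i).len) i.succ⟩ : Fin ((∑ i, (y i).len) + 1))
          = ⟨_, psum_lt (fun i => (y i).len) i.castSucc⟩ := by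
        ext
        simp only [Fin.val_succ]
        rw [hs, h0]
        rfl
      rw [e, ih]
      refine (y i).head.symm.trans (Eq.trans (congrArg (y i).vtx ?_) (y i).last)
      ext
      simp [h0]
    · have e : (⟨_, psum_lt (fun i => (y i).len) i.succ⟩ : Fin ((∑ i, (y i).len) + 1))
          = (finSigmaFinEquiv (⟨i, ⟨(y i).len - 1, by omega⟩⟩ :
              (i : Fin x.len) × Fin (y i).len)).succ := by
        ext
        refine hs.trans ?_
        rw [Fin.val_succ, finSigmaFinEquiv_apply]
        dsimp only
        omega
      rw [e, concatVtx_succ]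
      refine Eq.trans (congrArg (y i).vtx ?_) (y i).last
      ext
      simp
      omega

theorem concatVtx_castSucc {a b : O} (x : ObjSeq O a b)
    (y : ∀ i : Fin x.len, ObjSeq O (x.vtx i.castSucc) (x.vtx i.succ)) (i : Fin x.len)
    (j : Fin (y i).len) :
    x.concatVtx y (finSigmaFinEquiv
      (⟨i, j⟩ : (i : Fin x.len) × Fin (y i).len)).castSucc = (y i).vtx j.castSucc := by
  obtain ⟨j, hj⟩ := j
  cases j with
  | zero =>
    have e : (finSigmaFinEquiv (⟨i, ⟨0, hj⟩⟩ : (i : Fin x.len) × Fin (y i).len)).castSucc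
        = ⟨_, psum_lt (fun i => (y i).len) i.castSucc⟩ := by
      ext
      rw [Fin.val_castSucc, finSigmaFinEquiv_apply]
      rfl
    rw [e, concatVtx_psum]
    exact (y i).head.symm
  | succ j =>
    have e : (finSigmaFinEquiv (⟨i, ⟨j + 1, hj⟩⟩ : (i : Fin x.len) × Fin (y i).len)).castSucc
        = (finSigmaFinEquiv (⟨i, ⟨j, by omega⟩⟩ : (i : Fin x.len) × Fin (y i).len)).succ := by
      ext
      rw [Fin.val_castSucc, Fin.val_succ, finSigmaFinEquiv_apply, finSigmaFinEquiv_apply]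
      rfl
    rw [e, concatVtx_succ]
    rfl

/-- Concatenation of a doubly nested sequence: an outer sequence `x_0, …, x_m` and, for each `i`,
an inner sequence from `x_{i-1}` to `x_i`. -/
def concat {a b : O} (x : ObjSeq O a b)
    (y : ∀ i : Fin x.len, ObjSeq O (x.vtx i.castSucc) (x.vtx i.succ)) : ObjSeq O a b where
  len := ∑ i, (y i).len
  vtx := x.concatVtx y
  head := rfl
  last := by
    have h := x.concatVtx_psum y (Fin.last x.len)
    rw [x.last] at h
    exact h

theorem concat_castSucc {a b : O} (x : ObjSeq O a b)
    (y : ∀ i : Fin x.len, ObjSeq O (x.vtx i.castSucc) (x.vtx i.succ))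
    (l : Fin (∑ i, (y i).len)) :
    (y (finSigmaFinEquiv.symm l).1).vtx (finSigmaFinEquiv.symm l).2.castSucc
      = (x.concat y).vtx (Fin.castSucc l) := by
  obtain ⟨⟨i, j⟩, rfl⟩ := finSigmaFinEquiv.surjective l
  rw [Equiv.symm_apply_apply]
  exact (x.concatVtx_castSucc y i j).symm

theorem concat_succ {a b : O} (x : ObjSeq O a b)
    (y : ∀ i : Fin x.len, ObjSeq O (x.vtx i.castSucc) (x.vtx i.succ))
    (l : Fin (∑ i, (y i).len)) :
    (y (finSigmaFinEquiv.symm l).1).vtx (finSigmaFinEquiv.symm l).2.succ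
      = (x.concat y).vtx (Fin.succ l) := rfl

theorem single_castSucc (a b : O) (i : Fin 1) : (single a b).vtx (Fin.castSucc i) = a := by
  rw [Subsingleton.elim i 0]
  rfl

theorem single_succ (a b : O) (i : Fin 1) : (single a b).vtx (Fin.succ i) = b := by
  rw [Subsingleton.elim i 0]
  rfl

theorem concat_single_left {a b : O} (p : ObjSeq O a b) :
    (single a b).concat (fun i => p.copy (single_castSucc a b i).symm (single_succ a b i).symm)
      = p :=
  ext_of (show ∑ _i : Fin 1, p.len = p.len by simp) fun i =>
    flat_unit_left (fun j : Fin p.len => p.vtx j.succ) i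

theorem concat_single_right {a b : O} (p : ObjSeq O a b) :
    p.concat (fun i => single (p.vtx i.castSucc) (p.vtx i.succ)) = p :=
  ext_of (show ∑ _i : Fin p.len, 1 = p.len by simp) fun l => by
    refine Eq.trans ?_ (flat_unit_right (fun j : Fin p.len => p.vtx j.succ) l)
    exact single_succ (p.vtx (finSigmaFinEquiv.symm l).1.castSucc) _ (finSigmaFinEquiv.symm l).2

theorem concat_concat {a b : O} (x : ObjSeq O a b)
    (y : ∀ i : Fin x.len, ObjSeq O (x.vtx i.castSucc) (x.vtx i.succ))
    (z : ∀ (i : Fin x.len) (j : Fin (y i).len),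
      ObjSeq O ((y i).vtx j.castSucc) ((y i).vtx j.succ)) :
    x.concat (fun i => (y i).concat (z i)) =
      (x.concat y).concat (fun l => (z (finSigmaFinEquiv.symm l).1 (finSigmaFinEquiv.symm l).2).copy
        (concat_castSucc x y l) (concat_succ x y l)) :=
  ext_of (sum_flat fun i j => (z i j).len).symm fun l =>
    flat_flat (fun i j => (z i j).len) (fun i j k => (z i j).vtx k.succ) l

theorem concat_map_vtx {O' : Type w} (f : O → O') {a b : O} (x : ObjSeq O a b)
    (y : ∀ i : Fin x.len, ObjSeq O (x.vtx i.castSucc) (x.vtx i.succ))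
    (l : Fin ((∑ i, (y i).len) + 1)) :
    ((x.map f).concat (fun i => (y i).map f)).vtx l = f ((x.concat y).vtx l) := by
  refine Fin.cases ?_ (fun l => ?_) l <;> rfl

theorem concat_map {O' : Type w} (f : O → O') {a b : O} (x : ObjSeq O a b)
    (y : ∀ i : Fin x.len, ObjSeq O (x.vtx i.castSucc) (x.vtx i.succ)) :
    (x.map f).concat (fun i => (y i).map f) = (x.concat y).map f :=
  ext_of rfl fun _ => rfl

end ObjSeq

/-! ### Multitensors -/

section Tensor

variable {V : Type u} [Category.{v} V]

/-- The underlying data of a functor `M V ⥤ V`, where `M V` is the category of finite sequences of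
objects of `V` and length preserving sequences of maps: for each `n` a functor `Vⁿ ⥤ V`. -/
abbrev TensorFunctor (V : Type u) [Category.{v} V] := ∀ n : ℕ, (Fin n → V) ⥤ V

/-- The action of `E` on a sequence of maps. -/
abbrev tmap (E : TensorFunctor V) {n : ℕ} {X Y : Fin n → V} (f : ∀ i, X i ⟶ Y i) :
    (E n).obj X ⟶ (E n).obj Y :=
  (E n).map f

theorem tobj_congr (E : TensorFunctor V) {n n' : ℕ} (h : n = n') {X : Fin n → V} {Y : Fin n' → V}
    (hX : ∀ i, X i = Y (Fin.cast h i)) : (E n).obj X = (E n').obj Y := by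
  subst h
  exact congrArg (E n).obj (funext hX)

/-- The identity `E X ⟶ E Y` for sequences `X` and `Y` that are equal (have equal lengths and
equal entries). -/
def tcast (E : TensorFunctor V) {n n' : ℕ} (h : n = n') {X : Fin n → V} {Y : Fin n' → V}
    (hX : ∀ i, X i = Y (Fin.cast h i)) : (E n).obj X ⟶ (E n').obj Y :=
  eqToHom (tobj_congr E h hX)

theorem tmap_comp (E : TensorFunctor V) {n : ℕ} {X Y Z : Fin n → V} (f : ∀ i, X i ⟶ Y i)
    (g : ∀ i, Y i ⟶ Z i) : tmap E f ≫ tmap E g = tmap E (fun i => f i ≫ g i) :=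
  ((E n).map_comp (X := X) (Y := Y) (Z := Z) f g).symm

theorem tmap_id (E : TensorFunctor V) {n : ℕ} (X : Fin n → V) :
    tmap E (fun i => 𝟙 (X i)) = 𝟙 ((E n).obj X) :=
  (E n).map_id X

theorem tcast_trans (E : TensorFunctor V) {n n' n'' : ℕ} (h : n = n') (h' : n' = n'')
    {X : Fin n → V} {Y : Fin n' → V} {Z : Fin n'' → V}
    (hX : ∀ i, X i = Y (Fin.cast h i)) (hY : ∀ i, Y i = Z (Fin.cast h' i)) :
    tcast E h hX ≫ tcast E h' hY = tcast E (h.trans h') (fun i => (hX i).trans (hY _)) := by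
  simp [tcast]

theorem tcast_rfl (E : TensorFunctor V) {n : ℕ} {X : Fin n → V} (h : n = n)
    (hX : ∀ i, X i = X (Fin.cast h i)) : tcast E h hX = 𝟙 _ := rfl

theorem tcast_tmap (E : TensorFunctor V) {n n' : ℕ} (h : n = n') {X X' : Fin n → V}
    {Y Y' : Fin n' → V} (hX : ∀ i, X i = Y (Fin.cast h i)) (hX' : ∀ i, X' i = Y' (Fin.cast h i))
    (f : ∀ i, X i ⟶ X' i) (g : ∀ i, Y i ⟶ Y' i)
    (hfg : ∀ i, f i ≫ eqToHom (hX' i) = eqToHom (hX i) ≫ g (Fin.cast h i)) :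
    tmap E f ≫ tcast E h hX' = tcast E h hX ≫ tmap E g := by
  subst h
  obtain rfl : X = Y := funext hX
  obtain rfl : X' = Y' := funext hX'
  rw [tcast_rfl, tcast_rfl, Category.comp_id, Category.id_comp]
  congr 1
  funext i
  have := hfg i
  rw [eqToHom_refl, eqToHom_refl, Category.comp_id, Category.id_comp] at this
  exact this

theorem tmap_eqToHom (E : TensorFunctor V) {n : ℕ} {X Y : Fin n → V} (h : ∀ i, X i = Y i) :
    tmap E (fun i => eqToHom (h i)) = tcast E rfl h := by
  obtain rfl : X = Y := funext h
  exact tmap_id E X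

/-- The type of families of unit maps `u_Z : Z ⟶ E(Z)`. -/
abbrev TensorUnit (E : TensorFunctor V) := ∀ Z : V, Z ⟶ (E 1).obj (fun _ => Z)

/-- The type of families of substitution maps `σ : E_i E_j Z_{ij} ⟶ E_{ij} Z_{ij}`. -/
abbrev TensorSubst (E : TensorFunctor V) := ∀ {m : ℕ} (n : Fin m → ℕ) (Z : ∀ i, Fin (n i) → V),
  (E m).obj (fun i => (E (n i)).obj (Z i)) ⟶ (E (∑ i, n i)).obj (flat Z)

theorem subst_tcast {E : TensorFunctor V} (σ : TensorSubst E) {m m' : ℕ} (hm : m = m')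
    {n : Fin m → ℕ} {n' : Fin m' → ℕ} (hn : ∀ i, n i = n' (Fin.cast hm i))
    {Z : ∀ i, Fin (n i) → V} {Z' : ∀ i, Fin (n' i) → V}
    (hZ : ∀ i j, Z i j = Z' (Fin.cast hm i) (Fin.cast (hn i) j))
    (hE : ∀ i, (E (n i)).obj (Z i) = (E (n' (Fin.cast hm i))).obj (Z' (Fin.cast hm i)))
    (hs : ∑ i, n i = ∑ i, n' i) (hF : ∀ l, flat Z l = flat Z' (Fin.cast hs l)) :
    tcast E hm hE ≫ σ n' Z' = σ n Z ≫ tcast E hs hF := by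
  subst hm
  obtain rfl : n = n' := funext hn
  obtain rfl : Z = Z' := funext fun i => funext fun j => hZ i j
  rw [tcast_rfl, tcast_rfl, Category.comp_id, Category.id_comp]

/-- The axioms making a functor `E : M V ⥤ V`, with a unit `u` and a substitution `σ`, into a
multitensor (a lax monoidal structure) on `V`. -/
structure IsMultitensor (E : TensorFunctor V) (u : TensorUnit E) (σ : TensorSubst E) : Prop where
  unit_natural : ∀ {X Y : V} (f : X ⟶ Y), f ≫ u Y = u X ≫ tmap E (fun _ => f)
  subst_natural : ∀ {m : ℕ} (n : Fin m → ℕ) (Z Z' : ∀ i, Fin (n i) → V)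
    (f : ∀ i j, Z i j ⟶ Z' i j),
    tmap E (fun i => tmap E (f i)) ≫ σ n Z' =
      σ n Z ≫ tmap E (fun l => f (finSigmaFinEquiv.symm l).1 (finSigmaFinEquiv.symm l).2)
  unit_left : ∀ {n : ℕ} (Z : Fin n → V),
    u ((E n).obj Z) ≫ σ (fun _ : Fin 1 => n) (fun _ => Z) ≫
      tcast E (by simp) (flat_unit_left Z) = 𝟙 _
  unit_right : ∀ {n : ℕ} (Z : Fin n → V),
    tmap E (fun i => u (Z i)) ≫ σ (fun _ : Fin n => 1) (fun i _ => Z i) ≫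
      tcast E (by simp) (flat_unit_right Z) = 𝟙 _
  assoc : ∀ {m : ℕ} (n : Fin m → ℕ) (p : ∀ i, Fin (n i) → ℕ)
    (Z : ∀ i (j : Fin (n i)), Fin (p i j) → V),
    tmap E (fun i => σ (p i) (Z i)) ≫ σ (fun i => ∑ j, p i j) (fun i => flat (Z i)) ≫
        tcast E (sum_flat p).symm (flat_flat p Z) =
      σ n (fun i j => (E (p i j)).obj (Z i j)) ≫
        σ (flat p) (fun r => Z (finSigmaFinEquiv.symm r).1 (finSigmaFinEquiv.symm r).2)

variable (V) in
/-- A multitensor `(E, u, σ)` on `V`. -/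
structure Multitensor where
  /-- the functor `M V ⥤ V` -/
  E : TensorFunctor V
  /-- the unit -/
  unit : TensorUnit E
  /-- the substitution -/
  subst : TensorSubst E
  isMultitensor : IsMultitensor E unit subst

/-- The `n`-ary functors of `E` preserve coproducts (indexed by types in universe `w`) in each
variable: for all `X` and `i` the functor sending `Z` to `E` of the sequence obtained from `X` by
putting `Z` in place `i` preserves coproducts. -/
def IsDistributive (E : TensorFunctor V) : Prop :=
  ∀ (n : ℕ) (X : Fin n → V) (i : Fin n) (J : Type w),
    PreservesColimitsOfShape (Discrete J)
      (Functor.pi' (fun k => if k = i then 𝟭 V else (Functor.const V).obj (X k)) ⋙ E n)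

/-- The monad on `V` obtained by restricting a multitensor to singleton sequences. -/
def Multitensor.unaryMonad (M : Multitensor V) : Monad V where
  obj Z := (M.E 1).obj (fun _ => Z)
  map f := tmap M.E (fun _ => f)
  map_id Z := tmap_id M.E (fun _ => Z)
  map_comp f g := (tmap_comp M.E (fun _ => f) (fun _ => g)).symm
  η := { app := M.unit, naturality := fun _ _ f => M.isMultitensor.unit_natural f }
  μ :=
    { app := fun Z => M.subst (fun _ : Fin 1 => 1) (fun _ _ => Z) ≫
        tcast M.E (by simp) (fun _ => rfl)
      naturality := fun X Y f => by
        have h := M.isMultitensor.subst_natural (fun _ : Fin 1 => 1) (fun _ _ => X) (fun _ _ => Y)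
          (fun _ _ => f)
        have h' := tcast_tmap M.E (show ∑ _i : Fin 1, 1 = 1 by simp)
          (X := fun _ => X) (X' := fun _ => Y) (Y := fun _ => X) (Y' := fun _ => Y)
          (fun _ => rfl) (fun _ => rfl) (fun _ => f) (fun _ => f) (fun _ => by simp)
        refine ((Category.assoc _ _ _).symm.trans (congrArg (· ≫ _) h)).trans ?_
        refine (Category.assoc _ _ _).trans ((congrArg (_ ≫ ·) h').trans ?_)
        exact (Category.assoc _ _ _).symm }
  left_unit Z := M.isMultitensor.unit_left (fun _ => Z)
  right_unit Z := M.isMultitensor.unit_right (fun _ => Z)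
  assoc Z := by
    have hA := M.isMultitensor.assoc (fun _ : Fin 1 => 1) (fun _ _ => 1) (fun _ _ _ => Z)
    have h1 : ∑ _i : Fin 1, 1 = 1 := by simp
    have h2 : (M.E (∑ _i : Fin 1, 1)).obj (fun _ => Z) = (M.E 1).obj (fun _ => Z) :=
      tobj_congr M.E h1 fun _ => rfl
    have hL := subst_tcast (E := M.E) M.subst (rfl : 1 = 1)
      (n := fun _ => ∑ _i : Fin 1, 1) (n' := fun _ => 1) (fun _ => h1)
      (Z := fun _ _ => Z) (Z' := fun _ _ => Z) (fun _ _ => rfl)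
      (fun _ => h2) (by simp) (fun _ => rfl)
    have hR := subst_tcast (E := M.E) M.subst h1
      (n := fun _ => 1) (n' := fun _ => 1) (fun _ => rfl)
      (Z := fun _ _ => Z) (Z' := fun _ _ => Z) (fun _ _ => rfl) (fun _ => rfl) (by simp)
      (fun _ => rfl)
    have hT : tmap M.E (fun _ : Fin 1 => M.subst (fun _ : Fin 1 => 1) (fun _ _ => Z) ≫
        tcast M.E h1 (X := fun _ => Z) (Y := fun _ => Z) (fun _ => rfl)) =
        tmap M.E (fun _ : Fin 1 => M.subst (fun _ : Fin 1 => 1) (fun _ _ => Z)) ≫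
        tcast M.E rfl (fun _ => h2) :=
      (tmap_comp M.E _ _).symm.trans (congrArg (_ ≫ ·) (tmap_eqToHom M.E (fun _ : Fin 1 => h2)))
    refine (congrArg (· ≫ _) hT).trans ?_
    refine (Category.assoc _ _ _).trans ?_
    refine (congrArg (_ ≫ ·) ((Category.assoc _ _ _).symm.trans
      ((congrArg (· ≫ _) hL).trans (Category.assoc _ _ _)))).trans ?_
    refine Eq.trans ?_ (Category.assoc _ _ _).symm
    refine Eq.trans ?_ (congrArg (_ ≫ ·) ((Category.assoc _ _ _).symm.trans
      ((congrArg (· ≫ _) hR).trans (Category.assoc _ _ _)))).symm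
    rw [tcast_trans, tcast_trans]
    have hc := congrArg (· ≫ tcast M.E (show ∑ l, flat (fun (_ : Fin 1) (_ : Fin 1) => 1) l = 1 by
      simp [flat]) (X := fun _ => Z) (Y := fun _ => Z) (fun _ => rfl)) hA
    refine Eq.trans ?_ (hc.trans (Category.assoc _ _ _))
    refine Eq.trans ?_ (Category.assoc _ _ _).symm
    refine congrArg (_ ≫ ·) ?_
    refine Eq.trans ?_ (Category.assoc _ _ _).symm
    refine congrArg (_ ≫ ·) ?_
    exact (tcast_trans M.E _ _ _ _).symm

/-- A multitensor map between multitensors on the same category: a natural family of maps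
`E X ⟶ F X` compatible with units and substitutions. -/
structure IsMultitensorMap (M N : Multitensor V) (φ : ∀ n (X : Fin n → V), (M.E n).obj X ⟶ (N.E n).obj X) :
    Prop where
  natural : ∀ {n : ℕ} {X Y : Fin n → V} (f : ∀ i, X i ⟶ Y i),
    tmap M.E f ≫ φ n Y = φ n X ≫ tmap N.E f
  unit : ∀ Z, M.unit Z ≫ φ 1 (fun _ => Z) = N.unit Z
  subst : ∀ {m : ℕ} (n : Fin m → ℕ) (Z : ∀ i, Fin (n i) → V),
    M.subst n Z ≫ φ _ (flat Z) =
      tmap M.E (fun i => φ (n i) (Z i)) ≫ φ m _ ≫ N.subst n Z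

end Tensor

/-! ### Enriched graphs -/

/-- A graph enriched in `V`: a set of objects and for each ordered pair of objects a hom in `V`. -/
structure VGraph (V : Type u) where
  /-- the set of objects -/
  obj : Type w
  /-- the homs -/
  hom : obj → obj → V

/-- The sequence of homs `X(x_{i-1}, x_i)` along a sequence of objects of `X`. -/
abbrev homs {V : Type u} (X : VGraph.{w} V) {a b : X.obj} (x : ObjSeq X.obj a b) : Fin x.len → V :=
  fun i => X.hom (x.vtx i.castSucc) (x.vtx i.succ)

theorem homs_congr {V : Type u} (X : VGraph.{w} V) {a b : X.obj} {x y : ObjSeq X.obj a b} (h : x = y)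
    (hl : x.len = y.len) (i : Fin x.len) : homs X x i = homs X y (Fin.cast hl i) := by
  subst h
  rfl

/-- A morphism of enriched graphs. -/
@[ext]
structure VGraph.Hom {V : Type u} [Category.{v} V] (X Y : VGraph.{w} V) where
  /-- the object function -/
  obj : X.obj → Y.obj
  /-- the hom maps -/
  hom : ∀ a b, X.hom a b ⟶ Y.hom (obj a) (obj b)

section Graph

variable {V : Type u} [Category.{v} V]

/-- The category `G V` of graphs enriched in `V`. -/
instance : Category (VGraph.{w} V) where
  Hom := VGraph.Hom
  id _ := ⟨id, fun _ _ => 𝟙 _⟩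
  comp f g := ⟨g.obj ∘ f.obj, fun a b => f.hom a b ≫ g.hom _ _⟩
  id_comp _ := VGraph.Hom.ext rfl (heq_of_eq (funext fun _ => funext fun _ => Category.id_comp _))
  comp_id _ := VGraph.Hom.ext rfl (heq_of_eq (funext fun _ => funext fun _ => Category.comp_id _))
  assoc _ _ _ :=
    VGraph.Hom.ext rfl (heq_of_eq (funext fun _ => funext fun _ => Category.assoc _ _ _))

theorem VGraph.hom_ext {X Y : VGraph.{w} V} {φ : X.obj → Y.obj}
    {f g : ∀ a b, X.hom a b ⟶ Y.hom (φ a) (φ b)} (h : ∀ a b, f a b = g a b) :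
    (⟨φ, f⟩ : X ⟶ Y) = ⟨φ, g⟩ :=
  VGraph.Hom.ext rfl (heq_of_eq (funext fun a => funext fun b => h a b))

theorem VGraph.hom_eqToHom {X Y : VGraph.{w} V} (f : X ⟶ Y) {a b a' b' : X.obj} (ha : a = a')
    (hb : b = b') (h : X.hom a b = X.hom a' b')
    (h' : Y.hom (f.obj a) (f.obj b) = Y.hom (f.obj a') (f.obj b')) :
    f.hom a b ≫ eqToHom h' = eqToHom h ≫ f.hom a' b' := by
  subst ha hb
  exact (Category.comp_id _).trans (Category.id_comp _).symm

/-- The functor `G H : G V ⥤ G W` applying `H` to the homs. -/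
def graphFunctor {W : Type*} [Category W] (H : V ⥤ W) : VGraph.{w} V ⥤ VGraph.{w} W where
  obj X := ⟨X.obj, fun a b => H.obj (X.hom a b)⟩
  map f := ⟨f.obj, fun a b => H.map (f.hom a b)⟩
  map_id _ := VGraph.hom_ext fun _ _ => H.map_id _
  map_comp _ _ := VGraph.hom_ext fun _ _ => H.map_comp _ _

/-- The monad `G(T)` on `G V` induced by a monad `T` on `V`; its unit and multiplication are
identities on objects and are those of `T` on homs. -/
def graphMonad (T : Monad V) : Monad (VGraph.{w} V) where
  toFunctor := graphFunctor T.toFunctor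
  η :=
    { app := fun X => ⟨id, fun a b => T.η.app (X.hom a b)⟩
      naturality := fun _ _ _ => VGraph.hom_ext fun _ _ => T.η.naturality _ }
  μ :=
    { app := fun X => ⟨id, fun a b => T.μ.app (X.hom a b)⟩
      naturality := fun _ _ _ => VGraph.hom_ext fun _ _ => T.μ.naturality _ }
  assoc _ := VGraph.hom_ext fun _ _ => T.assoc _
  left_unit _ := VGraph.hom_ext fun _ _ => T.left_unit _
  right_unit _ := VGraph.hom_ext fun _ _ => T.right_unit _

/-- `E_i X(x_{i-1}, x_i)` -/
abbrev seqTensor (E : TensorFunctor V) (X : VGraph.{w} V) {a b : X.obj} (x : ObjSeq X.obj a b) :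
    V :=
  (E x.len).obj (homs X x)

/-- The identity `E_1 X(a, b) ⟶ E_i X(x_{i-1}, x_i)` for the sequence `x = (a, b)`. -/
def singleCast (E : TensorFunctor V) (X : VGraph.{w} V) (a b : X.obj) :
    (E 1).obj (fun _ => X.hom a b) ⟶ seqTensor E X (ObjSeq.single a b) :=
  tcast E rfl fun i => (congrArg₂ X.hom (ObjSeq.single_castSucc a b i)
    (ObjSeq.single_succ a b i)).symm

/-- The identity from `E_{ij} X(x_{ij-1}, x_{ij})`, for a doubly nested sequence `x_{ij}`, to the
tensor product along the concatenated sequence. -/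
def concatCast (E : TensorFunctor V) (X : VGraph.{w} V) {a b : X.obj} (x : ObjSeq X.obj a b)
    (y : ∀ i : Fin x.len, ObjSeq X.obj (x.vtx i.castSucc) (x.vtx i.succ)) :
    (E (∑ i, (y i).len)).obj (flat fun i => homs X (y i)) ⟶ seqTensor E X (x.concat y) :=
  tcast E rfl fun l => congrArg₂ X.hom (ObjSeq.concat_castSucc x y l) (ObjSeq.concat_succ x y l)

/-- The map `E_i X(x_{i-1}, x_i) ⟶ E_i Y(f x_{i-1}, f x_i)` induced by `f : X ⟶ Y`. -/
abbrev seqTensorMap (E : TensorFunctor V) {X Y : VGraph.{w} V} (f : X ⟶ Y) {a b : X.obj}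
    (x : ObjSeq X.obj a b) : seqTensor E X x ⟶ seqTensor E Y (x.map f.obj) :=
  tmap E (X := homs X x) (Y := homs Y (x.map f.obj)) fun _ => f.hom _ _

/-! ### Categories enriched in a multitensor -/

/-- A category enriched in the multitensor `M`. -/
structure ECat (M : Multitensor V) where
  /-- the underlying graph -/
  graph : VGraph.{w} V
  /-- the composition maps -/
  comp : ∀ {a b : graph.obj} (x : ObjSeq graph.obj a b), seqTensor M.E graph x ⟶ graph.hom a b
  unit_comp : ∀ a b : graph.obj,
    M.unit (graph.hom a b) ≫ singleCast M.E graph a b ≫ comp (ObjSeq.single a b) = 𝟙 _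
  subst_comp : ∀ {a b : graph.obj} (x : ObjSeq graph.obj a b)
    (y : ∀ i : Fin x.len, ObjSeq graph.obj (x.vtx i.castSucc) (x.vtx i.succ)),
    tmap M.E (fun i => comp (y i)) ≫ comp x =
      M.subst (fun i => (y i).len) (fun i => homs graph (y i)) ≫
        concatCast M.E graph x y ≫ comp (x.concat y)

/-- An `E`-functor: a morphism of graphs compatible with the compositions. -/
@[ext]
structure ECat.Hom {M : Multitensor V} (X Y : ECat.{w} M) where
  /-- the underlying morphism of graphs -/
  toHom : X.graph ⟶ Y.graph
  comm : ∀ {a b : X.graph.obj} (x : ObjSeq X.graph.obj a b),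
    X.comp x ≫ toHom.hom a b = seqTensorMap M.E toHom x ≫ Y.comp (x.map toHom.obj)

/-- The category `E`-Cat. -/
instance (M : Multitensor V) : Category (ECat.{w} M) where
  Hom := ECat.Hom
  id X := ⟨𝟙 _, fun x => (Category.comp_id _).trans
    ((Category.id_comp _).symm.trans (congrArg (· ≫ _) (tmap_id M.E _).symm))⟩
  comp {X Y Z} f g := ⟨f.toHom ≫ g.toHom, fun {a b} x => by
    have h1 := f.comm x
    have h2 := g.comm (x.map f.toHom.obj)
    refine (Category.assoc _ _ _).symm.trans ((congrArg (· ≫ _) h1).trans ?_)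
    refine (Category.assoc _ _ _).trans ((congrArg (_ ≫ ·) h2).trans ?_)
    refine (Category.assoc _ _ _).symm.trans (congrArg (· ≫ _) ?_)
    exact tmap_comp M.E _ _⟩
  id_comp f := ECat.Hom.ext (Category.id_comp _)
  comp_id f := ECat.Hom.ext (Category.comp_id _)
  assoc f g h := ECat.Hom.ext (Category.assoc _ _ _)

/-- The forgetful functor `U^E` from `E`-Cat to `G V`. -/
def ECat.forget (M : Multitensor V) : ECat.{w} M ⥤ VGraph.{w} V where
  obj X := X.graph
  map f := f.toHom

/-! ### Monoidal monads and composite multitensors -/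

/-- Coherence data `τ : E_i T X_i ⟶ T E_i X_i` making the monad `T` into a monoidal monad on
`(V, E)`: `(T, τ)` is a lax monoidal functor and the unit and multiplication of `T` are monoidal
natural transformations. -/
@[ext]
structure MonoidalCoherence (M : Multitensor V) (T : Monad V) where
  /-- the coherence maps -/
  τ : ∀ {n : ℕ} (X : Fin n → V), (M.E n).obj (fun i => T.obj (X i)) ⟶ T.obj ((M.E n).obj X)
  natural : ∀ {n : ℕ} {X Y : Fin n → V} (f : ∀ i, X i ⟶ Y i),
    tmap M.E (fun i => T.map (f i)) ≫ τ Y = τ X ≫ T.map (tmap M.E f)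
  unit : ∀ X : V, M.unit (T.obj X) ≫ τ (fun _ : Fin 1 => X) = T.map (M.unit X)
  subst : ∀ {m : ℕ} (n : Fin m → ℕ) (Z : ∀ i, Fin (n i) → V),
    tmap M.E (fun i => τ (Z i)) ≫ τ (fun i => (M.E (n i)).obj (Z i)) ≫ T.map (M.subst n Z) =
      M.subst n (fun i j => T.obj (Z i j)) ≫ τ (flat Z)
  monad_unit : ∀ {n : ℕ} (X : Fin n → V),
    tmap M.E (fun i => T.η.app (X i)) ≫ τ X = T.η.app ((M.E n).obj X)
  monad_mul : ∀ {n : ℕ} (X : Fin n → V),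
    tmap M.E (fun i => T.μ.app (X i)) ≫ τ X =
      τ (fun i => T.obj (X i)) ≫ T.map (τ X) ≫ T.μ.app ((M.E n).obj X)

/-- The functor `T E`. -/
abbrev compTensor (M : Multitensor V) (T : Monad V) : TensorFunctor V :=
  fun n => M.E n ⋙ T.toFunctor

/-- The unit `u'_X = η_{E_1 X} u_X` of `T E`. -/
abbrev compUnit (M : Multitensor V) (T : Monad V) : TensorUnit (compTensor M T) :=
  fun X => M.unit X ≫ T.η.app ((M.E 1).obj (fun _ => X))

/-- Substitutions `σ'` for a multitensor `(T E, u', σ')` such that `η E` is a multitensor map, `T u`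
is a monad map, and the middle unit law `σ' (T u η E) = id` holds. -/
@[ext]
structure CompositeMultitensor (M : Multitensor V) (T : Monad V) where
  /-- the substitution `σ' : T E_i T E_j X_{ij} ⟶ T E_{ij} X_{ij}` -/
  subst : TensorSubst (compTensor M T)
  isMultitensor : IsMultitensor (compTensor M T) (compUnit M T) subst
  isMultitensorMap : IsMultitensorMap M ⟨compTensor M T, compUnit M T, subst, isMultitensor⟩
    (fun n X => T.η.app ((M.E n).obj X))
  isMonadMap : ∃ φ : T ⟶ Multitensor.unaryMonad ⟨compTensor M T, compUnit M T, subst, isMultitensor⟩,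
    ∀ X, φ.app X = T.map (M.unit X)
  middle_unit : ∀ {n : ℕ} (X : Fin n → V),
    T.map (M.unit ((M.E n).obj X)) ≫
        T.map (tmap M.E (fun _ : Fin 1 => T.η.app ((M.E n).obj X))) ≫
        subst (fun _ : Fin 1 => n) (fun _ => X) ≫ tcast (compTensor M T) (by simp) (flat_unit_left X) =
      𝟙 _

/-- The multitensor `(T E, u', σ')`. -/
abbrev CompositeMultitensor.toMultitensor {M : Multitensor V} {T : Monad V}
    (s : CompositeMultitensor M T) : Multitensor V :=
  ⟨compTensor M T, compUnit M T, s.subst, s.isMultitensor⟩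

/-! ### Liftings and distributive laws of monads -/

/-- A lifting of a monad `S` on `G V` to `E`-Cat: a monad `S'` on `E`-Cat such that
`S U = U S'`, `η U = U η'` and `μ U = U μ'`. -/
@[ext]
structure Lifting (M : Multitensor V) (S : Monad (VGraph.{w} V)) where
  /-- the lifted monad -/
  monad : Monad (ECat.{w} M)
  functor_eq : ECat.forget M ⋙ S.toFunctor = monad.toFunctor ⋙ ECat.forget M
  unit_eq : ∀ X, S.η.app ((ECat.forget M).obj X) ≫ eqToHom (Functor.congr_obj functor_eq X) =
    (ECat.forget M).map (monad.η.app X)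
  mul_eq : ∀ X, S.μ.app ((ECat.forget M).obj X) ≫ eqToHom (Functor.congr_obj functor_eq X) =
    S.map (eqToHom (Functor.congr_obj functor_eq X)) ≫
      eqToHom (Functor.congr_obj functor_eq (monad.obj X)) ≫
      (ECat.forget M).map (monad.μ.app X)

/-- A distributive law of the monad `S` over the monad `R`. -/
@[ext]
structure DistributiveLaw {C : Type*} [Category C] (S R : Monad C) where
  /-- the natural transformation `R S ⟶ S R` -/
  app : ∀ X : C, R.obj (S.obj X) ⟶ S.obj (R.obj X)
  natural : ∀ {X Y : C} (f : X ⟶ Y), R.map (S.map f) ≫ app Y = app X ≫ S.map (R.map f)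
  unit_left : ∀ X, R.η.app (S.obj X) ≫ app X = S.map (R.η.app X)
  unit_right : ∀ X, R.map (S.η.app X) ≫ app X = S.η.app (R.obj X)
  mul_left : ∀ X, R.μ.app (S.obj X) ≫ app X =
    R.map (app X) ≫ app (R.obj X) ≫ S.map (R.μ.app X)
  mul_right : ∀ X, R.map (S.μ.app X) ≫ app X =
    app (S.obj X) ≫ S.map (app X) ≫ S.μ.app (R.obj X)

end Graph

/-! ### Distributivity in all variables simultaneously -/

section Distributive

variable {V : Type u} [Category.{v} V]

theorem IsDistributive.existsUnique_one {E : TensorFunctor V} (hE : IsDistributive.{w} E) {n : ℕ}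
    (Q : Fin n → V) (i : Fin n) {J : Type w} (P : J → Fin n → V) (p : ∀ j k, P j k ⟶ Q k)
    (hiso : ∀ j k, k ≠ i → IsIso (p j k))
    (hc : Nonempty (IsColimit (Cofan.mk (Q i) (fun j => p j i))))
    {A : V} (g : ∀ j, (E n).obj (P j) ⟶ A) :
    ∃! h : (E n).obj Q ⟶ A, ∀ j, tmap E (p j) ≫ h = g j := by
  obtain ⟨hc⟩ := hc
  let F : Fin n → V ⥤ V := fun k => if k = i then 𝟭 V else (Functor.const V).obj (Q k)
  have hF : ∀ k, ∃ (a : ∀ j, (F k).obj (P j i) ≅ P j k) (b : (F k).obj (Q i) ≅ Q k),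
      ∀ j, (a j).hom ≫ p j k = (F k).map (p j i) ≫ b.hom := by
    intro k
    by_cases h : k = i
    · subst h
      have hk : F k = 𝟭 V := if_pos rfl
      rw [hk]
      exact ⟨fun j => Iso.refl _, Iso.refl _, fun j =>
        (Category.id_comp _).trans (Category.comp_id _).symm⟩
    · have hk : F k = (Functor.const V).obj (Q k) := if_neg h
      rw [hk]
      have := fun j => hiso j k h
      exact ⟨fun j => (asIso (p j k)).symm, Iso.refl _, fun j => by simp⟩
  choose a b hab using hF
  let Φ : V ⥤ (Fin n → V) := Functor.pi' F
  have hP : PreservesColimitsOfShape (Discrete J) (Φ ⋙ E n) := hE n Q i J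
  have hc' := isColimitCofanMkObjOfIsColimit (Φ ⋙ E n) _ _ hc
  have hab' : ∀ k j, p j k ≫ (b k).inv = (a k j).inv ≫ (F k).map (p j i) := by
    intro k j
    rw [Iso.comp_inv_eq, Category.assoc, Iso.eq_inv_comp]
    exact hab k j
  have e1 : ∀ j, tmap E (fun k => (a k j).hom) ≫ tmap E (p j) =
      (Φ ⋙ E n).map (p j i) ≫ tmap E (fun k => (b k).hom) := fun j =>
    (tmap_comp E _ _).trans ((congrArg (tmap E) (funext fun k => hab k j)).trans
      (tmap_comp E _ _).symm)
  have e2 : ∀ j, tmap E (p j) ≫ tmap E (fun k => (b k).inv) =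
      tmap E (fun k => (a k j).inv) ≫ (Φ ⋙ E n).map (p j i) := fun j =>
    (tmap_comp E _ _).trans ((congrArg (tmap E) (funext fun k => hab' k j)).trans
      (tmap_comp E _ _).symm)
  have e3 : ∀ j, tmap E (fun k => (a k j).inv) ≫ tmap E (fun k => (a k j).hom) = 𝟙 _ := fun j =>
    (tmap_comp E _ _).trans ((congrArg (tmap E) (funext fun k => (a k j).inv_hom_id)).trans
      (tmap_id E _))
  have e4 : tmap E (fun k => (b k).inv) ≫ tmap E (fun k => (b k).hom) = 𝟙 _ :=
    (tmap_comp E _ _).trans ((congrArg (tmap E) (funext fun k => (b k).inv_hom_id)).trans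
      (tmap_id E _))
  let d : (Φ ⋙ E n).obj (Q i) ⟶ A :=
    Cofan.IsColimit.desc hc' (fun j => tmap E (fun k => (a k j).hom) ≫ g j)
  have hd : ∀ j, (Φ ⋙ E n).map (p j i) ≫ d = tmap E (fun k => (a k j).hom) ≫ g j :=
    fun j => Cofan.IsColimit.fac hc' _ j
  refine ⟨tmap E (fun k => (b k).inv) ≫ d, fun j => ?_, fun h hh => ?_⟩
  · refine (Category.assoc _ _ _).symm.trans ((congrArg (· ≫ d) (e2 j)).trans ?_)
    refine (Category.assoc _ _ _).trans ((congrArg (_ ≫ ·) (hd j)).trans ?_)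
    refine (Category.assoc _ _ _).symm.trans ((congrArg (· ≫ _) (e3 j)).trans ?_)
    exact Category.id_comp _
  · have hd' : tmap E (fun k => (b k).hom) ≫ h = d := by
      refine Cofan.IsColimit.hom_ext hc' _ _ fun j => ?_
      refine Eq.trans ?_ (hd j).symm
      refine (Category.assoc _ _ _).symm.trans ((congrArg (· ≫ h) (e1 j)).symm.trans ?_)
      exact (Category.assoc _ _ _).trans (congrArg (_ ≫ ·) (hh j))
    rw [← hd', ← Category.assoc, e4]
    exact (Category.id_comp _).symm

/-- `F` extended by `C` at `none`. -/
abbrev optObj {J : Type w} (F : J → V) (C : V) : Option J → V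
  | none => C
  | some j => F j

/-- The comparison maps between the values of `optObj`. -/
def optMap {J : Type w} {F : J → V} {C : V} (c : ∀ j, F j ⟶ C) :
    ∀ (o o' : Option J), (o' = none ∨ o' = o) → (optObj F C o ⟶ optObj F C o')
  | none, none, _ => 𝟙 C
  | some j, none, _ => c j
  | o, some j, h => eqToHom (by
      rcases h with h | h
      · cases h
      · rw [h])

theorem optMap_comp {J : Type w} {F : J → V} {C : V} (c : ∀ j, F j ⟶ C) (o o' o'' : Option J)
    (h : o' = none ∨ o' = o) (h' : o'' = none ∨ o'' = o') (h'' : o'' = none ∨ o'' = o) :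
    optMap c o o' h ≫ optMap c o' o'' h' = optMap c o o'' h'' := by
  rcases h with rfl | rfl <;> rcases h' with rfl | rfl
  · cases o <;> simp [optMap]
  · cases o <;> simp [optMap]
  · cases o' <;> simp [optMap]
  · cases o'' <;> simp [optMap]

theorem optMap_isIso {J : Type w} {F : J → V} {C : V} (c : ∀ j, F j ⟶ C) (o o' : Option J)
    (h : o' = none ∨ o' = o) (h' : o = o') : IsIso (optMap c o o' h) := by
  subst h'
  cases o <;> (unfold optMap; infer_instance)

theorem optMap_isColimit {J : Type w} {F : J → V} {C : V} (c : ∀ j, F j ⟶ C)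
    (hc : Nonempty (IsColimit (Cofan.mk C c))) (o : J → Option J) (o' : Option J)
    (ho : ∀ j, o j = some j) (ho' : o' = none) (h : ∀ j, o' = none ∨ o' = o j) :
    Nonempty (IsColimit (Cofan.mk (optObj F C o') (fun j => optMap c (o j) o' (h j)))) := by
  subst ho'
  obtain rfl : o = some := funext ho
  exact hc

theorem IsDistributive.existsUnique_aux {E : TensorFunctor V} (hE : IsDistributive.{w} E) {n : ℕ}
    {J : Fin n → Type w} (F : ∀ i, J i → V) (C : Fin n → V) (c : ∀ i j, F i j ⟶ C i)
    (hc : ∀ i, Nonempty (IsColimit (Cofan.mk (C i) (c i)))) {A : V}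
    (g : ∀ s : ∀ i, J i, (E n).obj (fun i => F i (s i)) ⟶ A) (S : Finset (Fin n)) :
    ∀ t : ∀ i, Option (J i), (∀ i, t i = none ↔ i ∈ S) →
      ∃! h : (E n).obj (fun i => optObj (F i) (C i) (t i)) ⟶ A,
        ∀ (s : ∀ i, J i) (hs : ∀ i, t i = none ∨ t i = some (s i)),
          tmap E (fun i => optMap (c i) (some (s i)) (t i) (hs i)) ≫ h = g s := by
  classical
  induction S using Finset.induction with
  | empty =>
    intro t ht
    have ht' : ∀ i, ∃ j, t i = some j := fun i => by
      rcases h : t i with _ | j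
      · exact absurd ((ht i).1 h) (by simp)
      · exact ⟨j, rfl⟩
    choose s₀ hs₀ using ht'
    obtain rfl : t = fun i => some (s₀ i) := funext hs₀
    refine ⟨g s₀, fun s hs => ?_, fun h hh => ?_⟩
    · obtain rfl : s₀ = s := funext fun i => by
        rcases hs i with h | h
        · cases h
        · exact Option.some.inj h
      exact (congrArg (· ≫ g s₀) (tmap_id E _)).trans (Category.id_comp _)
    · have := hh s₀ (fun i => Or.inr rfl)
      exact ((Category.id_comp _).symm.trans (congrArg (· ≫ h) (tmap_id E _).symm)).trans this
  | insert a S ha ih =>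
    intro t ht
    have hta : t a = none := (ht a).2 (Finset.mem_insert_self a S)
    let t' : J a → ∀ i, Option (J i) := fun j => Function.update t a (some j)
    have ht'a : ∀ j, t' j a = some j := fun j => Function.update_self ..
    have ht'n : ∀ j k, k ≠ a → t' j k = t k := fun j k hk => Function.update_of_ne hk ..
    have hle : ∀ j k, t k = none ∨ t k = t' j k := fun j k => by
      by_cases hk : k = a
      · subst hk; exact Or.inl hta
      · exact Or.inr (ht'n j k hk).symm
    have ht'S : ∀ j i, t' j i = none ↔ i ∈ S := fun j i => by
      by_cases hi : i = a
      · subst hi; rw [ht'a]; simp [ha]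
      · rw [ht'n j i hi, ht i]; simp [hi]
    choose g' hg' hg'u using fun j => ih (t' j) (ht'S j)
    obtain ⟨h, hh, hu⟩ := hE.existsUnique_one (fun i => optObj (F i) (C i) (t i)) a
      (fun j i => optObj (F i) (C i) (t' j i))
      (fun j i => optMap (c i) (t' j i) (t i) (hle j i))
      (fun j k hk => optMap_isIso _ _ _ _ (ht'n j k hk))
      (optMap_isColimit (c a) (hc a) (fun j => t' j a) (t a) ht'a hta _) g'
    have hcomp : ∀ (j : J a) (s : ∀ i, J i) (hs : ∀ i, t i = none ∨ t i = some (s i))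
        (hs' : ∀ i, t' j i = none ∨ t' j i = some (s i)),
        tmap E (fun i => optMap (c i) (some (s i)) (t' j i) (hs' i)) ≫
          tmap E (fun i => optMap (c i) (t' j i) (t i) (hle j i)) =
        tmap E (fun i => optMap (c i) (some (s i)) (t i) (hs i)) := fun j s hs hs' =>
      (tmap_comp E _ _).trans (congrArg (tmap E) (funext fun i => optMap_comp _ _ _ _ _ _ _))
    refine ⟨h, fun s hs => ?_, fun h' hh' => hu h' fun j => hg'u j _ fun s hs' => ?_⟩
    · have hs' : ∀ i, t' (s a) i = none ∨ t' (s a) i = some (s i) := fun i => by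
        by_cases hi : i = a
        · subst hi; exact Or.inr (ht'a _)
        · rw [ht'n _ i hi]; exact hs i
      rw [← hcomp (s a) s hs hs', Category.assoc, hh]
      exact hg' (s a) s hs'
    · have hs : ∀ i, t i = none ∨ t i = some (s i) := fun i => by
        by_cases hi : i = a
        · subst hi; exact Or.inl hta
        · rw [← ht'n j i hi]; exact hs' i
      rw [← Category.assoc, hcomp j s hs hs']
      exact hh' s hs

/-- If the `n`-ary functors of `E` preserve coproducts in each variable, then `E` sends a sequence
of coproducts to a coproduct over all sequences of summands. -/
theorem IsDistributive.existsUnique {E : TensorFunctor V} (hE : IsDistributive.{w} E) {n : ℕ}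
    {J : Fin n → Type w} (F : ∀ i, J i → V) (C : Fin n → V) (c : ∀ i j, F i j ⟶ C i)
    (hc : ∀ i, Nonempty (IsColimit (Cofan.mk (C i) (c i)))) {A : V}
    (g : ∀ s : ∀ i, J i, (E n).obj (fun i => F i (s i)) ⟶ A) :
    ∃! h : (E n).obj C ⟶ A, ∀ s : ∀ i, J i, tmap E (fun i => c i (s i)) ≫ h = g s := by
  obtain ⟨h, hh, hu⟩ := hE.existsUnique_aux F C c hc g Finset.univ (fun _ => none) (by simp)
  exact ⟨h, fun s => hh s (fun _ => Or.inl rfl), fun h' hh' => hu h' fun s _ => hh' s⟩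

end Distributive

/-! ### The monad on enriched graphs induced by a distributive multitensor -/

theorem comp_whisker {C : Type*} [Category C] {A B B' D D' : C} {f : A ⟶ B} {g : B ⟶ D}
    {f' : A ⟶ B'} {g' : B' ⟶ D} (h : f ≫ g = f' ≫ g') (k : D ⟶ D') :
    f ≫ g ≫ k = f' ≫ g' ≫ k := by
  rw [← Category.assoc, h, Category.assoc]

section Gamma

variable {V : Type u} [Category.{v} V] [HasCoproducts.{w} V]

/-- The graph `Γ E (X)`: the same objects as `X`, and
`Γ E (X)(a, b) = ∐_{a = x_0, …, x_n = b} E_i X(x_{i-1}, x_i)`. -/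
noncomputable abbrev gammaObj (E : TensorFunctor V) (X : VGraph.{w} V) : VGraph.{w} V where
  obj := X.obj
  hom a b := ∐ fun x : ObjSeq X.obj a b => seqTensor E X x

/-- The coproduct inclusions `k`. -/
noncomputable abbrev gammaIncl (E : TensorFunctor V) (X : VGraph.{w} V) {a b : X.obj}
    (x : ObjSeq X.obj a b) : seqTensor E X x ⟶ (gammaObj E X).hom a b :=
  Sigma.ι (fun x : ObjSeq X.obj a b => seqTensor E X x) x

/-- The hom maps of `Γ E (f)`. -/
noncomputable def gammaMapHom (E : TensorFunctor V) {X Y : VGraph.{w} V} (f : X ⟶ Y)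
    (a b : X.obj) : (gammaObj E X).hom a b ⟶ (gammaObj E Y).hom (f.obj a) (f.obj b) :=
  Sigma.desc fun x : ObjSeq X.obj a b => seqTensorMap E f x ≫ gammaIncl E Y (x.map f.obj)

theorem gammaIncl_map (E : TensorFunctor V) {X Y : VGraph.{w} V} (f : X ⟶ Y) {a b : X.obj}
    (x : ObjSeq X.obj a b) :
    gammaIncl E X x ≫ gammaMapHom E f a b = seqTensorMap E f x ≫ gammaIncl E Y (x.map f.obj) :=
  Sigma.ι_desc _ _

theorem gamma_hom_ext_one {E : TensorFunctor V} {X : VGraph.{w} V} {a b : X.obj} {A : V}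
    {f g : (gammaObj E X).hom a b ⟶ A}
    (h : ∀ x : ObjSeq X.obj a b, gammaIncl E X x ≫ f = gammaIncl E X x ≫ g) : f = g :=
  Sigma.hom_ext _ _ h

/-- The action of `Γ E` on morphisms. -/
noncomputable abbrev gammaMap (E : TensorFunctor V) {X Y : VGraph.{w} V} (f : X ⟶ Y) :
    gammaObj E X ⟶ gammaObj E Y :=
  ⟨f.obj, gammaMapHom E f⟩

/-- The functor `Γ E`. -/
noncomputable def gammaFunctor (E : TensorFunctor V) : VGraph.{w} V ⥤ VGraph.{w} V where
  obj X := gammaObj E X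
  map f := gammaMap E f
  map_id X := VGraph.hom_ext fun a b => gamma_hom_ext_one fun x =>
    (gammaIncl_map E (𝟙 X) x).trans ((eq_whisker (tmap_id E (homs X x)) _).trans
      ((Category.id_comp _).trans (Category.comp_id _).symm))
  map_comp {X Y Z} f g := VGraph.hom_ext fun a b => gamma_hom_ext_one fun x => by
    refine (gammaIncl_map E (f ≫ g) x).trans ?_
    refine Eq.trans ?_ (comp_whisker (gammaIncl_map E f x) (gammaMapHom E g _ _)).symm
    refine Eq.trans ?_ (whisker_eq _ (gammaIncl_map E g (x.map f.obj)).symm)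
    refine Eq.trans ?_ (Category.assoc _ _ _)
    exact eq_whisker (tmap_comp E _ _).symm _

theorem gammaIncl_congr (E : TensorFunctor V) (X : VGraph.{w} V) {a b : X.obj}
    {x y : ObjSeq X.obj a b} (h : x = y) (hl : x.len = y.len)
    (hX : ∀ i, homs X x i = homs X y (Fin.cast hl i)) :
    tcast E hl hX ≫ gammaIncl E X y = gammaIncl E X x := by
  subst h
  exact Category.id_comp _

theorem gammaIncl_copy (E : TensorFunctor V) (X : VGraph.{w} V) {a b a' b' : X.obj}
    (x : ObjSeq X.obj a b) (ha : a = a') (hb : b = b')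
    (h : (gammaObj E X).hom a b = (gammaObj E X).hom a' b') :
    gammaIncl E X x ≫ eqToHom h = gammaIncl E X (x.copy ha hb) := by
  subst ha hb
  exact Category.comp_id _

/-- The hom maps of the unit of `Γ E`. -/
noncomputable def gammaUnitHom (M : Multitensor V) (X : VGraph.{w} V) (a b : X.obj) :
    X.hom a b ⟶ (gammaObj M.E X).hom a b :=
  M.unit (X.hom a b) ≫ singleCast M.E X a b ≫ gammaIncl M.E X (ObjSeq.single a b)

/-- `E_i (Γ E X)(x_{i-1}, x_i)`; a sequence of objects of `Γ E (X)` is a sequence of objects of `X`. -/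
noncomputable abbrev gammaSeqTensor (E : TensorFunctor V) (X : VGraph.{w} V) {a b : X.obj}
    (x : ObjSeq X.obj a b) : V :=
  (E x.len).obj (fun i => (gammaObj E X).hom (x.vtx i.castSucc) (x.vtx i.succ))

/-- The coproduct inclusions for `(Γ E)² X`. -/
noncomputable abbrev gammaIncl₂ (E : TensorFunctor V) (X : VGraph.{w} V) {a b : X.obj}
    (x : ObjSeq X.obj a b) : gammaSeqTensor E X x ⟶ (gammaObj E (gammaObj E X)).hom a b :=
  gammaIncl E (gammaObj E X) (a := a) (b := b) x

/-- Sequences of sequences of objects of `X` that can be concatenated along `x`. -/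
abbrev ObjSeq.Inner {O : Type w} {a b : O} (x : ObjSeq O a b) :=
  ∀ i : Fin x.len, ObjSeq O (x.vtx i.castSucc) (x.vtx i.succ)

theorem gammaMul_existsUnique (M : Multitensor V) (hM : IsDistributive.{w} M.E) (X : VGraph.{w} V)
    {a b : X.obj} (x : ObjSeq X.obj a b) :
    ∃! h : gammaSeqTensor M.E X x ⟶ (gammaObj M.E X).hom a b, ∀ y : x.Inner,
      tmap M.E (fun i => gammaIncl M.E X (y i)) ≫ h =
        M.subst (fun i => (y i).len) (fun i => homs X (y i)) ≫
          concatCast M.E X x y ≫ gammaIncl M.E X (x.concat y) :=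
  hM.existsUnique (J := fun i : Fin x.len => ObjSeq X.obj (x.vtx i.castSucc) (x.vtx i.succ))
    (fun _ y => seqTensor M.E X y) _
    (fun _ y => gammaIncl M.E X y) (fun _ => ⟨coproductIsCoproduct _⟩) _

/-- The hom maps of the multiplication of `Γ E`: the unique maps compatible with `σ` and the
coproduct inclusions `k` and `k^{(2)}`. -/
noncomputable def gammaMulHom (M : Multitensor V) (hM : IsDistributive.{w} M.E) (X : VGraph.{w} V)
    (a b : X.obj) : (gammaObj M.E (gammaObj M.E X)).hom a b ⟶ (gammaObj M.E X).hom a b :=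
  Sigma.desc fun x : ObjSeq X.obj a b => (gammaMul_existsUnique M hM X x).choose

theorem gammaIncl₂_mul (M : Multitensor V) (hM : IsDistributive.{w} M.E) (X : VGraph.{w} V)
    {a b : X.obj} (x : ObjSeq X.obj a b) :
    gammaIncl₂ M.E X x ≫ gammaMulHom M hM X a b = (gammaMul_existsUnique M hM X x).choose :=
  Sigma.ι_desc _ _

theorem gammaMul_spec (M : Multitensor V) (hM : IsDistributive.{w} M.E) (X : VGraph.{w} V)
    {a b : X.obj} (x : ObjSeq X.obj a b) (y : x.Inner) :
    tmap M.E (fun i => gammaIncl M.E X (y i)) ≫ gammaIncl₂ M.E X x ≫ gammaMulHom M hM X a b =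
      M.subst (fun i => (y i).len) (fun i => homs X (y i)) ≫
        concatCast M.E X x y ≫ gammaIncl M.E X (x.concat y) :=
  (whisker_eq _ (gammaIncl₂_mul M hM X x)).trans
    ((gammaMul_existsUnique M hM X x).choose_spec.1 y)

/-- Maps out of `E_i (Γ E X)(x_{i-1}, x_i)` are determined on doubly nested sequences. -/
theorem gamma_hom_ext_two {E : TensorFunctor V} (hE : IsDistributive.{w} E) {X : VGraph.{w} V}
    {a b : X.obj} (x : ObjSeq X.obj a b) {A : V} {f g : gammaSeqTensor E X x ⟶ A}
    (h : ∀ y : x.Inner,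
      tmap E (fun i => gammaIncl E X (y i)) ≫ f = tmap E (fun i => gammaIncl E X (y i)) ≫ g) :
    f = g :=
  (hE.existsUnique (J := fun i : Fin x.len => ObjSeq X.obj (x.vtx i.castSucc) (x.vtx i.succ))
    (fun _ y => seqTensor E X y) _
    (fun _ y => gammaIncl E X y) (fun _ => ⟨coproductIsCoproduct _⟩) _).unique h (fun _ => rfl)

theorem gammaUnit_natural (M : Multitensor V) {X Y : VGraph.{w} V} (f : X ⟶ Y) (a b : X.obj) :
    f.hom a b ≫ gammaUnitHom M Y (f.obj a) (f.obj b) =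
      gammaUnitHom M X a b ≫ gammaMapHom M.E f a b := by
  have h1 := M.isMultitensor.unit_natural (f.hom a b)
  have hmap : (ObjSeq.single a b).map f.obj = ObjSeq.single (f.obj a) (f.obj b) :=
    ObjSeq.ext_of rfl fun i => (congrArg f.obj (ObjSeq.single_succ a b i)).trans
      (ObjSeq.single_succ (f.obj a) (f.obj b) i).symm
  have hV : ∀ i, homs Y ((ObjSeq.single a b).map f.obj) i
      = homs Y (ObjSeq.single (f.obj a) (f.obj b)) i := fun i => congrArg₂ Y.hom
    ((congrArg f.obj (ObjSeq.single_castSucc a b i)).trans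
      (ObjSeq.single_castSucc (f.obj a) (f.obj b) i).symm)
    ((congrArg f.obj (ObjSeq.single_succ a b i)).trans
      (ObjSeq.single_succ (f.obj a) (f.obj b) i).symm)
  have hU : ∀ i : Fin 1, Y.hom (f.obj a) (f.obj b) =
      homs Y ((ObjSeq.single a b).map f.obj) i := fun i => congrArg₂ Y.hom
    (congrArg f.obj (ObjSeq.single_castSucc a b i)).symm
    (congrArg f.obj (ObjSeq.single_succ a b i)).symm
  have h2 : tmap M.E (fun _ : Fin 1 => f.hom a b) ≫ tcast M.E rfl hU =
      singleCast M.E X a b ≫ seqTensorMap M.E f (ObjSeq.single a b) :=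
    tcast_tmap M.E rfl _ _ _ _ fun i => VGraph.hom_eqToHom f
      (ObjSeq.single_castSucc a b i).symm (ObjSeq.single_succ a b i).symm _ _
  have h3 := gammaIncl_congr M.E Y hmap rfl hV
  have h4 : tcast M.E rfl hU ≫ tcast M.E rfl hV = singleCast M.E Y (f.obj a) (f.obj b) :=
    tcast_trans M.E _ _ _ _
  have h5 := gammaIncl_map M.E f (ObjSeq.single a b)
  unfold gammaUnitHom
  rw [Category.assoc, Category.assoc, h5, ← h4, ← h3]
  refine (comp_whisker h1 _).trans (whisker_eq _ ?_)
  refine (whisker_eq _ (Category.assoc _ _ _)).trans ?_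
  exact comp_whisker h2 _

theorem gammaMul_natural (M : Multitensor V) (hM : IsDistributive.{w} M.E) {X Y : VGraph.{w} V}
    (f : X ⟶ Y) (a b : X.obj) :
    gammaMapHom M.E (gammaMap M.E f) a b ≫ gammaMulHom M hM Y (f.obj a) (f.obj b) =
      gammaMulHom M hM X a b ≫ gammaMapHom M.E f a b :=
  gamma_hom_ext_one (X := gammaObj M.E X) (a := a) (b := b) fun x =>
    gamma_hom_ext_two (X := X) hM x fun y => by
    have hV : ∀ l, homs Y ((x.map f.obj).concat (fun i => (y i).map f.obj)) l
        = homs Y ((x.concat y).map f.obj) l := fun l =>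
      congrArg₂ Y.hom (ObjSeq.concat_map_vtx f.obj x y _) (ObjSeq.concat_map_vtx f.obj x y _)
    have h1 := gammaIncl_map M.E (gammaMap M.E f) x
    have h2 : tmap M.E (fun i => gammaIncl M.E X (y i)) ≫
          seqTensorMap M.E (gammaMap M.E f) x =
        tmap M.E (fun i => seqTensorMap M.E f (y i)) ≫
          tmap M.E (fun i => gammaIncl M.E Y ((y i).map f.obj)) :=
      (tmap_comp M.E _ _).trans ((congrArg (tmap M.E)
        (funext fun i => gammaIncl_map M.E f (y i))).trans (tmap_comp M.E _ _).symm)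
    have h3 := gammaMul_spec M hM Y (x.map f.obj) (fun i => (y i).map f.obj)
    have h4 := M.isMultitensor.subst_natural (fun i => (y i).len) (fun i => homs X (y i))
      (fun i => homs Y ((y i).map f.obj)) (fun _ _ => f.hom _ _)
    have h5 : tmap M.E (X := flat (fun i => homs X (y i)))
          (Y := flat (fun i => homs Y ((y i).map f.obj))) (fun _ => f.hom _ _) ≫
          concatCast M.E Y (x.map f.obj) (fun i => (y i).map f.obj) ≫ tcast M.E rfl hV =
        concatCast M.E X x y ≫ seqTensorMap M.E f (x.concat y) := by
      unfold concatCast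
      refine (whisker_eq _ (tcast_trans M.E _ _ _ _)).trans ?_
      exact tcast_tmap M.E rfl _ _ _ _ fun l => VGraph.hom_eqToHom f
        (ObjSeq.concat_castSucc x y l) (ObjSeq.concat_succ x y l) _ _
    have h6 := gammaIncl_congr M.E Y (ObjSeq.concat_map f.obj x y) rfl hV
    have h7 := gammaMul_spec M hM X x y
    have h8 := gammaIncl_map M.E f (x.concat y)
    -- left hand side
    refine (whisker_eq _ (comp_whisker h1 (gammaMulHom M hM Y _ _))).trans ?_
    refine (comp_whisker h2 _).trans ?_
    refine (whisker_eq _ h3).trans ?_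
    refine (comp_whisker h4 _).trans ?_
    refine Eq.trans ?_ (Eq.trans (eq_whisker h7 (gammaMapHom M.E f a b)).symm ?_)
    · refine Eq.trans ?_ (Category.assoc _ _ _).symm
      refine whisker_eq _ ?_
      refine Eq.trans ?_ (Category.assoc _ _ _).symm
      refine Eq.trans ?_ (whisker_eq _ h8.symm)
      refine Eq.trans (whisker_eq _ (whisker_eq _ h6.symm)) ?_
      refine Eq.trans (whisker_eq _ (Category.assoc _ _ _).symm) ?_
      exact comp_whisker h5 _
    · exact (Category.assoc _ _ _).trans (whisker_eq _ (Category.assoc _ _ _))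

theorem gamma_left_unit (M : Multitensor V) (hM : IsDistributive.{w} M.E) (X : VGraph.{w} V)
    (a b : X.obj) :
    gammaUnitHom M (gammaObj M.E X) a b ≫ gammaMulHom M hM X a b = 𝟙 _ :=
  gamma_hom_ext_one fun x => by
    let y : (ObjSeq.single a b).Inner := fun i =>
      x.copy (ObjSeq.single_castSucc a b i).symm (ObjSeq.single_succ a b i).symm
    have h1 := M.isMultitensor.unit_natural (gammaIncl M.E X x)
    have h2 : tmap M.E (fun _ : Fin 1 => gammaIncl M.E X x) ≫ singleCast M.E (gammaObj M.E X) a b =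
        tmap M.E (fun i => gammaIncl M.E X (y i)) := by
      refine (tcast_tmap M.E (X := fun _ : Fin 1 => seqTensor M.E X x)
        (Y := fun i => seqTensor M.E X (y i)) rfl (fun _ => rfl) _ _
        (fun i => gammaIncl M.E X (y i)) fun i => ?_).trans (Category.id_comp _)
      exact (gammaIncl_copy M.E X x (ObjSeq.single_castSucc a b i).symm
        (ObjSeq.single_succ a b i).symm _).trans (Category.id_comp _).symm
    have h3 := gammaMul_spec M hM X (ObjSeq.single a b) y
    have h4 := M.isMultitensor.unit_left (homs X x)
    have hl : ∑ _i : Fin 1, x.len = x.len := by simp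
    have hX := homs_congr X (ObjSeq.concat_single_left x) hl
    have h5 := gammaIncl_congr M.E X (ObjSeq.concat_single_left x) hl hX
    have h6 : concatCast M.E X (ObjSeq.single a b) y ≫ tcast M.E hl hX =
        tcast M.E hl (flat_unit_left (homs X x)) := tcast_trans M.E _ _ _ _
    refine Eq.trans ?_ (Category.comp_id _).symm
    unfold gammaUnitHom
    refine (whisker_eq _ (Category.assoc _ _ _)).trans ?_
    refine (comp_whisker h1 _).trans ?_
    refine (whisker_eq _ (whisker_eq _ (Category.assoc _ _ _))).trans ?_
    refine (whisker_eq _ ((Category.assoc _ _ _).symm.trans (eq_whisker h2 _))).trans ?_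
    refine (whisker_eq _ h3).trans ?_
    refine (whisker_eq _ (whisker_eq _ (whisker_eq _ h5.symm))).trans ?_
    refine (whisker_eq _ (whisker_eq _ (Category.assoc _ _ _).symm)).trans ?_
    refine (whisker_eq _ (whisker_eq _ (eq_whisker h6 _))).trans ?_
    refine (whisker_eq _ (Category.assoc _ _ _).symm).trans ?_
    refine (Category.assoc _ _ _).symm.trans ?_
    exact (eq_whisker h4 _).trans (Category.id_comp _)

/-- The unit of `Γ E` as a morphism of graphs. -/
noncomputable abbrev gammaUnit (M : Multitensor V) (X : VGraph.{w} V) : X ⟶ gammaObj M.E X :=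
  ⟨id, gammaUnitHom M X⟩

/-- The multiplication of `Γ E` as a morphism of graphs. -/
noncomputable abbrev gammaMul (M : Multitensor V) (hM : IsDistributive.{w} M.E)
    (X : VGraph.{w} V) : gammaObj M.E (gammaObj M.E X) ⟶ gammaObj M.E X :=
  ⟨id, gammaMulHom M hM X⟩

theorem gamma_right_unit (M : Multitensor V) (hM : IsDistributive.{w} M.E) (X : VGraph.{w} V)
    (a b : X.obj) :
    gammaMapHom M.E (gammaUnit M X) a b ≫ gammaMulHom M hM X a b = 𝟙 _ :=
  gamma_hom_ext_one fun x => by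
    let y : x.Inner := fun i => ObjSeq.single (x.vtx i.castSucc) (x.vtx i.succ)
    have h1 := gammaIncl_map M.E (gammaUnit M X) x
    have h2 : seqTensorMap M.E (gammaUnit M X) x =
        tmap M.E (fun i => M.unit (homs X x i)) ≫
          tmap M.E (fun i => singleCast M.E X (x.vtx i.castSucc) (x.vtx i.succ)) ≫
            tmap M.E (fun i => gammaIncl M.E X (y i)) := by
      rw [tmap_comp, tmap_comp]
      rfl
    have h3 := gammaMul_spec M hM X x y
    have h4 := M.isMultitensor.unit_right (homs X x)
    have hl : ∑ _i : Fin x.len, 1 = x.len := by simp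
    have hX := homs_congr X (ObjSeq.concat_single_right x) hl
    have h5 := gammaIncl_congr M.E X (ObjSeq.concat_single_right x) hl hX
    have hS : ∀ i (j : Fin 1), homs X x i = homs X (y i) j := fun i j => (congrArg₂ X.hom
      (ObjSeq.single_castSucc (x.vtx i.castSucc) (x.vtx i.succ) j)
      (ObjSeq.single_succ (x.vtx i.castSucc) (x.vtx i.succ) j)).symm
    have h6 : tmap M.E (fun i => singleCast M.E X (x.vtx i.castSucc) (x.vtx i.succ)) ≫
          M.subst (fun i => (y i).len) (fun i => homs X (y i)) =
        M.subst (fun _ => 1) (fun i _ => homs X x i) ≫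
          tcast M.E rfl (fun l => hS _ (finSigmaFinEquiv.symm l).2) := by
      refine (eq_whisker (tmap_eqToHom M.E (fun i => tobj_congr M.E rfl (hS i))) _).trans ?_
      exact subst_tcast (E := M.E) M.subst rfl (n := fun _ => 1) (n' := fun i => (y i).len)
        (fun _ => rfl) hS _ rfl _
    have h7 : tcast M.E rfl (fun l => hS _ (finSigmaFinEquiv.symm l).2) ≫
        concatCast M.E X x y ≫ tcast M.E hl hX = tcast M.E hl (flat_unit_right (homs X x)) :=
      (whisker_eq _ (tcast_trans M.E _ _ _ _)).trans (tcast_trans M.E _ _ _ _)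
    refine Eq.trans ?_ (Category.comp_id _).symm
    refine (comp_whisker h1 _).trans ?_
    refine (eq_whisker h2 _).trans ?_
    refine (Category.assoc _ _ _).trans ?_
    refine (whisker_eq _ ((Category.assoc _ _ _).trans (whisker_eq _ h3))).trans ?_
    refine (whisker_eq _ (comp_whisker h6 _)).trans ?_
    refine (whisker_eq _ (whisker_eq _ (whisker_eq _ (whisker_eq _ h5.symm)))).trans ?_
    refine (whisker_eq _ (whisker_eq _ (whisker_eq _ (Category.assoc _ _ _).symm))).trans ?_
    refine (whisker_eq _ (whisker_eq _ ((Category.assoc _ _ _).symm.trans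
      (eq_whisker h7 _)))).trans ?_
    refine (whisker_eq _ (Category.assoc _ _ _).symm).trans ?_
    refine (Category.assoc _ _ _).symm.trans ?_
    exact (eq_whisker h4 _).trans (Category.id_comp _)

/-- Maps out of `E_i (Γ E)² X(x_{i-1}, x_i)` are determined on triply nested sequences. -/
theorem gamma_hom_ext_three {E : TensorFunctor V} (hE : IsDistributive.{w} E) {X : VGraph.{w} V}
    {a b : X.obj} (x : ObjSeq X.obj a b) (y : x.Inner) {A : V}
    {f g : (E x.len).obj (fun i => gammaSeqTensor E X (y i)) ⟶ A}
    (h : ∀ z : ∀ i, (y i).Inner,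
      tmap E (fun i => tmap E (fun j => gammaIncl E X (z i j))) ≫ f =
        tmap E (fun i => tmap E (fun j => gammaIncl E X (z i j))) ≫ g) :
    f = g := by
  have hc : ∀ i, Nonempty (IsColimit (Cofan.mk (gammaSeqTensor E X (y i))
      (fun z : (y i).Inner => tmap E (fun j => gammaIncl E X (z j))))) := fun i => by
    have hex := fun (B : V) (k : ∀ z : (y i).Inner,
        (E (y i).len).obj (fun j => seqTensor E X (z j)) ⟶ B) =>
      hE.existsUnique (J := fun j : Fin (y i).len =>
        ObjSeq X.obj ((y i).vtx j.castSucc) ((y i).vtx j.succ))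
        (fun _ z => seqTensor E X z) _ (fun _ z => gammaIncl E X z)
        (fun _ => ⟨coproductIsCoproduct _⟩) k
    exact ⟨Cofan.IsColimit.mk _ (fun s => (hex s.pt s.inj).choose)
      (fun s z => (hex s.pt s.inj).choose_spec.1 z)
      (fun s m hm => (hex s.pt s.inj).choose_spec.2 m hm)⟩
  exact (hE.existsUnique (J := fun i : Fin x.len => (y i).Inner)
    (fun i z => (E (y i).len).obj (fun j => seqTensor E X (z j))) _
    (fun _ z => tmap E (fun j => gammaIncl E X (z j))) hc _).unique h (fun _ => rfl)

theorem gamma_assoc (M : Multitensor V) (hM : IsDistributive.{w} M.E) (X : VGraph.{w} V)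
    (a b : X.obj) :
    gammaMapHom M.E (gammaMul M hM X) a b ≫ gammaMulHom M hM X a b =
      gammaMulHom M hM (gammaObj M.E X) a b ≫ gammaMulHom M hM X a b :=
  gamma_hom_ext_one (X := gammaObj M.E (gammaObj M.E X)) (a := a) (b := b) fun x =>
    gamma_hom_ext_two (X := gammaObj M.E X) (a := a) (b := b) hM x fun y =>
      gamma_hom_ext_three (X := X) hM x y fun z => by
    let c : x.Inner := fun i => (y i).concat (z i)
    let w : (x.concat y).Inner := fun l =>
      (z (finSigmaFinEquiv.symm l).1 (finSigmaFinEquiv.symm l).2).copy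
        (ObjSeq.concat_castSucc x y l) (ObjSeq.concat_succ x y l)
    have h1 := gammaIncl_map M.E (gammaMul M hM X) x
    have h2 : tmap M.E (fun i => tmap M.E (fun j => gammaIncl M.E X (z i j))) ≫
          tmap M.E (fun i => gammaIncl₂ M.E X (y i)) ≫
            seqTensorMap M.E (gammaMul M hM X) x =
        tmap M.E (fun i => M.subst (fun j => (z i j).len) (fun j => homs X (z i j))) ≫
          tmap M.E (fun i => concatCast M.E X (y i) (z i)) ≫
            tmap M.E (fun i => gammaIncl M.E X (c i)) := by
      refine (whisker_eq _ (tmap_comp M.E _ _)).trans ((tmap_comp M.E _ _).trans ?_)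
      refine Eq.trans ?_ ((whisker_eq _ (tmap_comp M.E _ _)).trans (tmap_comp M.E _ _)).symm
      exact congrArg (tmap M.E) (funext fun i => gammaMul_spec M hM X (y i) (z i))
    have h3 := gammaMul_spec M hM X x c
    have hC : ∀ i l, flat (fun j => homs X (z i j)) l = homs X (c i) l := fun i l =>
      congrArg₂ X.hom (ObjSeq.concat_castSucc (y i) (z i) l) (ObjSeq.concat_succ (y i) (z i) l)
    have hF : ∀ l, flat (fun i => flat (fun j => homs X (z i j))) l =
        flat (fun i => homs X (c i)) l := fun l => congrArg₂ X.hom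
          (ObjSeq.concat_castSucc _ (z _) _) (ObjSeq.concat_succ _ (z _) _)
    have h4 : tmap M.E (fun i => concatCast M.E X (y i) (z i)) ≫
          M.subst (fun i => (c i).len) (fun i => homs X (c i)) =
        M.subst (fun i => ∑ j, (z i j).len) (fun i => flat (fun j => homs X (z i j))) ≫
          tcast M.E rfl hF := by
      refine (eq_whisker (tmap_eqToHom M.E (fun i => tobj_congr M.E rfl (hC i))) _).trans ?_
      exact subst_tcast (E := M.E) M.subst rfl (n := fun i => ∑ j, (z i j).len)
        (n' := fun i => (c i).len) (fun _ => rfl) hC _ rfl hF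
    have r1 := gammaMul_spec M hM (gammaObj M.E X) x y
    have r1' : tmap M.E (fun i => gammaIncl₂ M.E X (y i)) ≫
          gammaIncl₂ M.E (gammaObj M.E X) x ≫ gammaMulHom M hM (gammaObj M.E X) a b ≫
            gammaMulHom M hM X a b =
        M.subst (fun i => (y i).len) (fun i => homs (gammaObj M.E X) (y i)) ≫
          concatCast M.E (gammaObj M.E X) x y ≫ gammaIncl₂ M.E X (x.concat y) ≫
            gammaMulHom M hM X a b :=
      (whisker_eq _ (Category.assoc _ _ _).symm).trans ((Category.assoc _ _ _).symm.trans
        ((eq_whisker r1 _).trans ((Category.assoc _ _ _).trans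
          (whisker_eq _ (Category.assoc _ _ _)))))
    have r2 := M.isMultitensor.subst_natural (fun i => (y i).len)
      (fun i j => seqTensor M.E X (z i j)) (fun i => homs (gammaObj M.E X) (y i))
      (fun i j => gammaIncl M.E X (z i j))
    have r3 : tmap M.E (X := flat (fun i j => seqTensor M.E X (z i j)))
          (Y := flat (fun i => homs (gammaObj M.E X) (y i)))
          (fun l => gammaIncl M.E X
            (z (finSigmaFinEquiv.symm l).1 (finSigmaFinEquiv.symm l).2)) ≫
          concatCast M.E (gammaObj M.E X) x y =
        𝟙 _ ≫ tmap M.E (fun l => gammaIncl M.E X (w l)) := by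
      refine (tcast_tmap M.E (X := flat (fun i j => seqTensor M.E X (z i j)))
        (Y := fun l => seqTensor M.E X (w l)) rfl (fun _ => rfl) _ _
        (fun l => gammaIncl M.E X (w l)) fun l => ?_)
      exact (gammaIncl_copy M.E X _ (ObjSeq.concat_castSucc x y l)
        (ObjSeq.concat_succ x y l) _).trans (Category.id_comp _).symm
    have r4 := gammaMul_spec M hM X (x.concat y) w
    have h5 := M.isMultitensor.assoc (fun i => (y i).len) (fun i j => (z i j).len)
      (fun i j => homs X (z i j))
    have h5' := comp_whisker ((Category.assoc _ _ _).trans h5)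
      (concatCast M.E X (x.concat y) w ≫ gammaIncl M.E X ((x.concat y).concat w))
    have hl : (x.concat c).len = ((x.concat y).concat w).len :=
      (sum_flat fun i j => (z i j).len).symm
    have hX := homs_congr X (ObjSeq.concat_concat x y z) hl
    have h6 := gammaIncl_congr M.E X (ObjSeq.concat_concat x y z) hl hX
    have h7 : tcast M.E rfl hF ≫ concatCast M.E X x c ≫ tcast M.E hl hX =
        tcast M.E (sum_flat fun i j => (z i j).len).symm
          (flat_flat (fun i j => (z i j).len) (fun i j => homs X (z i j))) ≫
          concatCast M.E X (x.concat y) w :=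
      ((whisker_eq _ (tcast_trans M.E _ _ _ _)).trans (tcast_trans M.E _ _ _ _)).trans
        (tcast_trans M.E _ _ _ _).symm
    -- left hand side
    refine (whisker_eq _ (whisker_eq _ (comp_whisker h1 (gammaMulHom M hM X a b)))).trans ?_
    refine (whisker_eq _ (Category.assoc _ _ _).symm).trans ?_
    refine (Category.assoc _ _ _).symm.trans ?_
    refine (eq_whisker h2 _).trans ?_
    refine (Category.assoc _ _ _).trans ?_
    refine (whisker_eq _ (Category.assoc _ _ _)).trans ?_
    refine (whisker_eq _ (whisker_eq _ h3)).trans ?_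
    refine (whisker_eq _ (comp_whisker h4 _)).trans ?_
    refine (whisker_eq _ (whisker_eq _ (whisker_eq _ (whisker_eq _ h6.symm)))).trans ?_
    refine (whisker_eq _ (whisker_eq _ (whisker_eq _ (Category.assoc _ _ _).symm))).trans ?_
    refine (whisker_eq _ (whisker_eq _ ((Category.assoc _ _ _).symm.trans
      (eq_whisker h7 _)))).trans ?_
    refine (whisker_eq _ (whisker_eq _ (Category.assoc _ _ _))).trans ?_
    -- right hand side
    refine Eq.trans ?_ (whisker_eq _ r1').symm
    refine Eq.trans ?_ (comp_whisker r2 _).symm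
    refine Eq.trans ?_ (whisker_eq _ (comp_whisker r3 _)).symm
    refine Eq.trans ?_ (whisker_eq _ (Category.id_comp _)).symm
    refine Eq.trans ?_ (whisker_eq _ r4).symm
    exact (Category.assoc _ _ _).symm.trans h5'

/-- The monad `Γ E` on `G V` induced by a distributive multitensor `E`. -/
noncomputable def gammaMonad (M : Multitensor V) (hM : IsDistributive.{w} M.E) :
    Monad (VGraph.{w} V) where
  toFunctor := gammaFunctor M.E
  η :=
    { app := gammaUnit M
      naturality := fun _ _ f => VGraph.hom_ext fun a b => gammaUnit_natural M f a b }
  μ :=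
    { app := gammaMul M hM
      naturality := fun _ _ f => VGraph.hom_ext fun a b => gammaMul_natural M hM f a b }
  left_unit X := VGraph.hom_ext fun a b => gamma_left_unit M hM X a b
  right_unit X := VGraph.hom_ext fun a b => gamma_right_unit M hM X a b
  assoc X := VGraph.hom_ext fun a b => gamma_assoc M hM X a b

end Gamma

/-- Distributive laws `λ_X : Γ(E) G(T) X ⟶ G(T) Γ(E) X` of `G(T)` over `Γ(E)` whose components are
identities on objects. -/
abbrev IdOnObjDistributiveLaw {V : Type u} [Category.{v} V] [HasCoproducts.{w} V]
    (M : Multitensor V) (T : Monad V) (hM : IsDistributive.{w} M.E) :=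
  {l : DistributiveLaw (graphMonad.{w} T) (gammaMonad M hM) // ∀ X, (l.app X).obj = id}

end EnrichedMultitensor

open EnrichedMultitensor

/-
Restricting `σ' = (μ σ) ∘ (T τ E)` along `η E` on the outer `E` and along `T u` on the inner ones
gives back `τ`. Conversely, the axioms of a composite multitensor say that `σ'` restricts to `σ`
along `η E` and, because of the middle unit law, to `μ` along `T u`; associativity then writes
`σ'` as `(μ σ) ∘ (T τ E)` for its restriction `τ`.

For distributive `E`, any sequence `X_1, …, X_n` is the sequence of homs along the path `0, …, n`
in a graph whose other homs are initial. There all summands of `Γ(E)` between the end points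
other than that of the path are initial, so on this graph a distributive law over `Γ(E)`, which a
priori mixes summands, amounts to one map `E_i T X_i ⟶ T E_i X_i`. Naturality along morphisms out
of such path graphs gives the formula for `λ` on all graphs, and the axioms for `τ` can be
checked on path graphs.

Since `E`-categories are the algebras of `Γ(E)`, liftings correspond to distributive laws as in
Beck's theorem, a lifting being determined by its values on free `E`-categories. Finally, both an
algebra for the lifted monad and a `T E`-category amount to an `E`-category with `T`-actions on
homs that commute with composition: for a `T E`-category the compositions are restricted along
`η E`, and the actions are the compositions of length one restricted along `T u`.
-/

namespace EnrichedMultitensor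

section Substitution

theorem finSigmaFinEquiv_symm_one_snd {n : ℕ} (l : Fin (∑ _i : Fin 1, n)) :
    (finSigmaFinEquiv.symm l).2 = Fin.cast (by simp) l :=
  flat_unit_left (fun i : Fin n => i) l

theorem finSigmaFinEquiv_symm_one_fst {n : ℕ} (l : Fin (∑ _i : Fin n, 1)) :
    (finSigmaFinEquiv.symm l).1 = Fin.cast (by simp) l :=
  flat_unit_right (fun i : Fin n => i) l

theorem apply_eq_apply_cast {α ι : Sort*} {n : ι → ℕ} (Z : ∀ i, Fin (n i) → α) {i i' : ι}
    (h : i = i') (k : Fin (n i)) (hn : n i = n i') : Z i k = Z i' (Fin.cast hn k) := by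
  subst h
  rfl

variable {V : Type u} [Category.{v} V]

theorem comp_eqToHom_of_index_eq {ι : Sort*} {X Y : ι → V} (f : ∀ i, X i ⟶ Y i) {i j : ι}
    (h : i = j) (hX : X i = X j) (hY : Y i = Y j) : f i ≫ eqToHom hY = eqToHom hX ≫ f j := by
  subst h
  simp

theorem isIso_tcast (E : TensorFunctor V) {n n' : ℕ} (h : n = n') {X : Fin n → V} {Y : Fin n' → V}
    (hX : ∀ i, X i = Y (Fin.cast h i)) : IsIso (tcast E h hX) :=
  inferInstanceAs (IsIso (eqToHom _))

theorem tmap_comp₃ (E : TensorFunctor V) {n : ℕ} {A B C D : Fin n → V} (f : ∀ i, A i ⟶ B i)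
    (g : ∀ i, B i ⟶ C i) (h : ∀ i, C i ⟶ D i) :
    tmap E f ≫ tmap E g ≫ tmap E h = tmap E (fun i => f i ≫ g i ≫ h i) := by
  rw [tmap_comp, tmap_comp]

namespace Multitensor

variable (M : Multitensor V)

/-- The substitution `σ`, with values in any sequence `W` equal to the concatenated one. Leaving
`W` free hides the casts between the equal but not definitionally equal sequences that occur in
the multitensor axioms. -/
def substTo {m : ℕ} {n : Fin m → ℕ} (Z : ∀ i, Fin (n i) → V) {N : ℕ} {W : Fin N → V}
    (h : ∑ i, n i = N) (hW : ∀ l, flat Z l = W (Fin.cast h l)) :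
    (M.E m).obj (fun i => (M.E (n i)).obj (Z i)) ⟶ (M.E N).obj W :=
  M.subst n Z ≫ tcast M.E h hW

theorem substTo_rfl {m : ℕ} {n : Fin m → ℕ} (Z : ∀ i, Fin (n i) → V) :
    M.substTo Z rfl (fun _ => rfl) = M.subst n Z :=
  Category.comp_id _

theorem substTo_natural {m : ℕ} {n : Fin m → ℕ} {Z Z' : ∀ i, Fin (n i) → V}
    (f : ∀ i j, Z i j ⟶ Z' i j) {N : ℕ} {W W' : Fin N → V} (h : ∑ i, n i = N)
    (hW : ∀ l, flat Z l = W (Fin.cast h l)) (hW' : ∀ l, flat Z' l = W' (Fin.cast h l))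
    (g : ∀ l, W l ⟶ W' l)
    (hg : ∀ l, f (finSigmaFinEquiv.symm l).1 (finSigmaFinEquiv.symm l).2 ≫ eqToHom (hW' l) =
      eqToHom (hW l) ≫ g (Fin.cast h l)) :
    tmap M.E (fun i => tmap M.E (f i)) ≫ M.substTo Z' h hW' = M.substTo Z h hW ≫ tmap M.E g := by
  rw [substTo, substTo, reassoc_of% M.isMultitensor.subst_natural n Z Z' f,
    tcast_tmap M.E h hW hW' _ g hg, Category.assoc]

theorem substTo_assoc {m : ℕ} {n : Fin m → ℕ} {p : ∀ i, Fin (n i) → ℕ}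
    (Z : ∀ i (j : Fin (n i)), Fin (p i j) → V)
    {q : Fin m → ℕ} {W : ∀ i, Fin (q i) → V} (hq : ∀ i, ∑ j, p i j = q i)
    (hW : ∀ i l, flat (Z i) l = W i (Fin.cast (hq i) l))
    {N : ℕ} {Y : Fin N → V} (hN : ∑ i, q i = N) (hY : ∀ l, flat W l = Y (Fin.cast hN l))
    {r : ℕ} {b : Fin r → ℕ} {B : ∀ l, Fin (b l) → V} (hr : ∑ i, n i = r)
    (hb : ∀ l, flat p l = b (Fin.cast hr l))
    (hB : ∀ l k, Z (finSigmaFinEquiv.symm l).1 (finSigmaFinEquiv.symm l).2 k =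
      B (Fin.cast hr l) (Fin.cast (hb l) k))
    (hE : ∀ l, flat (fun i j => (M.E (p i j)).obj (Z i j)) l =
      (M.E (b (Fin.cast hr l))).obj (B (Fin.cast hr l)))
    (hN' : ∑ l, b l = N) (hY' : ∀ l, flat B l = Y (Fin.cast hN' l)) :
    tmap M.E (fun i => M.substTo (Z i) (hq i) (hW i)) ≫ M.substTo W hN hY =
      M.substTo (fun i j => (M.E (p i j)).obj (Z i j)) hr hE ≫ M.substTo B hN' hY' := by
  obtain rfl : (fun i => ∑ j, p i j) = q := funext hq
  obtain rfl : (fun i => flat (Z i)) = W := funext fun i => funext fun l => hW i l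
  subst hr
  obtain rfl : flat p = b := funext hb
  obtain rfl : (fun r => Z (finSigmaFinEquiv.symm r).1 (finSigmaFinEquiv.symm r).2) = B :=
    funext fun l => funext fun k => hB l k
  subst hN'
  obtain rfl : flat (n := flat p)
    (fun r => Z (finSigmaFinEquiv.symm r).1 (finSigmaFinEquiv.symm r).2) = Y := funext hY'
  have inner : (fun i => M.substTo (Z i) (hq i) (hW i)) = fun i => M.subst (p i) (Z i) :=
    funext fun i => M.substTo_rfl (Z i)
  have outer : M.substTo (n := flat p)
      (fun r => Z (finSigmaFinEquiv.symm r).1 (finSigmaFinEquiv.symm r).2) rfl hY' =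
      M.subst _ _ := M.substTo_rfl _
  have first : M.substTo (fun i j => (M.E (p i j)).obj (Z i j)) rfl hE = M.subst _ _ :=
    M.substTo_rfl _
  rw [inner, outer]
  exact (M.isMultitensor.assoc n p Z).trans (eq_whisker first _).symm

/-- The substitution `E_1 E_i X_i ⟶ E_i X_i` of a single sequence. -/
def substLeft {n : ℕ} (X : Fin n → V) :
    (M.E 1).obj (fun _ => (M.E n).obj X) ⟶ (M.E n).obj X :=
  M.substTo (fun _ : Fin 1 => X) (by simp) (flat_unit_left X)

/-- The substitution `E_i E_1 X_i ⟶ E_i X_i` of sequences of length one. -/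
def substRight {n : ℕ} (X : Fin n → V) :
    (M.E n).obj (fun i => (M.E 1).obj (fun _ => X i)) ⟶ (M.E n).obj X :=
  M.substTo (fun i (_ : Fin 1) => X i) (by simp) (flat_unit_right X)

theorem unit_substLeft {n : ℕ} (X : Fin n → V) :
    M.unit ((M.E n).obj X) ≫ M.substLeft X = 𝟙 _ :=
  M.isMultitensor.unit_left X

theorem unit_substRight {n : ℕ} (X : Fin n → V) :
    tmap M.E (fun i => M.unit (X i)) ≫ M.substRight X = 𝟙 _ :=
  M.isMultitensor.unit_right X

theorem substLeft_natural {n : ℕ} {X Y : Fin n → V} (f : ∀ i, X i ⟶ Y i) :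
    tmap M.E (fun _ : Fin 1 => tmap M.E f) ≫ M.substLeft Y = M.substLeft X ≫ tmap M.E f :=
  M.substTo_natural (fun (_ : Fin 1) j => f j) _ _ _ f fun l =>
    comp_eqToHom_of_index_eq f (finSigmaFinEquiv_symm_one_snd l) _ _

theorem substRight_natural {n : ℕ} {X Y : Fin n → V} (f : ∀ i, X i ⟶ Y i) :
    tmap M.E (fun i => tmap M.E (fun _ : Fin 1 => f i)) ≫ M.substRight Y =
      M.substRight X ≫ tmap M.E f :=
  M.substTo_natural (fun j (_ : Fin 1) => f j) _ _ _ f fun l =>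
    comp_eqToHom_of_index_eq f (finSigmaFinEquiv_symm_one_fst l) _ _

theorem map_subst_substLeft {m : ℕ} (n : Fin m → ℕ) (Z : ∀ i, Fin (n i) → V) :
    tmap M.E (fun _ : Fin 1 => M.subst n Z) ≫ M.substLeft (flat Z) =
      M.substLeft (fun i => (M.E (n i)).obj (Z i)) ≫ M.subst n Z := by
  rw [← M.substTo_rfl Z]
  exact M.substTo_assoc (fun (_ : Fin 1) i => Z i) (fun _ => rfl) (fun _ _ => rfl) _ _ (B := Z)
    (by simp) (fun l => congrArg n (finSigmaFinEquiv_symm_one_snd l))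
    (fun l k => apply_eq_apply_cast Z (finSigmaFinEquiv_symm_one_snd l) k _) _ _ _

theorem map_substRight_subst {m : ℕ} (n : Fin m → ℕ) (Z : ∀ i, Fin (n i) → V) :
    tmap M.E (fun i => M.substRight (Z i)) ≫ M.subst n Z =
      M.subst n (fun i j => (M.E 1).obj (fun _ => Z i j)) ≫ M.substRight (flat Z) := by
  rw [← M.substTo_rfl Z, ← M.substTo_rfl (fun i j => (M.E 1).obj (fun _ => Z i j))]
  exact M.substTo_assoc (fun i j (_ : Fin 1) => Z i j) _ _ _ _ (B := fun l (_ : Fin 1) => flat Z l)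
    rfl (fun _ => rfl) (fun _ _ => rfl) _ _ _

theorem map_substLeft_subst {m : ℕ} (n : Fin m → ℕ) (Z : ∀ i, Fin (n i) → V) :
    tmap M.E (fun i => M.substLeft (Z i)) ≫ M.subst n Z =
      M.substRight (fun i => (M.E (n i)).obj (Z i)) ≫ M.subst n Z := by
  rw [← M.substTo_rfl Z]
  exact M.substTo_assoc (fun i (_ : Fin 1) => Z i) _ _ _ _ (B := Z)
    (by simp) (fun l => congrArg n (finSigmaFinEquiv_symm_one_fst l))
    (fun l k => apply_eq_apply_cast Z (finSigmaFinEquiv_symm_one_fst l) k _) _ _ _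

theorem map_substRight_substLeft {n : ℕ} (X : Fin n → V) :
    tmap M.E (fun _ : Fin 1 => M.substRight X) ≫ M.substLeft X =
      M.substLeft (fun i => (M.E 1).obj (fun _ => X i)) ≫ M.substRight X :=
  M.substTo_assoc (fun (_ : Fin 1) i (_ : Fin 1) => X i) _ _ _ _ (B := fun i (_ : Fin 1) => X i)
    (by simp) (fun _ => rfl) (fun l _ => congrArg X (finSigmaFinEquiv_symm_one_snd l)) _ _ _

theorem map_substRight_substRight {n : ℕ} (X : Fin n → V) :
    tmap M.E (fun i => M.substRight (fun _ : Fin 1 => X i)) ≫ M.substRight X =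
      M.substRight (fun i => (M.E 1).obj (fun _ => X i)) ≫ M.substRight X :=
  M.substTo_assoc (fun i (_ : Fin 1) (_ : Fin 1) => X i) _ _ _ _ (B := fun i (_ : Fin 1) => X i)
    (by simp) (fun _ => rfl) (fun l _ => congrArg X (finSigmaFinEquiv_symm_one_fst l)) _ _ _

theorem map_substLeft_substLeft {n : ℕ} (X : Fin n → V) :
    tmap M.E (fun _ : Fin 1 => M.substLeft X) ≫ M.substLeft X =
      M.substLeft (fun _ : Fin 1 => (M.E n).obj X) ≫ M.substLeft X :=
  M.substTo_assoc (fun (_ : Fin 1) (_ : Fin 1) => X) _ _ _ _ (B := fun (_ : Fin 1) => X)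
    (by simp) (fun _ => rfl) (fun _ _ => rfl) _ _ _

end Multitensor

end Substitution

section Composite

variable {V : Type u} [Category.{v} V] {M : Multitensor V} {T : Monad V}

theorem tcast_compTensor {n n' : ℕ} (h : n = n') {X : Fin n → V}
    {Y : Fin n' → V} (hX : ∀ i, X i = Y (Fin.cast h i)) :
    tcast (compTensor M T) h hX = T.map (tcast M.E h hX) := by
  subst h
  obtain rfl : X = Y := funext hX
  exact (T.map_id _).symm

theorem map_unit_natural {X Y : V} (f : X ⟶ Y) :
    T.map f ≫ T.map (M.unit Y) = T.map (M.unit X) ≫ T.map (tmap M.E fun _ : Fin 1 => f) := by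
  rw [← T.map_comp, M.isMultitensor.unit_natural, T.map_comp]

namespace MonoidalCoherence

/-- The substitution `T E_i T E_j X_{ij} ⟶ T E_{ij} X_{ij}` of the composite multitensor of a
monoidal monad. -/
def compSubst (c : MonoidalCoherence M T) {m : ℕ} (n : Fin m → ℕ) (Z : ∀ i, Fin (n i) → V) :
    T.obj ((M.E m).obj fun i => T.obj ((M.E (n i)).obj (Z i))) ⟶
      T.obj ((M.E (∑ i, n i)).obj (flat Z)) :=
  T.map (c.τ fun i => (M.E (n i)).obj (Z i)) ≫ T.μ.app _ ≫ T.map (M.subst n Z)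

theorem compSubst_natural (c : MonoidalCoherence M T) {m : ℕ} (n : Fin m → ℕ)
    (Z Z' : ∀ i, Fin (n i) → V) (f : ∀ i j, Z i j ⟶ Z' i j) :
    T.map (tmap M.E fun i => T.map (tmap M.E (f i))) ≫ c.compSubst n Z' =
      c.compSubst n Z ≫
        T.map (tmap M.E fun l => f (finSigmaFinEquiv.symm l).1 (finSigmaFinEquiv.symm l).2) := by
  simp only [compSubst, Category.assoc, ← T.map_comp, ← M.isMultitensor.subst_natural]
  rw [← T.map_comp_assoc, c.natural, T.map_comp_assoc, T.map_comp]
  exact whisker_eq _ (T.μ.naturality_assoc _ _)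

theorem η_compSubst (c : MonoidalCoherence M T) {m : ℕ} (n : Fin m → ℕ)
    (Z : ∀ i, Fin (n i) → V) :
    T.η.app _ ≫ c.compSubst n Z =
      c.τ (fun i => (M.E (n i)).obj (Z i)) ≫ T.map (M.subst n Z) := by
  rw [compSubst, ← T.η.naturality_assoc, T.left_unit_assoc, Functor.id_map]

theorem map_η_compSubst (c : MonoidalCoherence M T) {m : ℕ} (n : Fin m → ℕ)
    (Z : ∀ i, Fin (n i) → V) :
    T.map (tmap M.E fun i => T.η.app ((M.E (n i)).obj (Z i))) ≫ c.compSubst n Z =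
      T.map (M.subst n Z) := by
  rw [compSubst, ← T.map_comp_assoc, c.monad_unit]
  exact T.right_unit_assoc _ _

theorem compUnit_compSubst (c : MonoidalCoherence M T) {n : ℕ} (Z : Fin n → V) :
    (M.unit (T.obj ((M.E n).obj Z)) ≫ T.η.app _) ≫ c.compSubst (fun _ : Fin 1 => n) (fun _ => Z) ≫
      T.map (tcast M.E (by simp) (flat_unit_left Z)) = 𝟙 _ := by
  rw [Category.assoc, reassoc_of% c.η_compSubst, reassoc_of% c.unit]
  rw [← T.map_comp, ← T.map_comp, M.isMultitensor.unit_left, T.map_id]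

theorem map_compUnit_compSubst (c : MonoidalCoherence M T) {n : ℕ} (Z : Fin n → V) :
    T.map (tmap M.E fun i => M.unit (Z i) ≫ T.η.app _) ≫
      c.compSubst (fun _ : Fin n => 1) (fun i _ => Z i) ≫
      T.map (tcast M.E (by simp) (flat_unit_right Z)) = 𝟙 _ := by
  rw [← tmap_comp, T.map_comp_assoc, reassoc_of% c.map_η_compSubst]
  rw [← T.map_comp, ← T.map_comp, M.isMultitensor.unit_right, T.map_id]

theorem map_compSubst_τ (c : MonoidalCoherence M T) {m : ℕ} {n : Fin m → ℕ}
    (p : ∀ i, Fin (n i) → ℕ) (Z : ∀ i (j : Fin (n i)), Fin (p i j) → V) :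
    tmap M.E (fun i => c.compSubst (p i) (Z i)) ≫ c.τ _ =
      c.τ _ ≫ T.map (tmap M.E (fun i => c.τ _) ≫ c.τ _) ≫ T.μ.app _ ≫
        T.map (tmap M.E fun i => M.subst (p i) (Z i)) := by
  simp only [compSubst, ← tmap_comp₃, Category.assoc]
  rw [c.natural, reassoc_of% c.monad_mul, reassoc_of% c.natural]
  simp

theorem compSubst_assoc (c : MonoidalCoherence M T) {m : ℕ} (n : Fin m → ℕ)
    (p : ∀ i, Fin (n i) → ℕ) (Z : ∀ i (j : Fin (n i)), Fin (p i j) → V) :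
    T.map (tmap M.E fun i => c.compSubst (p i) (Z i)) ≫
        c.compSubst (fun i => ∑ j, p i j) (fun i => flat (Z i)) ≫
          T.map (tcast M.E (sum_flat p).symm (flat_flat p Z)) =
      c.compSubst n (fun i j => T.obj ((M.E (p i j)).obj (Z i j))) ≫
        c.compSubst (flat p)
          (fun r => Z (finSigmaFinEquiv.symm r).1 (finSigmaFinEquiv.symm r).2) := by
  have merge_τ := c.subst n fun i j => (M.E (p i j)).obj (Z i j)
  calc
    _ = T.map (tmap M.E (fun i => c.compSubst (p i) (Z i)) ≫ c.τ _) ≫ T.μ.app _ ≫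
          T.map (M.subst _ (fun i => flat (Z i)) ≫
            tcast M.E (sum_flat p).symm (flat_flat p Z)) := by
      rw [T.map_comp, T.map_comp, compSubst]
      simp only [Category.assoc]
    _ = T.map (c.τ _) ≫ T.map (T.map (tmap M.E (fun i => c.τ _) ≫ c.τ _)) ≫
          T.map (T.μ.app _) ≫ T.μ.app _ ≫
          T.map (tmap M.E (fun i => M.subst (p i) (Z i)) ≫
            M.subst _ (fun i => flat (Z i)) ≫
            tcast M.E (sum_flat p).symm (flat_flat p Z)) := by
      rw [c.map_compSubst_τ]
      simp only [T.map_comp, Category.assoc]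
      rw [T.mu_naturality_assoc]
    _ = T.map (c.τ _) ≫ T.map (T.map (tmap M.E (fun i => c.τ _) ≫ c.τ _)) ≫
          T.μ.app _ ≫ T.μ.app _ ≫
          T.map (M.subst n (fun i j => (M.E (p i j)).obj (Z i j)) ≫ M.subst (flat p) _) := by
      rw [M.isMultitensor.assoc, reassoc_of% T.assoc]
    _ = T.map (c.τ _) ≫ T.μ.app _ ≫ T.map (tmap M.E (fun i => c.τ _) ≫ c.τ _ ≫
          T.map (M.subst n fun i j => (M.E (p i j)).obj (Z i j))) ≫
          T.μ.app _ ≫ T.map (M.subst (flat p) _) := by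
      simp only [T.map_comp, Category.assoc]
      simp only [T.mu_naturality_assoc]
    _ = _ := by
      rw [merge_τ]
      simp [compSubst]

theorem isMultitensor_compSubst (c : MonoidalCoherence M T) :
    IsMultitensor (compTensor M T) (compUnit M T) c.compSubst where
  unit_natural f := by
    rw [compUnit, reassoc_of% M.isMultitensor.unit_natural f, T.unit_naturality, Category.assoc]
    rfl
  subst_natural := c.compSubst_natural
  unit_left Z := by
    rw [tcast_compTensor]
    exact c.compUnit_compSubst Z
  unit_right Z := by
    rw [tcast_compTensor]
    exact c.map_compUnit_compSubst Z
  assoc n p Z := by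
    rw [tcast_compTensor]
    exact c.compSubst_assoc n p Z

theorem middle_unit (c : MonoidalCoherence M T) {n : ℕ} (X : Fin n → V) :
    T.map (M.unit ((M.E n).obj X)) ≫
        T.map (tmap M.E (fun _ : Fin 1 => T.η.app ((M.E n).obj X))) ≫
        c.compSubst (fun _ : Fin 1 => n) (fun _ => X) ≫
          T.map (tcast M.E (by simp) (flat_unit_left X)) = 𝟙 _ := by
  rw [reassoc_of% c.map_η_compSubst, ← T.map_comp, ← T.map_comp, M.isMultitensor.unit_left,
    T.map_id]

theorem map_unit_compSubst (c : MonoidalCoherence M T) {n : ℕ} (X : Fin n → V) :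
    T.map (M.unit (T.obj ((M.E n).obj X))) ≫ c.compSubst (fun _ : Fin 1 => n) (fun _ => X) ≫
        T.map (tcast M.E (by simp) (flat_unit_left X)) = T.μ.app ((M.E n).obj X) := by
  rw [compSubst]
  simp only [Category.assoc]
  rw [← T.map_comp_assoc, c.unit, T.mu_naturality_assoc, ← T.map_comp, ← T.map_comp,
    M.isMultitensor.unit_left, T.map_id, Category.comp_id]

/-- `T u : T ⟶ T E_1` as a morphism of monads. -/
def unaryMonadHom (c : MonoidalCoherence M T) :
    T ⟶ Multitensor.unaryMonad ⟨compTensor M T, compUnit M T, c.compSubst,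
      c.isMultitensor_compSubst⟩ where
  app X := T.map (M.unit X)
  naturality X Y f := map_unit_natural f
  app_η X := (T.unit_naturality _ (M.unit X)).symm
  app_μ X := by
    have unit_substLeft : T.map (M.unit (T.obj ((M.E 1).obj fun _ => X))) ≫
        (c.compSubst (fun _ : Fin 1 => 1) (fun _ _ => X) ≫
          tcast (compTensor M T) (by simp) (flat_unit_left fun _ : Fin 1 => X)) = T.μ.app _ := by
      rw [tcast_compTensor]
      exact c.map_unit_compSubst fun _ : Fin 1 => X
    refine Eq.trans ?_ (Category.assoc _ _ _).symm
    exact (T.mu_naturality _ (M.unit X)).symm.trans (whisker_eq _ unit_substLeft.symm)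

theorem map_η_η_compSubst (c : MonoidalCoherence M T) {m : ℕ} (n : Fin m → ℕ)
    (Z : ∀ i, Fin (n i) → V) :
    M.subst n Z ≫ T.η.app ((M.E (∑ i, n i)).obj (flat Z)) =
      tmap M.E (fun i => T.η.app ((M.E (n i)).obj (Z i))) ≫ T.η.app _ ≫ c.compSubst n Z := by
  rw [c.η_compSubst, reassoc_of% c.monad_unit fun i => (M.E (n i)).obj (Z i),
    T.unit_naturality]

/-- The composite multitensor of a monoidal monad. -/
def composite (c : MonoidalCoherence M T) : CompositeMultitensor M T where
  subst := c.compSubst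
  isMultitensor := c.isMultitensor_compSubst
  isMultitensorMap :=
    { natural := fun _ => T.η.naturality _
      unit := fun _ => rfl
      subst := c.map_η_η_compSubst }
  isMonadMap := ⟨c.unaryMonadHom, fun _ => rfl⟩
  middle_unit X := by
    rw [tcast_compTensor]
    exact c.middle_unit X

theorem η_substRight (c : MonoidalCoherence M T) {n : ℕ} (X : Fin n → V) :
    T.η.app _ ≫ c.composite.toMultitensor.substRight X =
      c.τ (fun i => (M.E 1).obj fun _ => X i) ≫ T.map (M.substRight X) := by
  calc
    _ = T.η.app _ ≫ c.compSubst (fun _ : Fin n => 1) (fun i _ => X i) ≫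
          T.map (tcast M.E (by simp) (flat_unit_right X)) :=
      whisker_eq _ (whisker_eq _ (tcast_compTensor _ _))
    _ = _ := by
      rw [reassoc_of% c.η_compSubst, ← T.map_comp]
      rfl

theorem composite_τ (c : MonoidalCoherence M T) {n : ℕ} (X : Fin n → V) :
    T.η.app ((M.E n).obj fun i => T.obj (X i)) ≫
        T.map (tmap M.E fun i => T.map (M.unit (X i))) ≫
          c.composite.toMultitensor.substRight X = c.τ X :=
  calc
    _ = tmap M.E (fun i => T.map (M.unit (X i))) ≫ T.η.app _ ≫
          c.composite.toMultitensor.substRight X := (T.unit_naturality_assoc _ _ _).symm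
    _ = tmap M.E (fun i => T.map (M.unit (X i))) ≫ c.τ _ ≫ T.map (M.substRight X) :=
      whisker_eq _ (c.η_substRight X)
    _ = c.τ X := by
      rw [reassoc_of% c.natural, ← T.map_comp, M.unit_substRight, T.map_id, Category.comp_id]

theorem composite_injective :
    Function.Injective (composite : MonoidalCoherence M T → CompositeMultitensor M T) := by
  intro c c' h
  ext n X
  rw [← c.composite_τ, ← c'.composite_τ, h]

end MonoidalCoherence
end Composite

section Composite

variable {V : Type u} [Category.{v} V] {M : Multitensor V} {T : Monad V}

theorem map_tmap_comp {n : ℕ} {X Y Z : Fin n → V} (f : ∀ i, X i ⟶ Y i) (g : ∀ i, Y i ⟶ Z i) :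
    T.map (tmap M.E f) ≫ T.map (tmap M.E g) = T.map (tmap M.E fun i => f i ≫ g i) := by
  rw [← T.map_comp, tmap_comp]

namespace CompositeMultitensor

variable (s : CompositeMultitensor M T)

/-- The substitution `T E_1 T E_i X_i ⟶ T E_i X_i` of a single sequence. -/
def substLeft {n : ℕ} (X : Fin n → V) :
    T.obj ((M.E 1).obj fun _ => T.obj ((M.E n).obj X)) ⟶ T.obj ((M.E n).obj X) :=
  s.toMultitensor.substLeft X

/-- The substitution `T E_i T E_1 X_i ⟶ T E_i X_i` of sequences of length one. -/
def substRight {n : ℕ} (X : Fin n → V) :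
    T.obj ((M.E n).obj fun i => T.obj ((M.E 1).obj fun _ => X i)) ⟶ T.obj ((M.E n).obj X) :=
  s.toMultitensor.substRight X

theorem substLeft_natural {n : ℕ} {X Y : Fin n → V} (f : ∀ i, X i ⟶ Y i) :
    T.map (tmap M.E fun _ : Fin 1 => T.map (tmap M.E f)) ≫ s.substLeft Y =
      s.substLeft X ≫ T.map (tmap M.E f) :=
  s.toMultitensor.substLeft_natural f

theorem substRight_natural {n : ℕ} {X Y : Fin n → V} (f : ∀ i, X i ⟶ Y i) :
    T.map (tmap M.E fun i => T.map (tmap M.E fun _ : Fin 1 => f i)) ≫ s.substRight Y =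
      s.substRight X ≫ T.map (tmap M.E f) :=
  s.toMultitensor.substRight_natural f

theorem unit_substLeft {n : ℕ} (X : Fin n → V) :
    M.unit (T.obj ((M.E n).obj X)) ≫ T.η.app _ ≫ s.substLeft X = 𝟙 _ :=
  (Category.assoc _ _ _).symm.trans (s.toMultitensor.unit_substLeft X)

theorem unit_substRight {n : ℕ} (X : Fin n → V) :
    T.map (tmap M.E fun i => M.unit (X i) ≫ T.η.app _) ≫ s.substRight X = 𝟙 _ :=
  s.toMultitensor.unit_substRight X

theorem map_unit_η_substLeft {n : ℕ} (X : Fin n → V) :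
    T.map (M.unit ((M.E n).obj X)) ≫ T.map (tmap M.E fun _ : Fin 1 => T.η.app ((M.E n).obj X)) ≫
      s.substLeft X = 𝟙 _ :=
  s.middle_unit X

theorem map_unit_map_unit_substLeft (X : V) :
    T.map (M.unit (T.obj X)) ≫ T.map (tmap M.E fun _ : Fin 1 => T.map (M.unit X)) ≫
      s.substLeft (fun _ : Fin 1 => X) = T.μ.app X ≫ T.map (M.unit X) := by
  obtain ⟨φ, φ_app⟩ := s.isMonadMap
  have app_μ := φ.app_μ X
  rw [φ_app, φ_app] at app_μ
  rw [← reassoc_of% map_unit_natural (M := M) (T := T) (T.map (M.unit X))]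
  exact (app_μ.trans (Category.assoc _ _ _)).symm

theorem map_unit_substLeft {n : ℕ} (X : Fin n → V) :
    T.map (M.unit (T.obj ((M.E n).obj X))) ≫ s.substLeft X = T.μ.app ((M.E n).obj X) := by
  let A := (M.E n).obj X
  have split_id : T.map (tmap M.E fun _ : Fin 1 => T.map (M.unit A)) ≫
      T.map (tmap M.E fun _ : Fin 1 => T.map (tmap M.E fun _ : Fin 1 => T.η.app A)) ≫
        T.map (tmap M.E fun _ : Fin 1 => s.substLeft X) = 𝟙 _ := by
    rw [map_tmap_comp, map_tmap_comp, s.map_unit_η_substLeft X, tmap_id, T.map_id]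
  have assoc : T.map (tmap M.E fun _ : Fin 1 => s.substLeft X) ≫ s.substLeft X =
      s.substLeft (fun _ : Fin 1 => T.obj A) ≫ s.substLeft X :=
    s.toMultitensor.map_substLeft_substLeft X
  rw [← Category.id_comp (s.substLeft X), ← split_id]
  simp only [Category.assoc]
  rw [assoc, reassoc_of% s.substLeft_natural fun _ : Fin 1 => T.η.app A,
    reassoc_of% s.map_unit_map_unit_substLeft A, s.map_unit_η_substLeft X, Category.comp_id]

theorem map_η_subst {m : ℕ} (n : Fin m → ℕ) (Z : ∀ i, Fin (n i) → V) :
    T.map (tmap M.E fun i => T.η.app ((M.E (n i)).obj (Z i))) ≫ s.subst n Z =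
      T.map (M.subst n Z) := by
  have η_natural : T.η.app ((M.E m).obj fun i => (M.E (n i)).obj (Z i)) ≫
      T.map (tmap M.E fun i => T.η.app ((M.E (n i)).obj (Z i))) ≫ s.subst n Z =
        M.subst n Z ≫ T.η.app _ :=
    (T.unit_naturality_assoc _ _ _).symm.trans (s.isMultitensorMap.subst n Z).symm
  have assoc : T.map (tmap M.E fun _ : Fin 1 => s.subst n Z) ≫ s.substLeft (flat Z) =
      s.substLeft (fun i => T.obj ((M.E (n i)).obj (Z i))) ≫ s.subst n Z :=
    s.toMultitensor.map_subst_substLeft n Z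
  rw [← Category.id_comp (T.map (tmap M.E _) ≫ _), ← s.map_unit_η_substLeft]
  simp only [Category.assoc, Functor.id_obj]
  rw [← reassoc_of% s.substLeft_natural fun i => T.η.app ((M.E (n i)).obj (Z i)), ← assoc,
    reassoc_of% map_tmap_comp (M := M) (T := T), reassoc_of% map_tmap_comp (M := M) (T := T)]
  simp only [Category.assoc]
  rw [η_natural, ← reassoc_of% map_tmap_comp (M := M) (T := T), ← reassoc_of% map_unit_natural,
    s.map_unit_η_substLeft, Category.comp_id]

/-- The coherence maps of the monoidal monad recovered from a composite multitensor. -/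
def tau {n : ℕ} (X : Fin n → V) :
    (M.E n).obj (fun i => T.obj (X i)) ⟶ T.obj ((M.E n).obj X) :=
  T.η.app _ ≫ T.map (tmap M.E fun i => T.map (M.unit (X i))) ≫ s.substRight X

theorem map_map_unit_substRight {n : ℕ} (X : Fin n → V) :
    T.map (tmap M.E fun i => T.map (M.unit (X i))) ≫ s.substRight X =
      T.map (s.tau X) ≫ T.μ.app _ := by
  have assoc : T.map (tmap M.E fun _ : Fin 1 => s.substRight X) ≫ s.substLeft X =
      s.substLeft (fun i => T.obj ((M.E 1).obj fun _ => X i)) ≫ s.substRight X :=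
    s.toMultitensor.map_substRight_substLeft X
  symm
  calc
    _ = T.map (M.unit _) ≫ T.map (tmap M.E fun _ : Fin 1 => s.tau X) ≫ s.substLeft X := by
      rw [← s.map_unit_substLeft, ← reassoc_of% map_unit_natural (M := M) (s.tau X)]
    _ = T.map (M.unit _) ≫ T.map (tmap M.E fun _ : Fin 1 => T.η.app _) ≫
          T.map (tmap M.E fun _ : Fin 1 => T.map (tmap M.E fun i => T.map (M.unit (X i)))) ≫
          T.map (tmap M.E fun _ : Fin 1 => s.substRight X) ≫ s.substLeft X := by
      simp only [reassoc_of% map_tmap_comp (M := M) (T := T)]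
      rfl
    _ = _ := by
      rw [assoc, reassoc_of% s.substLeft_natural fun i => T.map (M.unit (X i))]
      simp only [Functor.id_obj]
      rw [reassoc_of% s.map_unit_η_substLeft]

theorem map_map_unit_substRight_map_subst {m : ℕ} (n : Fin m → ℕ) (Z : ∀ i, Fin (n i) → V) :
    T.map (tmap M.E fun i => T.map (M.unit ((M.E (n i)).obj (Z i)))) ≫
      s.substRight (fun i => (M.E (n i)).obj (Z i)) ≫ T.map (M.subst n Z) = s.subst n Z := by
  have assoc : T.map (tmap M.E fun i => s.substLeft (Z i)) ≫ s.subst n Z =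
      s.substRight (fun i => T.obj ((M.E (n i)).obj (Z i))) ≫ s.subst n Z :=
    s.toMultitensor.map_substLeft_subst n Z
  rw [← s.map_η_subst, ← reassoc_of% s.substRight_natural, ← assoc,
    reassoc_of% map_tmap_comp (M := M) (T := T), reassoc_of% map_tmap_comp (M := M) (T := T)]
  simp only [Category.assoc, s.map_unit_η_substLeft]
  rw [tmap_id, T.map_id, Category.id_comp]

theorem tau_natural {n : ℕ} {X Y : Fin n → V} (f : ∀ i, X i ⟶ Y i) :
    tmap M.E (fun i => T.map (f i)) ≫ s.tau Y = s.tau X ≫ T.map (tmap M.E f) := by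
  rw [tau, tau, T.unit_naturality_assoc, reassoc_of% map_tmap_comp (M := M) (T := T)]
  simp only [map_unit_natural]
  rw [← reassoc_of% map_tmap_comp (M := M) (T := T), s.substRight_natural]
  simp only [Category.assoc]

theorem tau_unit (X : V) : M.unit (T.obj X) ≫ s.tau (fun _ : Fin 1 => X) = T.map (M.unit X) := by
  rw [tau, ← T.unit_naturality_assoc,
    ← reassoc_of% M.isMultitensor.unit_natural (T.map (M.unit X))]
  exact (whisker_eq _ (s.unit_substLeft fun _ : Fin 1 => X)).trans (Category.comp_id _)

theorem tau_map_subst {m : ℕ} (n : Fin m → ℕ) (Z : ∀ i, Fin (n i) → V) :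
    s.tau (fun i => (M.E (n i)).obj (Z i)) ≫ T.map (M.subst n Z) =
      T.η.app ((M.E m).obj fun i => T.obj ((M.E (n i)).obj (Z i))) ≫ s.subst n Z := by
  rw [← s.map_map_unit_substRight_map_subst, tau]
  simp only [Category.assoc]

theorem tau_subst {m : ℕ} (n : Fin m → ℕ) (Z : ∀ i, Fin (n i) → V) :
    tmap M.E (fun i => s.tau (Z i)) ≫ s.tau (fun i => (M.E (n i)).obj (Z i)) ≫
        T.map (M.subst n Z) =
      M.subst n (fun i j => T.obj (Z i j)) ≫ s.tau (flat Z) := by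
  have assoc : T.map (tmap M.E fun i => s.substRight (Z i)) ≫ s.subst n Z =
      s.subst n (fun i j => T.obj ((M.E 1).obj fun _ => Z i j)) ≫ s.substRight (flat Z) :=
    s.toMultitensor.map_substRight_subst n Z
  have subst_natural : T.map (tmap M.E fun i => T.map (tmap M.E fun j => T.map (M.unit (Z i j)))) ≫
      s.subst n (fun i j => T.obj ((M.E 1).obj fun _ => Z i j)) =
        s.subst n (fun i j => T.obj (Z i j)) ≫
          T.map (tmap M.E fun l => T.map (M.unit (flat Z l))) :=
    s.isMultitensor.subst_natural n _ _ fun i j => T.map (M.unit (Z i j))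
  have η_subst : M.subst n (fun i j => T.obj (Z i j)) ≫ T.η.app _ =
      tmap M.E (fun i => T.η.app _) ≫ T.η.app _ ≫ s.subst n (fun i j => T.obj (Z i j)) :=
    s.isMultitensorMap.subst n fun i j => T.obj (Z i j)
  rw [s.tau_map_subst, tau, reassoc_of% η_subst, ← reassoc_of% subst_natural, ← assoc,
    reassoc_of% map_tmap_comp (M := M) (T := T), ← T.unit_naturality_assoc,
    reassoc_of% tmap_comp]
  rfl

theorem tau_monad_unit {n : ℕ} (X : Fin n → V) :
    tmap M.E (fun i => T.η.app (X i)) ≫ s.tau X = T.η.app ((M.E n).obj X) := by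
  rw [tau, T.unit_naturality_assoc, reassoc_of% map_tmap_comp (M := M) (T := T)]
  simp only [← T.unit_naturality]
  exact (whisker_eq _ (s.unit_substRight X)).trans (Category.comp_id _)

theorem tau_monad_mul {n : ℕ} (X : Fin n → V) :
    tmap M.E (fun i => T.μ.app (X i)) ≫ s.tau X =
      s.tau (fun i => T.obj (X i)) ≫ T.map (s.tau X) ≫ T.μ.app ((M.E n).obj X) := by
  have assoc : T.map (tmap M.E fun i => s.substLeft fun _ : Fin 1 => X i) ≫ s.substRight X =
      s.substRight (fun i => T.obj ((M.E 1).obj fun _ => X i)) ≫ s.substRight X :=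
    s.toMultitensor.map_substRight_substRight X
  rw [← s.map_map_unit_substRight, tau, tau]
  simp only [Category.assoc]
  rw [← reassoc_of% s.substRight_natural fun i => T.map (M.unit (X i)), ← assoc,
    reassoc_of% map_tmap_comp (M := M) (T := T), reassoc_of% map_tmap_comp (M := M) (T := T)]
  simp only [Category.assoc, s.map_unit_map_unit_substLeft]
  rw [← reassoc_of% map_tmap_comp (M := M) (T := T)]
  exact T.unit_naturality_assoc _ _ _

/-- The monoidal monad recovered from a composite multitensor. -/
def coherence : MonoidalCoherence M T where
  τ := s.tau
  natural := s.tau_natural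
  unit := s.tau_unit
  subst := s.tau_subst
  monad_unit := s.tau_monad_unit
  monad_mul := s.tau_monad_mul

theorem composite_coherence : s.coherence.composite = s := by
  ext m n Z
  calc
    _ = (T.map (s.tau fun i => (M.E (n i)).obj (Z i)) ≫ T.μ.app _) ≫ T.map (M.subst n Z) :=
      (Category.assoc _ _ _).symm
    _ = s.subst n Z := by
      rw [← s.map_map_unit_substRight, Category.assoc, s.map_map_unit_substRight_map_subst]

end CompositeMultitensor

/-- Monoidal monads correspond to composite multitensors. -/
noncomputable def compositeEquiv (M : Multitensor V) (T : Monad V) :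
    MonoidalCoherence M T ≃ CompositeMultitensor M T :=
  Equiv.ofBijective MonoidalCoherence.composite
    ⟨MonoidalCoherence.composite_injective, fun s => ⟨s.coherence, s.composite_coherence⟩⟩

end Composite

section LiftingData

variable {V : Type u} [Category.{v} V]

theorem tcast_comp_family {M : Multitensor V} {T : Monad V}
    (τ : ∀ {n : ℕ} (X : Fin n → V), (M.E n).obj (fun i => T.obj (X i)) ⟶ T.obj ((M.E n).obj X))
    {n n' : ℕ} (h : n = n') {X : Fin n → V} {Y : Fin n' → V}
    (hX : ∀ i, X i = Y (Fin.cast h i)) :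
    tcast M.E h (fun i => congrArg T.obj (hX i)) ≫ τ Y = τ X ≫ T.map (tcast M.E h hX) := by
  subst h
  obtain rfl : X = Y := funext hX
  rw [tcast_rfl, tcast_rfl, T.map_id, Category.comp_id, Category.id_comp]

/-- The property of being an `E`-functor, for a morphism between the underlying graphs of two
`E`-categories. -/
def ECat.IsFunctor {M : Multitensor V} (X Y : ECat.{w} M) (f : X.graph ⟶ Y.graph) : Prop :=
  ∀ ⦃a b : X.graph.obj⦄ (x : ObjSeq X.graph.obj a b),
    X.comp x ≫ f.hom a b = seqTensorMap M.E f x ≫ Y.comp (x.map f.obj)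

/-- The structures of an `E`-category on a fixed graph. -/
structure ECatStruct (M : Multitensor V) (G : VGraph.{w} V) where
  comp : ∀ {a b : G.obj} (x : ObjSeq G.obj a b), seqTensor M.E G x ⟶ G.hom a b
  unit_comp : ∀ a b : G.obj,
    M.unit (G.hom a b) ≫ singleCast M.E G a b ≫ comp (ObjSeq.single a b) = 𝟙 _
  subst_comp : ∀ {a b : G.obj} (x : ObjSeq G.obj a b)
    (y : ∀ i : Fin x.len, ObjSeq G.obj (x.vtx i.castSucc) (x.vtx i.succ)),
    tmap M.E (fun i => comp (y i)) ≫ comp x =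
      M.subst (fun i => (y i).len) (fun i => homs G (y i)) ≫
        concatCast M.E G x y ≫ comp (x.concat y)

/-- The `E`-category consisting of a graph and an `E`-category structure on it. -/
abbrev ECatStruct.toECat {M : Multitensor V} {G : VGraph.{w} V} (s : ECatStruct M G) : ECat.{w} M :=
  ⟨G, s.comp, s.unit_comp, s.subst_comp⟩

theorem ECatStruct.toECat_injective {M : Multitensor V} {G : VGraph.{w} V} :
    Function.Injective (toECat : ECatStruct M G → ECat.{w} M) := by
  rintro ⟨comp, _, _⟩ ⟨comp', _, _⟩ h
  injection h with _ h
  obtain rfl : @comp = @comp' := h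
  rfl

theorem ECatStruct.exists_toECat_eq {M : Multitensor V} {G : VGraph.{w} V} (X : ECat.{w} M)
    (h : X.graph = G) : ∃ s : ECatStruct M G, s.toECat = X := by
  subst h
  exact ⟨⟨X.comp, X.unit_comp, X.subst_comp⟩, rfl⟩

/-- The endofunctor of `E`-Cat over an endofunctor `S` of `G V` that is given by `E`-category
structures on the graphs `S X` for which the morphisms `S f` are `E`-functors. -/
def ECatStruct.liftFunctor {M : Multitensor V} {S : VGraph.{w} V ⥤ VGraph.{w} V}
    (str : ∀ X : ECat.{w} M, ECatStruct M (S.obj X.graph))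
    (map : ∀ {X Y : ECat.{w} M} (f : X ⟶ Y),
      ECat.IsFunctor (str X).toECat (str Y).toECat (S.map f.toHom)) :
    ECat.{w} M ⥤ ECat.{w} M where
  obj X := (str X).toECat
  map f := ⟨S.map f.toHom, fun x => map f x⟩
  map_id _ := ECat.Hom.ext (S.map_id _)
  map_comp _ _ := ECat.Hom.ext (S.map_comp _ _)

theorem ECatStruct.exists_liftFunctor_eq {M : Multitensor V} {S : VGraph.{w} V ⥤ VGraph.{w} V}
    {F : ECat.{w} M ⥤ ECat.{w} M} (hF : ECat.forget M ⋙ S = F ⋙ ECat.forget M) :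
    ∃ (str : ∀ X : ECat.{w} M, ECatStruct M (S.obj X.graph))
      (map : ∀ {X Y : ECat.{w} M} (f : X ⟶ Y),
        ECat.IsFunctor (str X).toECat (str Y).toECat (S.map f.toHom)),
      liftFunctor str map = F := by
  obtain ⟨obj, map, map_id, map_comp⟩ := F
  have exists_str : ∀ X, ∃ s : ECatStruct M (S.obj X.graph), s.toECat = obj X := fun X =>
    ECatStruct.exists_toECat_eq (obj X) (Functor.congr_obj hF X).symm
  choose str hstr using exists_str
  obtain rfl : (fun X => (str X).toECat) = obj := funext hstr
  have map_toHom : ∀ {X Y : ECat.{w} M} (f : X ⟶ Y), (map f).toHom = S.map f.toHom := fun f =>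
    ((Functor.congr_hom hF f).trans ((Category.id_comp _).trans (Category.comp_id _))).symm
  have isFunctor : ∀ {X Y : ECat.{w} M} (f : X ⟶ Y),
      ECat.IsFunctor (str X).toECat (str Y).toECat (S.map f.toHom) := fun f _ _ x => by
    rw [← map_toHom f]
    exact (map f).comm x
  obtain rfl : @map = @fun X Y f => ⟨S.map f.toHom, fun x => isFunctor f x⟩ :=
    funext fun X => funext fun Y => funext fun f => ECat.Hom.ext (map_toHom f)
  exact ⟨str, isFunctor, rfl⟩

/-- What determines a lifting of a monad `S` on `G V` to `E`-Cat: `E`-category structures on the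
graphs `S X` for which the structure maps of `S` are `E`-functors. -/
structure LiftingData (M : Multitensor V) (S : Monad (VGraph.{w} V)) where
  str : ∀ X : ECat.{w} M, ECatStruct M (S.obj X.graph)
  map : ∀ {X Y : ECat.{w} M} (f : X ⟶ Y),
    ECat.IsFunctor (str X).toECat (str Y).toECat (S.map f.toHom)
  unit : ∀ X, ECat.IsFunctor X (str X).toECat (S.η.app X.graph)
  mul : ∀ X, ECat.IsFunctor (str (str X).toECat).toECat (str X).toECat (S.μ.app X.graph)

namespace LiftingData

variable {M : Multitensor V} {S : Monad (VGraph.{w} V)}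

theorem ext_str {L L' : LiftingData M S} (h : ∀ X, L.str X = L'.str X) : L = L' := by
  obtain ⟨str, _, _, _⟩ := L
  obtain ⟨str', _, _, _⟩ := L'
  obtain rfl : str = str' := funext h
  rfl

/-- The monad on `E`-Cat determined by lifting data. -/
def monad (L : LiftingData M S) : Monad (ECat.{w} M) where
  toFunctor := ECatStruct.liftFunctor L.str L.map
  η :=
    { app := fun X => ⟨S.η.app X.graph, fun x => L.unit X x⟩
      naturality := fun _ _ _ => ECat.Hom.ext (S.η.naturality _) }
  μ :=
    { app := fun X => ⟨S.μ.app X.graph, fun x => L.mul X x⟩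
      naturality := fun _ _ _ => ECat.Hom.ext (S.μ.naturality _) }
  left_unit _ := ECat.Hom.ext (S.left_unit _)
  right_unit _ := ECat.Hom.ext (S.right_unit _)
  assoc _ := ECat.Hom.ext (S.assoc _)

theorem mul_eq (L : LiftingData M S) (X : ECat.{w} M) :
    S.μ.app X.graph ≫ 𝟙 (S.obj X.graph) =
      S.map (𝟙 (S.obj X.graph)) ≫ 𝟙 (S.obj (S.obj X.graph)) ≫ (L.monad.μ.app X).toHom := by
  rw [S.map_id, Category.comp_id]
  exact (Category.id_comp _).symm.trans (whisker_eq _ (Category.id_comp _).symm)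

/-- The lifting determined by lifting data. -/
def toLifting (L : LiftingData M S) : Lifting M S where
  monad := L.monad
  functor_eq := rfl
  unit_eq _ := Category.comp_id _
  mul_eq := L.mul_eq

theorem toLifting_injective : Function.Injective (toLifting : LiftingData M S → Lifting M S) :=
  fun _ _ h => ext_str fun X =>
    ECatStruct.toECat_injective (congrArg (fun l : Lifting M S => l.monad.obj X) h)

theorem toLifting_surjective : Function.Surjective (toLifting : LiftingData M S → Lifting M S) := by
  rintro ⟨⟨F, η, μ, _, _, _⟩, hF, hη, hμ⟩
  obtain ⟨str, map, rfl⟩ := ECatStruct.exists_liftFunctor_eq hF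
  have η_toHom : ∀ X, (η.app X).toHom = S.η.app X.graph := fun X =>
    (hη X).symm.trans (Category.comp_id _)
  have μ_toHom : ∀ X, (μ.app X).toHom = S.μ.app X.graph := fun X =>
    ((Category.comp_id _).symm.trans ((hμ X).trans ((eq_whisker (S.map_id _) _).trans
      ((Category.id_comp _).trans (Category.id_comp _))))).symm
  have unit : ∀ X, ECat.IsFunctor X (str X).toECat (S.η.app X.graph) := fun X _ _ x => by
    rw [← η_toHom X]
    exact (η.app X).comm x
  have mul : ∀ X, ECat.IsFunctor (str (str X).toECat).toECat (str X).toECat (S.μ.app X.graph) :=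
    fun X _ _ x => by
      rw [← μ_toHom X]
      exact (μ.app X).comm x
  obtain rfl : η = (LiftingData.mk str map unit mul).monad.η :=
    NatTrans.ext (funext fun X => ECat.Hom.ext (η_toHom X))
  obtain rfl : μ = (LiftingData.mk str map unit mul).monad.μ :=
    NatTrans.ext (funext fun X => ECat.Hom.ext (μ_toHom X))
  exact ⟨⟨str, map, unit, mul⟩, rfl⟩

end LiftingData

namespace MonoidalCoherence

variable {M : Multitensor V} {T : Monad V}

theorem unit_liftComp (c : MonoidalCoherence M T) (X : ECat.{w} M) (a b : X.graph.obj) :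
    M.unit (T.obj (X.graph.hom a b)) ≫ singleCast M.E ((graphMonad T).obj X.graph) a b ≫
      c.τ (homs X.graph (ObjSeq.single a b)) ≫ T.map (X.comp (ObjSeq.single a b)) = 𝟙 _ := by
  have singleCast_τ : singleCast M.E ((graphMonad T).obj X.graph) a b ≫
      c.τ (homs X.graph (ObjSeq.single a b)) =
        c.τ (fun _ => X.graph.hom a b) ≫ T.map (singleCast M.E X.graph a b) :=
    tcast_comp_family c.τ rfl _
  calc M.unit (T.obj (X.graph.hom a b)) ≫ singleCast M.E ((graphMonad T).obj X.graph) a b ≫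
          c.τ (homs X.graph (ObjSeq.single a b)) ≫ T.map (X.comp (ObjSeq.single a b))
    _ = M.unit (T.obj (X.graph.hom a b)) ≫ c.τ (fun _ => X.graph.hom a b) ≫
          T.map (singleCast M.E X.graph a b) ≫ T.map (X.comp (ObjSeq.single a b)) :=
      whisker_eq _ (comp_whisker singleCast_τ _)
    _ = T.map (M.unit (X.graph.hom a b) ≫ singleCast M.E X.graph a b ≫
          X.comp (ObjSeq.single a b)) := by
      rw [reassoc_of% c.unit, T.map_comp, T.map_comp]
    _ = 𝟙 _ := by rw [X.unit_comp, T.map_id]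

theorem subst_liftComp (c : MonoidalCoherence M T) (X : ECat.{w} M) {a b : X.graph.obj}
    (x : ObjSeq X.graph.obj a b)
    (y : ∀ i : Fin x.len, ObjSeq X.graph.obj (x.vtx i.castSucc) (x.vtx i.succ)) :
    tmap M.E (fun i => c.τ (homs X.graph (y i)) ≫ T.map (X.comp (y i))) ≫
        c.τ (homs X.graph x) ≫ T.map (X.comp x) =
      M.subst (fun i => (y i).len) (fun i j => T.obj (homs X.graph (y i) j)) ≫
        concatCast M.E ((graphMonad T).obj X.graph) x y ≫
          c.τ (homs X.graph (x.concat y)) ≫ T.map (X.comp (x.concat y)) := by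
  have concatCast_τ : concatCast M.E ((graphMonad T).obj X.graph) x y ≫
      c.τ (homs X.graph (x.concat y)) =
        c.τ (flat fun i => homs X.graph (y i)) ≫ T.map (concatCast M.E X.graph x y) :=
    tcast_comp_family c.τ rfl _
  calc tmap M.E (fun i => c.τ (homs X.graph (y i)) ≫ T.map (X.comp (y i))) ≫
          c.τ (homs X.graph x) ≫ T.map (X.comp x)
    _ = tmap M.E (fun i => c.τ (homs X.graph (y i))) ≫ c.τ _ ≫
          T.map (tmap M.E (fun i => X.comp (y i)) ≫ X.comp x) := by
      rw [← tmap_comp, Category.assoc, reassoc_of% c.natural fun i => X.comp (y i), ← T.map_comp]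
    _ = M.subst (fun i => (y i).len) (fun i j => T.obj (homs X.graph (y i) j)) ≫
          c.τ (flat fun i => homs X.graph (y i)) ≫
            T.map (concatCast M.E X.graph x y) ≫ T.map (X.comp (x.concat y)) := by
      rw [X.subst_comp, T.map_comp, T.map_comp, reassoc_of% c.subst]
    _ = M.subst (fun i => (y i).len) (fun i j => T.obj (homs X.graph (y i) j)) ≫
          concatCast M.E ((graphMonad T).obj X.graph) x y ≫
            c.τ (homs X.graph (x.concat y)) ≫ T.map (X.comp (x.concat y)) :=
      whisker_eq _ (comp_whisker concatCast_τ _).symm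

/-- The `E`-category structure on `G(T) X`, for an `E`-category `X`, with compositions
`T(κ) τ`. -/
def liftStruct (c : MonoidalCoherence M T) (X : ECat.{w} M) :
    ECatStruct M ((graphMonad T).obj X.graph) where
  comp x := c.τ (homs X.graph x) ≫ T.map (X.comp x)
  unit_comp := c.unit_liftComp X
  subst_comp := c.subst_liftComp X

theorem liftComp_naturality (c : MonoidalCoherence M T) {X Y : ECat.{w} M} (f : X ⟶ Y)
    {a b : X.graph.obj} (x : ObjSeq X.graph.obj a b) :
    (c.τ (homs X.graph x) ≫ T.map (X.comp x)) ≫ T.map (f.toHom.hom a b) =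
      tmap M.E (fun i : Fin x.len => T.map (f.toHom.hom (x.vtx i.castSucc) (x.vtx i.succ))) ≫
        c.τ (homs Y.graph (x.map f.toHom.obj)) ≫ T.map (Y.comp (x.map f.toHom.obj)) := by
  have τ_naturality := c.natural (X := homs X.graph x) (Y := homs Y.graph (x.map f.toHom.obj))
    fun _ => f.toHom.hom _ _
  calc (c.τ (homs X.graph x) ≫ T.map (X.comp x)) ≫ T.map (f.toHom.hom a b)
    _ = c.τ (homs X.graph x) ≫ T.map (seqTensorMap M.E f.toHom x) ≫
          T.map (Y.comp (x.map f.toHom.obj)) := by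
      rw [Category.assoc, ← T.map_comp, ← T.map_comp, f.comm]
    _ = tmap M.E (fun i : Fin x.len => T.map (f.toHom.hom (x.vtx i.castSucc) (x.vtx i.succ))) ≫
          c.τ (homs Y.graph (x.map f.toHom.obj)) ≫ T.map (Y.comp (x.map f.toHom.obj)) :=
      (comp_whisker τ_naturality _).symm

theorem η_liftComp (c : MonoidalCoherence M T) (X : ECat.{w} M) {a b : X.graph.obj}
    (x : ObjSeq X.graph.obj a b) :
    X.comp x ≫ T.η.app (X.graph.hom a b) =
      tmap M.E (fun i => T.η.app (homs X.graph x i)) ≫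
        c.τ (homs X.graph x) ≫ T.map (X.comp x) := by
  rw [reassoc_of% c.monad_unit (homs X.graph x), T.unit_naturality]

theorem μ_liftComp (c : MonoidalCoherence M T) (X : ECat.{w} M) {a b : X.graph.obj}
    (x : ObjSeq X.graph.obj a b) :
    (c.τ (fun i => T.obj (homs X.graph x i)) ≫
        T.map (c.τ (homs X.graph x) ≫ T.map (X.comp x))) ≫ T.μ.app (X.graph.hom a b) =
      tmap M.E (fun i => T.μ.app (homs X.graph x i)) ≫
        c.τ (homs X.graph x) ≫ T.map (X.comp x) := by
  rw [reassoc_of% c.monad_mul (homs X.graph x), T.map_comp, Category.assoc, Category.assoc,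
    T.mu_naturality]

/-- The lifting data of a monoidal monad. -/
def liftingData (c : MonoidalCoherence M T) : LiftingData.{w} M (graphMonad T) where
  str := c.liftStruct
  map f _ _ x := c.liftComp_naturality f x
  unit X _ _ x := c.η_liftComp X x
  mul X _ _ x := c.μ_liftComp X x

end MonoidalCoherence

end LiftingData

section BeckLaw

variable {C : Type*} [Category C]

/-- The part of a lifting of a monad `S` to the algebras of a monad `R` from which its distributive
law is built: the actions of `R` on the values `S R G` and `S S R G` of the lifting at the free
algebra `R G` and at `S R G`. -/
structure FreeAlgebraLifting (S R : Monad C) where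
  act : ∀ G, R.obj (S.obj (R.obj G)) ⟶ S.obj (R.obj G)
  act₂ : ∀ G, R.obj (S.obj (S.obj (R.obj G))) ⟶ S.obj (S.obj (R.obj G))
  unit : ∀ G, R.η.app _ ≫ act G = 𝟙 _
  mul : ∀ G, R.μ.app _ ≫ act G = R.map (act G) ≫ act G
  natural : ∀ {G H} (f : G ⟶ H), R.map (S.map (R.map f)) ≫ act H = act G ≫ S.map (R.map f)
  map_mul : ∀ G, R.map (S.map (R.μ.app G)) ≫ act G = act (R.obj G) ≫ S.map (R.μ.app G)
  map_act : ∀ G, R.map (S.map (act G)) ≫ act₂ G = act (S.obj (R.obj G)) ≫ S.map (act G)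
  η_act : ∀ G, R.map (S.η.app (R.obj G)) ≫ act G = R.μ.app G ≫ S.η.app (R.obj G)
  μ_act : ∀ G, R.map (S.μ.app (R.obj G)) ≫ act G = act₂ G ≫ S.μ.app (R.obj G)

namespace FreeAlgebraLifting

variable {S R : Monad C} (L : FreeAlgebraLifting S R)

/-- The components `R S G ⟶ R S R G ⟶ S R G` of the distributive law of a lifting. -/
def lawApp (G : C) : R.obj (S.obj G) ⟶ S.obj (R.obj G) :=
  R.map (S.map (R.η.app G)) ≫ L.act G

theorem lawApp_natural {G H : C} (f : G ⟶ H) :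
    R.map (S.map f) ≫ L.lawApp H = L.lawApp G ≫ S.map (R.map f) := by
  simp only [lawApp, Category.assoc]
  rw [← L.natural, ← R.map_comp_assoc, ← R.map_comp_assoc, ← S.map_comp, ← S.map_comp,
    R.unit_naturality]

theorem η_lawApp (G : C) : R.η.app (S.obj G) ≫ L.lawApp G = S.map (R.η.app G) := by
  simp only [lawApp, Functor.id_obj]
  rw [← R.unit_naturality_assoc, L.unit]
  exact Category.comp_id _

theorem map_η_lawApp (G : C) : R.map (S.η.app G) ≫ L.lawApp G = S.η.app (R.obj G) := by
  rw [lawApp, ← R.map_comp_assoc, ← S.unit_naturality, R.map_comp_assoc, L.η_act]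
  exact R.right_unit_assoc _ _

theorem act₂_eq (G : C) :
    L.act₂ G = L.lawApp (S.obj (R.obj G)) ≫ S.map (L.act G) := by
  simp only [lawApp, Category.assoc, ← L.map_act, ← R.map_comp_assoc, ← S.map_comp, L.unit,
    Functor.id_obj, S.map_id, R.map_id, Category.id_comp]

theorem μ_lawApp (G : C) :
    R.μ.app (S.obj G) ≫ L.lawApp G =
      R.map (L.lawApp G) ≫ L.lawApp (R.obj G) ≫ S.map (R.μ.app G) := by
  have lawApp_map_μ : L.lawApp (R.obj G) ≫ S.map (R.μ.app G) = L.act G := by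
    simp only [lawApp, Category.assoc, ← L.map_mul, ← R.map_comp_assoc, ← S.map_comp, R.left_unit,
      Functor.id_obj, S.map_id, R.map_id, Category.id_comp]
  rw [lawApp_map_μ, lawApp, ← R.mu_naturality_assoc, L.mul, R.map_comp_assoc]

theorem map_μ_lawApp (G : C) :
    R.map (S.μ.app G) ≫ L.lawApp G =
      L.lawApp (S.obj G) ≫ S.map (L.lawApp G) ≫ S.μ.app (R.obj G) := by
  rw [lawApp, ← R.map_comp_assoc, ← S.mu_naturality, R.map_comp_assoc, L.μ_act, L.act₂_eq,
    Category.assoc, reassoc_of% L.lawApp_natural, S.map_comp_assoc]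

/-- The distributive law of a lifting. -/
def law : DistributiveLaw S R where
  app := L.lawApp
  natural := L.lawApp_natural
  unit_left := L.η_lawApp
  unit_right := L.map_η_lawApp
  mul_left := L.μ_lawApp
  mul_right := L.map_μ_lawApp

end FreeAlgebraLifting

end BeckLaw

theorem VGraph.Hom.hom_eq_of_mk_eq {V : Type u} [Category.{v} V] {X Y : VGraph.{w} V}
    {φ : X.obj → Y.obj} {f g : ∀ a b, X.hom a b ⟶ Y.hom (φ a) (φ b)}
    (h : (⟨φ, f⟩ : X ⟶ Y) = ⟨φ, g⟩) (a b : X.obj) : f a b = g a b := by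
  injection h with _ h
  exact congrFun (congrFun h a) b

section Action

variable {V : Type u} [Category.{v} V] [HasCoproducts.{w} V]

namespace ECat

variable {M : Multitensor V}

/-- The hom maps of the action of `Γ E` on the underlying graph of an `E`-category. -/
noncomputable def actionHom (X : ECat.{w} M) (a b : X.graph.obj) :
    (gammaObj M.E X.graph).hom a b ⟶ X.graph.hom a b :=
  Sigma.desc fun x => X.comp x

/-- The action of `Γ E` on the underlying graph of an `E`-category. -/
noncomputable abbrev action (X : ECat.{w} M) : gammaObj M.E X.graph ⟶ X.graph :=
  ⟨id, X.actionHom⟩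

theorem gammaIncl_actionHom (X : ECat.{w} M) {a b : X.graph.obj} (x : ObjSeq X.graph.obj a b) :
    gammaIncl M.E X.graph x ≫ X.actionHom a b = X.comp x :=
  Sigma.ι_desc _ _

theorem gammaUnitHom_actionHom (X : ECat.{w} M) (a b : X.graph.obj) :
    gammaUnitHom M X.graph a b ≫ X.actionHom a b = 𝟙 _ := by
  rw [gammaUnitHom, Category.assoc, Category.assoc, gammaIncl_actionHom, X.unit_comp]

theorem gammaIncl₂_gammaMapHom_action (X : ECat.{w} M) {a b : X.graph.obj}
    (x : ObjSeq X.graph.obj a b) (y : x.Inner) :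
    tmap M.E (fun i => gammaIncl M.E X.graph (y i)) ≫
        gammaIncl₂ M.E X.graph x ≫ gammaMapHom M.E X.action a b =
      tmap M.E (fun i => X.comp (y i)) ≫ gammaIncl M.E X.graph x := by
  have tmap_gammaIncl_action : tmap M.E (fun i => gammaIncl M.E X.graph (y i)) ≫
      seqTensorMap M.E X.action x = tmap M.E (fun i => X.comp (y i)) :=
    (tmap_comp M.E _ _).trans (congrArg (tmap M.E) (funext fun i => X.gammaIncl_actionHom (y i)))
  exact (whisker_eq _ (gammaIncl_map M.E X.action x)).trans
    ((Category.assoc _ _ _).symm.trans (eq_whisker tmap_gammaIncl_action _))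

theorem gammaMulHom_actionHom (hM : IsDistributive.{w} M.E) (X : ECat.{w} M)
    (a b : X.graph.obj) :
    gammaMulHom M hM X.graph a b ≫ X.actionHom a b =
      gammaMapHom M.E X.action a b ≫ X.actionHom a b :=
  gamma_hom_ext_one (X := gammaObj M.E X.graph) (a := a) (b := b) fun x =>
    gamma_hom_ext_two (X := X.graph) hM x fun y => by
  calc tmap M.E (fun i => gammaIncl M.E X.graph (y i)) ≫
          gammaIncl₂ M.E X.graph x ≫ gammaMulHom M hM X.graph a b ≫ X.actionHom a b
    _ = M.subst _ _ ≫ concatCast M.E X.graph x y ≫ X.comp (x.concat y) := by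
      rw [reassoc_of% gammaMul_spec M hM X.graph x y, gammaIncl_actionHom]
    _ = tmap M.E (fun i => X.comp (y i)) ≫ X.comp x := (X.subst_comp x y).symm
    _ = tmap M.E (fun i => gammaIncl M.E X.graph (y i)) ≫
          gammaIncl₂ M.E X.graph x ≫ gammaMapHom M.E X.action a b ≫ X.actionHom a b := by
      rw [reassoc_of% X.gammaIncl₂_gammaMapHom_action x y, gammaIncl_actionHom]

theorem gammaIncl_gammaMapHom_actionHom {X Y : ECat.{w} M} (f : X.graph ⟶ Y.graph)
    {a b : X.graph.obj} (x : ObjSeq X.graph.obj a b) :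
    gammaIncl M.E X.graph x ≫ gammaMapHom M.E f a b ≫ Y.actionHom (f.obj a) (f.obj b) =
      seqTensorMap M.E f x ≫ Y.comp (x.map f.obj) := by
  rw [reassoc_of% gammaIncl_map M.E f x, gammaIncl_actionHom]

theorem isFunctor_iff {X Y : ECat.{w} M} (f : X.graph ⟶ Y.graph) :
    IsFunctor X Y f ↔ X.action ≫ f = gammaMap M.E f ≫ Y.action := by
  constructor
  · intro hf
    refine VGraph.hom_ext fun a b => gamma_hom_ext_one fun x => ?_
    calc gammaIncl M.E X.graph x ≫ X.actionHom a b ≫ f.hom a b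
      _ = X.comp x ≫ f.hom a b := by rw [← Category.assoc, gammaIncl_actionHom]
      _ = seqTensorMap M.E f x ≫ Y.comp (x.map f.obj) := hf x
      _ = gammaIncl M.E X.graph x ≫ gammaMapHom M.E f a b ≫ Y.actionHom (f.obj a) (f.obj b) :=
        (gammaIncl_gammaMapHom_actionHom f x).symm
  · intro hf a b x
    have hom_eq : X.actionHom a b ≫ f.hom a b =
        gammaMapHom M.E f a b ≫ Y.actionHom (f.obj a) (f.obj b) :=
      VGraph.Hom.hom_eq_of_mk_eq hf a b
    rw [← gammaIncl_gammaMapHom_actionHom, ← hom_eq, ← Category.assoc, gammaIncl_actionHom]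

theorem gammaIncl₂_tmap_gammaMulHom (hM : IsDistributive.{w} M.E) (G : VGraph.{w} V) {a b : G.obj}
    (x : ObjSeq G.obj a b) (y : x.Inner) :
    tmap M.E (fun i => gammaIncl₂ M.E G (y i) ≫ gammaMulHom M hM G _ _) ≫
        gammaIncl₂ M.E G x ≫ gammaMulHom M hM G a b =
      tmap M.E (fun i => gammaIncl₂ M.E G (y i)) ≫
        gammaIncl₂ M.E (gammaObj M.E G) x ≫ gammaMapHom M.E (gammaMul M hM G) a b ≫
          gammaMulHom M hM G a b := by
  have gammaIncl_map_mul : gammaIncl₂ M.E (gammaObj M.E G) x ≫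
      gammaMapHom M.E (gammaMul M hM G) a b =
        tmap M.E (fun i => gammaMulHom M hM G _ _) ≫ gammaIncl₂ M.E G x :=
    gammaIncl_map M.E (gammaMul M hM G) x
  rw [← tmap_comp, Category.assoc, reassoc_of% gammaIncl_map_mul]

theorem subst_gammaMulHom (hM : IsDistributive.{w} M.E) (G : VGraph.{w} V) {a b : G.obj}
    (x : ObjSeq G.obj a b) (y : x.Inner) :
    tmap M.E (fun i => gammaIncl₂ M.E G (y i) ≫ gammaMulHom M hM G _ _) ≫
        gammaIncl₂ M.E G x ≫ gammaMulHom M hM G a b =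
      M.subst (fun i => (y i).len) (fun i => homs (gammaObj M.E G) (y i)) ≫
        concatCast M.E (gammaObj M.E G) x y ≫
          gammaIncl₂ M.E G (x.concat y) ≫ gammaMulHom M hM G a b := by
  have gammaMul_spec_gammaObj := gammaMul_spec M hM (gammaObj M.E G) x y
  calc _
    _ = tmap M.E (fun i => gammaIncl₂ M.E G (y i)) ≫
          gammaIncl₂ M.E (gammaObj M.E G) x ≫ gammaMapHom M.E (gammaMul M hM G) a b ≫
            gammaMulHom M hM G a b := gammaIncl₂_tmap_gammaMulHom hM G x y
    _ = tmap M.E (fun i => gammaIncl₂ M.E G (y i)) ≫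
          gammaIncl₂ M.E (gammaObj M.E G) x ≫ gammaMulHom M hM (gammaObj M.E G) a b ≫
            gammaMulHom M hM G a b :=
      whisker_eq _ (whisker_eq _ (gamma_assoc M hM G a b))
    _ = _ := by
      simpa only [Category.assoc] using gammaMul_spec_gammaObj =≫ gammaMulHom M hM G a b

/-- The free `E`-category on a graph. -/
noncomputable def free (hM : IsDistributive.{w} M.E) (G : VGraph.{w} V) : ECat.{w} M where
  graph := gammaObj M.E G
  comp x := gammaIncl₂ M.E G x ≫ gammaMulHom M hM G _ _
  unit_comp a b := by
    simpa only [gammaUnitHom, Category.assoc] using gamma_left_unit M hM G a b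
  subst_comp x y := subst_gammaMulHom hM G x y

theorem free_action (hM : IsDistributive.{w} M.E) (G : VGraph.{w} V) :
    (free hM G).action = gammaMul M hM G :=
  VGraph.hom_ext fun _ _ => gamma_hom_ext_one (X := gammaObj M.E G) fun x =>
    (free hM G).gammaIncl_actionHom x

/-- The action on the underlying graph of an `E`-category as an algebra structure for the monad
`Γ E`. -/
noncomputable def monadAction (hM : IsDistributive.{w} M.E) (X : ECat.{w} M) :
    (gammaMonad M hM).obj X.graph ⟶ X.graph :=
  X.action

theorem unit_monadAction (hM : IsDistributive.{w} M.E) (X : ECat.{w} M) :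
    (gammaMonad M hM).η.app X.graph ≫ X.monadAction hM = 𝟙 X.graph :=
  VGraph.hom_ext X.gammaUnitHom_actionHom

theorem mul_monadAction (hM : IsDistributive.{w} M.E) (X : ECat.{w} M) :
    (gammaMonad M hM).μ.app X.graph ≫ X.monadAction hM =
      (gammaMonad M hM).map (X.monadAction hM) ≫ X.monadAction hM :=
  VGraph.hom_ext (X.gammaMulHom_actionHom hM)

theorem free_monadAction (hM : IsDistributive.{w} M.E) (G : VGraph.{w} V) :
    (free hM G).monadAction hM = (gammaMonad M hM).μ.app G :=
  free_action hM G

theorem isFunctor_iff_monadAction (hM : IsDistributive.{w} M.E) {X Y : ECat.{w} M}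
    (f : X.graph ⟶ Y.graph) :
    IsFunctor X Y f ↔
      X.monadAction hM ≫ f = (gammaMonad M hM).map f ≫ Y.monadAction hM :=
  isFunctor_iff f

end ECat

namespace LiftingData

variable {M : Multitensor V} {S : Monad (VGraph.{w} V)} (hM : IsDistributive.{w} M.E)
  (L : LiftingData M S)

/-- The action of `Γ E` on `S X` for an `E`-category `X`. -/
noncomputable abbrev strAction (X : ECat.{w} M) :
    (gammaMonad M hM).obj (S.obj X.graph) ⟶ S.obj X.graph :=
  (L.str X).toECat.monadAction hM

theorem map_strAction {X Y : ECat.{w} M} (f : X.graph ⟶ Y.graph)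
    (h : X.monadAction hM ≫ f = (gammaMonad M hM).map f ≫ Y.monadAction hM) :
    (gammaMonad M hM).map (S.map f) ≫ L.strAction hM Y = L.strAction hM X ≫ S.map f :=
  ((ECat.isFunctor_iff_monadAction hM (X := (L.str X).toECat) (Y := (L.str Y).toECat)
    (S.map f)).1 (L.map (X := X) (Y := Y)
      ⟨f, fun x => (ECat.isFunctor_iff_monadAction hM f).2 h x⟩)).symm

theorem map_η_strAction (X : ECat.{w} M) :
    (gammaMonad M hM).map (S.η.app X.graph) ≫ L.strAction hM X =
      X.monadAction hM ≫ S.η.app X.graph :=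
  ((ECat.isFunctor_iff_monadAction hM (X := X) (Y := (L.str X).toECat) _).1 (L.unit X)).symm

theorem map_μ_strAction (X : ECat.{w} M) :
    (gammaMonad M hM).map (S.μ.app X.graph) ≫ L.strAction hM X =
      L.strAction hM (L.str X).toECat ≫ S.μ.app X.graph :=
  ((ECat.isFunctor_iff_monadAction hM (X := (L.str (L.str X).toECat).toECat)
    (Y := (L.str X).toECat) _).1 (L.mul X)).symm

/-- The values of a lifting at free `E`-categories. -/
noncomputable def freeAlgebraLifting : FreeAlgebraLifting S (gammaMonad M hM) where
  act G := L.strAction hM (ECat.free hM G)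
  act₂ G := L.strAction hM (L.str (ECat.free hM G)).toECat
  unit G := (L.str (ECat.free hM G)).toECat.unit_monadAction hM
  mul G := (L.str (ECat.free hM G)).toECat.mul_monadAction hM
  natural {G H} f := L.map_strAction hM (X := ECat.free hM G) (Y := ECat.free hM H)
    ((gammaMonad M hM).map f) (by
      rw [ECat.free_monadAction, ECat.free_monadAction]
      exact ((gammaMonad M hM).μ.naturality f).symm)
  map_mul G := L.map_strAction hM (X := ECat.free hM (gammaObj M.E G)) (Y := ECat.free hM G)
    ((gammaMonad M hM).μ.app G) (by
      rw [ECat.free_monadAction, ECat.free_monadAction]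
      exact ((gammaMonad M hM).assoc G).symm)
  map_act G := L.map_strAction hM (X := ECat.free hM (S.obj (gammaObj M.E G)))
    (Y := (L.str (ECat.free hM G)).toECat) (L.strAction hM (ECat.free hM G)) (by
      rw [ECat.free_monadAction]
      exact (L.str (ECat.free hM G)).toECat.mul_monadAction hM)
  η_act G := by
    have map_η := L.map_η_strAction hM (ECat.free hM G)
    rwa [ECat.free_monadAction] at map_η
  μ_act G := L.map_μ_strAction hM (ECat.free hM G)

/-- The distributive law of a lifting. -/
noncomputable def law : DistributiveLaw S (gammaMonad M hM) :=
  (L.freeAlgebraLifting hM).law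

theorem law_action (X : ECat.{w} M) :
    (L.law hM).app X.graph ≫ S.map (X.monadAction hM) = L.strAction hM X := by
  have map_map_strAction := L.map_strAction hM (X := ECat.free hM X.graph) (X.monadAction hM) (by
    rw [ECat.free_monadAction]
    exact X.mul_monadAction hM)
  calc ((gammaMonad M hM).map (S.map ((gammaMonad M hM).η.app X.graph)) ≫
          L.strAction hM (ECat.free hM X.graph)) ≫ S.map (X.monadAction hM)
    _ = (gammaMonad M hM).map (S.map ((gammaMonad M hM).η.app X.graph)) ≫
          (gammaMonad M hM).map (S.map (X.monadAction hM)) ≫ L.strAction hM X :=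
      (Category.assoc _ _ _).trans (whisker_eq _ map_map_strAction.symm)
    _ = L.strAction hM X := by
      rw [← Functor.map_comp_assoc, ← S.map_comp, ECat.unit_monadAction]
      simp only [Functor.id_obj, S.map_id]
      exact ((gammaMonad M hM).map_id _ =≫ L.strAction hM X).trans (Category.id_comp _)

end LiftingData

end Action

theorem isIso_sigma_ι_of_isInitial {C : Type*} [Category C] {J : Type*} (X : J → C)
    [HasCoproduct X] (j : J) (hX : ∀ k, k ≠ j → Nonempty (IsInitial (X k))) :
    IsIso (Sigma.ι X j) := by
  classical
  let retraction : ∐ X ⟶ X j := Sigma.desc fun k =>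
    if h : k = j then eqToHom (congrArg X h) else (hX k h).some.to (X j)
  have ι_retraction : Sigma.ι X j ≫ retraction = 𝟙 (X j) := by simp [retraction]
  refine ⟨retraction, ι_retraction, Sigma.hom_ext _ _ fun k => ?_⟩
  by_cases h : k = j
  · subst h
    rw [reassoc_of% ι_retraction, Category.comp_id]
  · exact (hX k h).some.hom_ext _ _

/-- The sequence of objects given by its vertices. -/
abbrev ObjSeq.ofVtx {O : Type w} {n : ℕ} (φ : Fin (n + 1) → O) :
    ObjSeq O (φ 0) (φ (Fin.last n)) :=
  ⟨n, φ, rfl, rfl⟩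

theorem ObjSeq.eq_ofVtx_of_steps {n : ℕ}
    (x : ObjSeq (ULift.{w} (Fin (n + 1))) ⟨0⟩ ⟨Fin.last n⟩)
    (h : ∀ i : Fin x.len, ∃ j : Fin n,
      (x.vtx i.castSucc).down = j.castSucc ∧ (x.vtx i.succ).down = j.succ) :
    x = ObjSeq.ofVtx (ULift.up : Fin (n + 1) → ULift.{w} (Fin (n + 1))) := by
  have val_vtx (k : Fin (x.len + 1)) : (x.vtx k).down.val = k.val := by
    induction k using Fin.induction with
    | zero => rw [x.head]; rfl
    | succ i ih =>
      obtain ⟨j, down_castSucc, down_succ⟩ := h i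
      rw [down_castSucc] at ih
      rw [down_succ, Fin.val_succ, Fin.val_succ]
      exact congrArg (· + 1) ih
  have len_eq : x.len = n := by
    have val_last := val_vtx (Fin.last x.len)
    rw [x.last] at val_last
    exact val_last.symm
  exact ObjSeq.ext_of len_eq fun i => ULift.ext _ _ (Fin.ext (val_vtx i.succ))

theorem IsDistributive.nonempty_isInitial {V : Type u} [Category.{v} V] {E : TensorFunctor V}
    (hE : IsDistributive.{w} E) {n : ℕ} (X : Fin n → V) (i : Fin n)
    (hX : Nonempty (IsInitial (X i))) : Nonempty (IsInitial ((E n).obj X)) := by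
  obtain ⟨hX⟩ := hX
  have existsUnique_hom (A : V) := hE.existsUnique_one X i (J := PEmpty) (fun j => j.elim)
    (fun j => j.elim) (fun j => j.elim) ⟨Cofan.IsColimit.mk _ (fun s => hX.to s.pt)
      (fun _ j => j.elim) fun _ _ _ => hX.hom_ext _ _⟩ (A := A) fun j => j.elim
  exact ⟨IsInitial.ofUniqueHom (fun A => (existsUnique_hom A).choose)
    fun A f => (existsUnique_hom A).unique (fun j => j.elim) (fun j => j.elim)⟩

section Path

variable {V : Type u} [Category.{v} V] [HasCoproducts.{w} V]

open Classical in
/-- The graph with vertices `0, …, n`, with `X i` as the hom from `i` to `i + 1` and with all other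
homs initial. -/
noncomputable def pathGraph {n : ℕ} (X : Fin n → V) : VGraph.{w} V where
  obj := ULift.{w} (Fin (n + 1))
  hom a b := if h : ∃ i : Fin n, a.down = i.castSucc ∧ b.down = i.succ then X h.choose
    else ∐ (fun e : PEmpty.{w + 1} => e.elim)

/-- The sequence `0, …, n` of vertices of `pathGraph X`. -/
abbrev pathSeq {n : ℕ} (X : Fin n → V) :
    ObjSeq (pathGraph.{w} X).obj ⟨0⟩ ⟨Fin.last n⟩ :=
  ObjSeq.ofVtx (ULift.up : Fin (n + 1) → (pathGraph.{w} X).obj)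

theorem pathGraph_hom {n : ℕ} (X : Fin n → V) (i : Fin n) :
    (pathGraph.{w} X).hom ⟨i.castSucc⟩ ⟨i.succ⟩ = X i := by
  have exists_step : ∃ j : Fin n, i.castSucc = j.castSucc ∧ i.succ = j.succ := ⟨i, rfl, rfl⟩
  have choose_eq : exists_step.choose = i :=
    (Fin.succ_injective _ exists_step.choose_spec.2).symm
  exact (dif_pos exists_step).trans (congrArg X choose_eq)

theorem nonempty_isInitial_pathGraph_hom {n : ℕ} (X : Fin n → V) {a b : (pathGraph.{w} X).obj}
    (h : ¬ ∃ i : Fin n, a.down = i.castSucc ∧ b.down = i.succ) :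
    Nonempty (IsInitial ((pathGraph.{w} X).hom a b)) := by
  rw [show (pathGraph.{w} X).hom a b = ∐ (fun e : PEmpty.{w + 1} => e.elim) from dif_neg h]
  exact ⟨IsInitial.ofUniqueHom (fun A => Sigma.desc fun e => e.elim)
    fun A m => Sigma.hom_ext _ _ fun e => e.elim⟩

theorem exists_pathGraph_hom_desc {n : ℕ} (X : Fin n → V) (H : VGraph.{w} V)
    (φ : Fin (n + 1) → H.obj) (g : ∀ i : Fin n, X i ⟶ H.hom (φ i.castSucc) (φ i.succ))
    (a b : (pathGraph.{w} X).obj) :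
    ∃ f : (pathGraph.{w} X).hom a b ⟶ H.hom (φ a.down) (φ b.down),
      ∀ i : Fin n, a.down = i.castSucc → b.down = i.succ → f ≍ g i := by
  by_cases hab : ∃ i : Fin n, a.down = i.castSucc ∧ b.down = i.succ
  · obtain ⟨a⟩ := a
    obtain ⟨b⟩ := b
    obtain ⟨i, rfl, rfl⟩ := hab
    refine ⟨eqToHom (pathGraph_hom X i) ≫ g i, fun j _ hj => ?_⟩
    obtain rfl : i = j := Fin.succ_injective _ hj
    exact eqToHom_comp_heq _ _
  · exact ⟨(nonempty_isInitial_pathGraph_hom X hab).some.to _,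
      fun i ha hb => absurd ⟨i, ha, hb⟩ hab⟩

theorem isIso_gammaIncl_pathSeq {E : TensorFunctor V} (hE : IsDistributive.{w} E) {n : ℕ}
    (X : Fin n → V) : IsIso (gammaIncl E (pathGraph.{w} X) (pathSeq X)) := by
  refine isIso_sigma_ι_of_isInitial _ (pathSeq.{w} X) fun x hx => ?_
  obtain ⟨i, hi⟩ := not_forall.1 fun h => hx (ObjSeq.eq_ofVtx_of_steps x h)
  exact hE.nonempty_isInitial _ i (nonempty_isInitial_pathGraph_hom X hi)

theorem exists_path {E : TensorFunctor V} (hE : IsDistributive.{w} E) {n : ℕ} (X : Fin n → V) :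
    ∃ (G : VGraph.{w} V) (p : Fin (n + 1) → G.obj),
      (fun i : Fin n => G.hom (p i.castSucc) (p i.succ)) = X ∧
      IsIso (gammaIncl E G (ObjSeq.ofVtx p)) ∧
      ∀ (H : VGraph.{w} V) (φ : Fin (n + 1) → H.obj)
        (g : ∀ i : Fin n, G.hom (p i.castSucc) (p i.succ) ⟶ H.hom (φ i.castSucc) (φ i.succ)),
        ∃ f : G ⟶ H, (fun k => f.obj (p k)) = φ ∧
          ∀ i : Fin n, f.hom (p i.castSucc) (p i.succ) ≍ g i := by
  refine ⟨pathGraph X, ULift.up, funext (pathGraph_hom X), isIso_gammaIncl_pathSeq hE X,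
    fun H φ g => ?_⟩
  choose f hf using exists_pathGraph_hom_desc X H φ fun i =>
    eqToHom (pathGraph_hom X i).symm ≫ g i
  exact ⟨⟨fun a => φ a.down, f⟩, rfl, fun i =>
    (hf _ _ i rfl rfl).trans (eqToHom_comp_heq _ _)⟩

end Path

theorem VGraph.exists_eq_mk {V : Type u} [Category.{v} V] {X Y : VGraph.{w} V}
    (f : X ⟶ Y) {φ : X.obj → Y.obj} (h : f.obj = φ) :
    ∃ g : ∀ a b, X.hom a b ⟶ Y.hom (φ a) (φ b), f = ⟨φ, g⟩ := by
  subst h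
  exact ⟨f.hom, rfl⟩

section GammaLaw

variable {V : Type u} [Category.{v} V] [HasCoproducts.{w} V]

/-- The hom maps of a family of morphisms `Γ(E) G(T) X ⟶ G(T) Γ(E) X` that are identities on
objects. -/
abbrev GammaFamily (M : Multitensor V) (T : Monad V) :=
  ∀ (G : VGraph.{w} V) (a b : G.obj),
    (gammaObj M.E ((graphMonad T).obj G)).hom a b ⟶ T.obj ((gammaObj M.E G).hom a b)

/-- Families of maps of the form of a monoidal monad coherence. -/
abbrev CoherenceFamily (M : Multitensor V) (T : Monad V) :=
  ∀ ⦃n : ℕ⦄ (X : Fin n → V), (M.E n).obj (fun i => T.obj (X i)) ⟶ T.obj ((M.E n).obj X)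

variable {M : Multitensor V} {T : Monad V}

/-- The morphism of graphs with given hom maps. -/
abbrev GammaFamily.app (l : GammaFamily.{w} M T) (G : VGraph.{w} V) :
    gammaObj M.E ((graphMonad T).obj G) ⟶ (graphMonad T).obj (gammaObj M.E G) :=
  ⟨id, l G⟩

variable (M T) in
/-- The conditions on a family of maps `Γ(E) G(T) X ⟶ G(T) Γ(E) X` of being a distributive law,
expressed on homs. -/
structure IsGammaLaw (hM : IsDistributive.{w} M.E) (l : GammaFamily.{w} M T) : Prop where
  natural : ∀ {G H : VGraph.{w} V} (f : G ⟶ H) (a b : G.obj),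
    gammaMapHom M.E ((graphMonad T).map f) a b ≫ l H (f.obj a) (f.obj b) =
      l G a b ≫ T.map (gammaMapHom M.E f a b)
  unit_left : ∀ (G : VGraph.{w} V) (a b : G.obj),
    gammaUnitHom M ((graphMonad T).obj G) a b ≫ l G a b = T.map (gammaUnitHom M G a b)
  unit_right : ∀ (G : VGraph.{w} V) (a b : G.obj),
    gammaMapHom M.E ((graphMonad T).η.app G) a b ≫ l G a b = T.η.app _
  mul_left : ∀ (G : VGraph.{w} V) (a b : G.obj),
    gammaMulHom M hM ((graphMonad T).obj G) a b ≫ l G a b =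
      gammaMapHom M.E (l.app G) a b ≫ l (gammaObj M.E G) a b ≫ T.map (gammaMulHom M hM G a b)
  mul_right : ∀ (G : VGraph.{w} V) (a b : G.obj),
    gammaMapHom M.E ((graphMonad T).μ.app G) a b ≫ l G a b =
      l ((graphMonad T).obj G) a b ≫ T.map (l G a b) ≫ T.μ.app _

theorem exists_isGammaLaw (hM : IsDistributive.{w} M.E) (d : IdOnObjDistributiveLaw.{w} M T hM) :
    ∃ l : GammaFamily.{w} M T, IsGammaLaw M T hM l ∧ ∀ G, d.1.app G = l.app G := by
  have exists_hom (G) : ∃ g : ∀ a b, (gammaObj M.E ((graphMonad T).obj G)).hom a b ⟶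
      T.obj ((gammaObj M.E G).hom a b), d.1.app G = ⟨id, g⟩ :=
    VGraph.exists_eq_mk (X := gammaObj M.E ((graphMonad T).obj G))
      (Y := (graphMonad T).obj (gammaObj M.E G)) (d.1.app G) (d.2 G)
  choose l app_eq using exists_hom
  refine ⟨l, ⟨fun {G H} f a b => ?_, fun G a b => ?_, fun G a b => ?_, fun G a b => ?_,
    fun G a b => ?_⟩, app_eq⟩
  · have natural := d.1.natural f
    rw [app_eq, app_eq] at natural
    exact VGraph.Hom.hom_eq_of_mk_eq (X := gammaObj M.E ((graphMonad T).obj G))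
      (Y := (graphMonad T).obj (gammaObj M.E H)) natural a b
  · have unit_left := d.1.unit_left G
    rw [app_eq] at unit_left
    exact VGraph.Hom.hom_eq_of_mk_eq (X := (graphMonad T).obj G)
      (Y := (graphMonad T).obj (gammaObj M.E G)) unit_left a b
  · have unit_right := d.1.unit_right G
    rw [app_eq] at unit_right
    exact VGraph.Hom.hom_eq_of_mk_eq (X := gammaObj M.E G)
      (Y := (graphMonad T).obj (gammaObj M.E G)) unit_right a b
  · have mul_left := d.1.mul_left G
    rw [app_eq, app_eq] at mul_left
    exact VGraph.Hom.hom_eq_of_mk_eq (X := gammaObj M.E (gammaObj M.E ((graphMonad T).obj G)))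
      (Y := (graphMonad T).obj (gammaObj M.E G)) mul_left a b
  · have mul_right := d.1.mul_right G
    rw [app_eq, app_eq] at mul_right
    exact VGraph.Hom.hom_eq_of_mk_eq
      (X := gammaObj M.E ((graphMonad T).obj ((graphMonad T).obj G)))
      (Y := (graphMonad T).obj (gammaObj M.E G)) mul_right a b

theorem GammaFamily.exists_factor (hM : IsDistributive.{w} M.E) (l : GammaFamily.{w} M T)
    (hl : ∀ {G H : VGraph.{w} V} (f : G ⟶ H) (a b : G.obj),
      gammaMapHom M.E ((graphMonad T).map f) a b ≫ l H (f.obj a) (f.obj b) =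
        l G a b ≫ T.map (gammaMapHom M.E f a b)) {n : ℕ} (X : Fin n → V) :
    ∃ t : (M.E n).obj (fun i => T.obj (X i)) ⟶ T.obj ((M.E n).obj X),
      ∀ (H : VGraph.{w} V) (φ : Fin (n + 1) → H.obj)
        (g : ∀ i : Fin n, X i ⟶ H.hom (φ i.castSucc) (φ i.succ)),
        tmap M.E (fun i => T.map (g i)) ≫
            gammaIncl M.E ((graphMonad T).obj H) (ObjSeq.ofVtx φ) ≫ l H _ _ =
          t ≫ T.map (tmap M.E g ≫ gammaIncl M.E H (ObjSeq.ofVtx φ)) := by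
  obtain ⟨G, p, rfl, isIso_gammaIncl, exists_hom⟩ := exists_path hM X
  refine ⟨gammaIncl M.E ((graphMonad T).obj G) (ObjSeq.ofVtx p) ≫ l G _ _ ≫
    T.map (inv (gammaIncl M.E G (ObjSeq.ofVtx p))), fun H φ g => ?_⟩
  obtain ⟨f, rfl, hf⟩ := exists_hom H φ g
  obtain rfl : (fun i => f.hom (p i.castSucc) (p i.succ)) = g := funext fun i => eq_of_heq (hf i)
  have gammaIncl_map_f : gammaIncl M.E G (ObjSeq.ofVtx p) ≫ gammaMapHom M.E f _ _ =
      tmap M.E (fun i => f.hom (p i.castSucc) (p i.succ)) ≫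
        gammaIncl M.E H (ObjSeq.ofVtx fun k => f.obj (p k)) :=
    gammaIncl_map M.E f (ObjSeq.ofVtx p)
  have natural_f := comp_whisker
    (gammaIncl_map M.E ((graphMonad T).map f) (ObjSeq.ofVtx p)).symm (l H _ _)
  have map_f_eq : T.map (gammaMapHom M.E f _ _) =
      T.map (inv (gammaIncl M.E G (ObjSeq.ofVtx p))) ≫
        T.map (gammaIncl M.E G (ObjSeq.ofVtx p) ≫ gammaMapHom M.E f _ _) := by
    rw [← T.map_comp, IsIso.inv_hom_id_assoc]
  rw [← gammaIncl_map_f]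
  refine natural_f.trans ((whisker_eq _ ((hl f _ _).trans (whisker_eq _ map_f_eq))).trans ?_)
  exact ((Category.assoc _ _ _).trans (whisker_eq _ (Category.assoc _ _ _))).symm

/-- The family `l` restricts to the natural family `τ` on the summands of `Γ(E) G(T) G`. -/
structure GammaFamily.RestrictsTo (l : GammaFamily.{w} M T) (τ : CoherenceFamily M T) : Prop where
  natural : ∀ {n : ℕ} {X Y : Fin n → V} (f : ∀ i, X i ⟶ Y i),
    tmap M.E (fun i => T.map (f i)) ≫ τ Y = τ X ≫ T.map (tmap M.E f)
  gammaIncl_comp : ∀ (G : VGraph.{w} V) {a b : G.obj} (x : ObjSeq G.obj a b),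
    gammaIncl M.E ((graphMonad T).obj G) x ≫ l G a b = τ (homs G x) ≫ T.map (gammaIncl M.E G x)

theorem IsGammaLaw.exists_restrictsTo {hM : IsDistributive.{w} M.E} {l : GammaFamily.{w} M T}
    (hl : IsGammaLaw M T hM l) : ∃ τ, l.RestrictsTo τ := by
  choose τ hτ using fun (n : ℕ) (X : Fin n → V) => l.exists_factor hM hl.natural X
  have gammaIncl_comp (G : VGraph.{w} V) {a b : G.obj} (x : ObjSeq G.obj a b) :
      gammaIncl M.E ((graphMonad T).obj G) x ≫ l G a b =
        τ _ (homs G x) ≫ T.map (gammaIncl M.E G x) := by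
    obtain ⟨n, φ, rfl, rfl⟩ := x
    have factor_id := hτ n _ G φ fun _ => 𝟙 _
    simp only [T.map_id, tmap_id, Category.id_comp] at factor_id
    exact factor_id
  refine ⟨τ, fun {n X Y} f => ?_, gammaIncl_comp⟩
  obtain ⟨H, q, rfl, isIso_gammaIncl, -⟩ := exists_path hM Y
  refine (cancel_mono (T.map (gammaIncl M.E H (ObjSeq.ofVtx q)))).1 ?_
  rw [Category.assoc, Category.assoc, ← T.map_comp, ← hτ n X H q f]
  exact whisker_eq _ (gammaIncl_comp H (ObjSeq.ofVtx q)).symm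

end GammaLaw

namespace ObjSeq

variable {O : Type w}

theorem psum_succ {m : ℕ} (n : Fin m → ℕ) (i : Fin m) :
    ∑ t : Fin i.succ.1, n (Fin.castLE (Nat.le_of_lt_succ i.succ.2) t) =
      ∑ t : Fin i.1, n (Fin.castLE i.2.le t) + n i :=
  Fin.sum_univ_castSucc (n := i.1) _

theorem psum_add_lt {m : ℕ} (n : Fin m → ℕ) (i : Fin m) (j : Fin (n i + 1)) :
    ∑ t : Fin i.1, n (Fin.castLE i.2.le t) + j.1 < (∑ i, n i) + 1 := by
  have psum_lt_succ := psum_lt n i.succ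
  rw [psum_succ] at psum_lt_succ
  omega

/-- The sequence of end points of the consecutive blocks of lengths `n i` of a sequence. -/
def blocks {m : ℕ} (n : Fin m → ℕ) (p : Fin ((∑ i, n i) + 1) → O) :
    ObjSeq O (p 0) (p (Fin.last _)) where
  len := m
  vtx k := p ⟨_, psum_lt n k⟩
  head := rfl
  last := rfl

/-- The `i`-th of the consecutive blocks of lengths `n i` of a sequence. -/
def block {m : ℕ} (n : Fin m → ℕ) (p : Fin ((∑ i, n i) + 1) → O) (i : Fin m) :
    ObjSeq O ((blocks n p).vtx (Fin.castSucc i)) ((blocks n p).vtx (Fin.succ i)) where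
  len := n i
  vtx j := p ⟨_, psum_add_lt n i j⟩
  head := rfl
  last := congrArg p (Fin.ext (psum_succ n i).symm)

theorem block_castSucc {m : ℕ} (n : Fin m → ℕ) (p : Fin ((∑ i, n i) + 1) → O) (i : Fin m)
    (j : Fin (n i)) : (block n p i).vtx j.castSucc =
      p (finSigmaFinEquiv (⟨i, j⟩ : (i : Fin m) × Fin (n i))).castSucc :=
  congrArg p (Fin.ext (finSigmaFinEquiv_apply (⟨i, j⟩ : (i : Fin m) × Fin (n i))).symm)

theorem block_succ {m : ℕ} (n : Fin m → ℕ) (p : Fin ((∑ i, n i) + 1) → O) (i : Fin m)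
    (j : Fin (n i)) : (block n p i).vtx j.succ =
      p (finSigmaFinEquiv (⟨i, j⟩ : (i : Fin m) × Fin (n i))).succ :=
  congrArg p (Fin.ext (congrArg (· + 1)
    (finSigmaFinEquiv_apply (⟨i, j⟩ : (i : Fin m) × Fin (n i))).symm))

theorem blocks_concat_block {m : ℕ} (n : Fin m → ℕ) (p : Fin ((∑ i, n i) + 1) → O) :
    (blocks n p).concat (block n p) = ofVtx p :=
  ext_of rfl fun l => by
    obtain ⟨⟨i, j⟩, rfl⟩ := (finSigmaFinEquiv (n := n)).surjective l
    exact ((blocks n p).concatVtx_succ (block n p) i j).trans (block_succ n p i j)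

theorem single_eq_ofVtx (p : Fin 2 → O) : single (p 0) (p (Fin.last 1)) = ofVtx p :=
  ext_of rfl fun i : Fin 1 => by
    rw [Subsingleton.elim i 0]
    rfl

end ObjSeq

section GammaLaw

variable {V : Type u} [Category.{v} V] [HasCoproducts.{w} V] {M : Multitensor V} {T : Monad V}

theorem isIso_gammaIncl_of_eq {E : TensorFunctor V} {G : VGraph.{w} V} {a b : G.obj}
    {x y : ObjSeq G.obj a b} (h : x = y) (hy : IsIso (gammaIncl E G y)) :
    IsIso (gammaIncl E G x) := by
  subst h
  exact hy

namespace GammaFamily.RestrictsTo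

variable {hM : IsDistributive.{w} M.E} {l : GammaFamily.{w} M T} {τ : CoherenceFamily M T}
  (hτ : l.RestrictsTo τ)

include hτ

theorem single_comp (G : VGraph.{w} V) (a b : G.obj) :
    singleCast M.E ((graphMonad T).obj G) a b ≫
        gammaIncl M.E ((graphMonad T).obj G) (ObjSeq.single a b) ≫ l G a b =
      τ (fun _ : Fin 1 => G.hom a b) ≫
        T.map (singleCast M.E G a b ≫ gammaIncl M.E G (ObjSeq.single a b)) := by
  have tcast_τ : singleCast M.E ((graphMonad T).obj G) a b ≫ τ (homs G (ObjSeq.single a b)) =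
      τ (fun _ : Fin 1 => G.hom a b) ≫ T.map (singleCast M.E G a b) :=
    tcast_comp_family (fun X => τ X) rfl _
  rw [T.map_comp]
  exact (whisker_eq _ (hτ.gammaIncl_comp G _)).trans (comp_whisker tcast_τ _)

theorem concat_comp (G : VGraph.{w} V) {a b : G.obj} (x : ObjSeq G.obj a b) (y : x.Inner) :
    concatCast M.E ((graphMonad T).obj G) x y ≫
        gammaIncl M.E ((graphMonad T).obj G) (x.concat y) ≫ l G a b =
      τ (flat fun i => homs G (y i)) ≫
        T.map (concatCast M.E G x y ≫ gammaIncl M.E G (x.concat y)) := by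
  have tcast_τ : concatCast M.E ((graphMonad T).obj G) x y ≫ τ (homs G (x.concat y)) =
      τ (flat fun i => homs G (y i)) ≫ T.map (concatCast M.E G x y) :=
    tcast_comp_family (fun X => τ X) rfl _
  rw [T.map_comp]
  exact (whisker_eq _ (hτ.gammaIncl_comp G _)).trans (comp_whisker tcast_τ _)

theorem unit_comp (hl : IsGammaLaw M T hM l) (G : VGraph.{w} V) (a b : G.obj) :
    M.unit (T.obj (G.hom a b)) ≫ τ (fun _ : Fin 1 => G.hom a b) ≫
        T.map (singleCast M.E G a b ≫ gammaIncl M.E G (ObjSeq.single a b)) =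
      T.map (M.unit (G.hom a b)) ≫
        T.map (singleCast M.E G a b ≫ gammaIncl M.E G (ObjSeq.single a b)) := by
  rw [← hτ.single_comp, ← T.map_comp]
  have unit_left := hl.unit_left G a b
  simp only [gammaUnitHom, Category.assoc] at unit_left
  exact unit_left

theorem gammaIncl₂_mul (G : VGraph.{w} V) {a b : G.obj} (x : ObjSeq G.obj a b) (y : x.Inner) :
    tmap M.E (fun i => gammaIncl M.E ((graphMonad T).obj G) (y i)) ≫
        gammaIncl₂ M.E ((graphMonad T).obj G) x ≫
          gammaMulHom M hM ((graphMonad T).obj G) a b ≫ l G a b =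
      M.subst (fun i => (y i).len) (fun i j => T.obj (homs G (y i) j)) ≫
        τ (flat fun i => homs G (y i)) ≫
          T.map (concatCast M.E G x y ≫ gammaIncl M.E G (x.concat y)) := by
  have mul_spec := gammaMul_spec M hM ((graphMonad T).obj G) x y =≫ l G a b
  simp only [Category.assoc] at mul_spec
  exact mul_spec.trans (whisker_eq _ (hτ.concat_comp G x y))

theorem gammaIncl₂_map (G : VGraph.{w} V) {a b : G.obj} (x : ObjSeq G.obj a b) (y : x.Inner) :
    tmap M.E (fun i => gammaIncl M.E ((graphMonad T).obj G) (y i)) ≫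
        gammaIncl₂ M.E ((graphMonad T).obj G) x ≫
          gammaMapHom M.E (l.app G) a b ≫ l (gammaObj M.E G) a b =
      tmap M.E (fun i => τ (homs G (y i))) ≫ τ (fun i => (M.E (y i).len).obj (homs G (y i))) ≫
        T.map (tmap M.E (fun i => gammaIncl M.E G (y i)) ≫ gammaIncl₂ M.E G x) := by
  have tmap_gammaIncl_l : tmap M.E (fun i => gammaIncl M.E ((graphMonad T).obj G) (y i)) ≫
      seqTensorMap M.E (l.app G) x =
        tmap M.E (fun i => τ (homs G (y i))) ≫ tmap M.E fun i => T.map (gammaIncl M.E G (y i)) :=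
    (tmap_comp M.E _ _).trans ((congrArg (tmap M.E)
      (funext fun i => hτ.gammaIncl_comp G (y i))).trans (tmap_comp M.E _ _).symm)
  have l_comp : gammaIncl M.E ((graphMonad T).obj (gammaObj M.E G)) x ≫ l (gammaObj M.E G) a b =
      τ (homs (gammaObj M.E G) x) ≫ T.map (gammaIncl₂ M.E G x) :=
    hτ.gammaIncl_comp (gammaObj M.E G) x
  rw [T.map_comp, ← reassoc_of% hτ.natural fun i => gammaIncl M.E G (y i)]
  refine (whisker_eq _ (comp_whisker (gammaIncl_map M.E (l.app G) x) _)).trans ?_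
  exact (comp_whisker tmap_gammaIncl_l _).trans (whisker_eq _ (whisker_eq _ l_comp))

theorem subst_comp (hl : IsGammaLaw M T hM l) (G : VGraph.{w} V) {a b : G.obj}
    (x : ObjSeq G.obj a b) (y : x.Inner) :
    (tmap M.E (fun i => τ (homs G (y i))) ≫ τ (fun i => (M.E (y i).len).obj (homs G (y i))) ≫
        T.map (M.subst (fun i => (y i).len) fun i => homs G (y i))) ≫
          T.map (concatCast M.E G x y ≫ gammaIncl M.E G (x.concat y)) =
      (M.subst (fun i => (y i).len) (fun i j => T.obj (homs G (y i) j)) ≫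
        τ (flat fun i => homs G (y i))) ≫
          T.map (concatCast M.E G x y ≫ gammaIncl M.E G (x.concat y)) := by
  have mul_left := whisker_eq (tmap M.E fun i => gammaIncl M.E ((graphMonad T).obj G) (y i))
    (whisker_eq (gammaIncl₂ M.E ((graphMonad T).obj G) x) (hl.mul_left G a b))
  have map_mul := hτ.gammaIncl₂_map G x y =≫ T.map (gammaMulHom M hM G a b)
  have map_mul_spec : T.map (tmap M.E (fun i => gammaIncl M.E G (y i)) ≫ gammaIncl₂ M.E G x) ≫
      T.map (gammaMulHom M hM G a b) =
        T.map (M.subst (fun i => (y i).len) fun i => homs G (y i)) ≫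
          T.map (concatCast M.E G x y ≫ gammaIncl M.E G (x.concat y)) := by
    rw [← T.map_comp, ← T.map_comp]
    exact congrArg T.map ((Category.assoc _ _ _).trans (gammaMul_spec M hM G x y))
  simp only [Category.assoc] at map_mul ⊢
  rw [← map_mul_spec]
  refine ((Category.assoc _ _ _).trans (whisker_eq _ (Category.assoc _ _ _))).symm.trans ?_
  exact map_mul.symm.trans (mul_left.symm.trans (hτ.gammaIncl₂_mul G x y))

theorem η_comp (hl : IsGammaLaw M T hM l) (G : VGraph.{w} V) {a b : G.obj}
    (x : ObjSeq G.obj a b) :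
    (tmap M.E (fun i => T.η.app (homs G x i)) ≫ τ (homs G x)) ≫ T.map (gammaIncl M.E G x) =
      T.η.app ((M.E x.len).obj (homs G x)) ≫ T.map (gammaIncl M.E G x) := by
  rw [Category.assoc, ← hτ.gammaIncl_comp G x]
  refine (comp_whisker (gammaIncl_map M.E ((graphMonad T).η.app G) x).symm _).trans ?_
  exact (whisker_eq _ (hl.unit_right G a b)).trans (T.η.naturality _)

theorem μ_comp (hl : IsGammaLaw M T hM l) (G : VGraph.{w} V) {a b : G.obj}
    (x : ObjSeq G.obj a b) :
    (tmap M.E (fun i => T.μ.app (homs G x i)) ≫ τ (homs G x)) ≫ T.map (gammaIncl M.E G x) =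
      (τ (fun i => T.obj (homs G x i)) ≫ T.map (τ (homs G x)) ≫
        T.μ.app ((M.E x.len).obj (homs G x))) ≫ T.map (gammaIncl M.E G x) := by
  have map_l_μ : T.map (gammaIncl M.E ((graphMonad T).obj G) x) ≫ T.map (l G a b) ≫
      T.μ.app ((gammaObj M.E G).hom a b) =
        T.map (τ (homs G x)) ≫ T.μ.app ((M.E x.len).obj (homs G x)) ≫
          T.map (gammaIncl M.E G x) := by
    have map_gammaIncl_l : T.map (gammaIncl M.E ((graphMonad T).obj G) x) ≫ T.map (l G a b) =
        T.map (τ (homs G x)) ≫ T.map (T.map (gammaIncl M.E G x)) :=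
      (T.map_comp _ _).symm.trans
        ((congrArg T.map (hτ.gammaIncl_comp G x)).trans (T.map_comp _ _))
    exact (comp_whisker map_gammaIncl_l _).trans (whisker_eq _ (T.μ.naturality _))
  rw [Category.assoc, ← hτ.gammaIncl_comp G x]
  refine (comp_whisker (gammaIncl_map M.E ((graphMonad T).μ.app G) x).symm _).trans ?_
  refine (whisker_eq _ (hl.mul_right G a b)).trans ?_
  refine (comp_whisker (hτ.gammaIncl_comp ((graphMonad T).obj G) x) _).trans ?_
  simp only [Category.assoc]
  exact whisker_eq _ map_l_μ

end GammaFamily.RestrictsTo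

theorem IsGammaLaw.exists_coherence {hM : IsDistributive.{w} M.E} {l : GammaFamily.{w} M T}
    (hl : IsGammaLaw M T hM l) :
    ∃ c : MonoidalCoherence M T, l.RestrictsTo fun _ X => c.τ X := by
  obtain ⟨τ, hτ⟩ := hl.exists_restrictsTo
  refine ⟨⟨fun {n} X => τ X, hτ.natural, fun X => ?unit, fun {m} n Z => ?subst,
    fun {n} X => ?η, fun {n} X => ?μ⟩, hτ⟩
  case unit =>
    obtain ⟨G, p, hX, isIso_gammaIncl, -⟩ := exists_path hM fun _ : Fin 1 => X
    obtain rfl : G.hom (p 0) (p (Fin.last 1)) = X := congrFun hX 0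
    have := isIso_gammaIncl_of_eq (ObjSeq.single_eq_ofVtx p) isIso_gammaIncl
    have : IsIso (singleCast M.E G (p 0) (p (Fin.last 1))) := isIso_tcast _ _ _
    refine (cancel_mono (T.map (singleCast M.E G _ _ ≫ gammaIncl M.E G (ObjSeq.single _ _)))).1 ?_
    exact (Category.assoc _ _ _).trans (hτ.unit_comp hl G _ _)
  case subst =>
    obtain ⟨G, p, hZ, isIso_gammaIncl, -⟩ := exists_path hM (flat Z)
    obtain rfl : (fun i => homs G (ObjSeq.block n p i)) = Z := funext fun i => funext fun j =>
      (congrArg₂ G.hom (ObjSeq.block_castSucc n p i j) (ObjSeq.block_succ n p i j)).trans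
        ((congrFun hZ _).trans (flat_apply Z ⟨i, j⟩))
    let x := ObjSeq.blocks n p
    let y := ObjSeq.block n p
    have := isIso_gammaIncl_of_eq (ObjSeq.blocks_concat_block n p) isIso_gammaIncl
    have : IsIso (concatCast M.E G x y) := isIso_tcast _ _ _
    exact (cancel_mono (T.map (concatCast M.E G x y ≫ gammaIncl M.E G (x.concat y)))).1
      (hτ.subst_comp hl G x y)
  case η =>
    obtain ⟨G, p, rfl, isIso_gammaIncl, -⟩ := exists_path hM X
    exact (cancel_mono (T.map (gammaIncl M.E G (ObjSeq.ofVtx p)))).1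
      (hτ.η_comp hl G (ObjSeq.ofVtx p))
  case μ =>
    obtain ⟨G, p, rfl, isIso_gammaIncl, -⟩ := exists_path hM X
    exact (cancel_mono (T.map (gammaIncl M.E G (ObjSeq.ofVtx p)))).1
      (hτ.μ_comp hl G (ObjSeq.ofVtx p))

end GammaLaw

section Equivalences

variable {V : Type u} [Category.{v} V] [HasCoproducts.{w} V] {M : Multitensor V} {T : Monad V}

theorem ECatStruct.ext_actionHom {G : VGraph.{w} V} {s s' : ECatStruct M G}
    (h : ∀ a b, s.toECat.actionHom a b = s'.toECat.actionHom a b) : s = s' := by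
  have comp_eq {a b : G.obj} (x : ObjSeq G.obj a b) : s.comp x = s'.comp x :=
    (s.toECat.gammaIncl_actionHom x).symm.trans
      ((whisker_eq _ (h a b)).trans (s'.toECat.gammaIncl_actionHom x))
  obtain ⟨κ, _, _⟩ := s
  obtain ⟨κ', _, _⟩ := s'
  obtain rfl : @κ = @κ' := funext fun a => funext fun b => funext fun x => comp_eq x
  rfl

theorem LiftingData.eq_of_law_eq (hM : IsDistributive.{w} M.E) {S : Monad (VGraph.{w} V)}
    {L L' : LiftingData M S} (h : L.law hM = L'.law hM) : L = L' := by
  refine LiftingData.ext_str fun X => ECatStruct.ext_actionHom fun a b => ?_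
  have strAction_eq : L.strAction hM X = L'.strAction hM X := by
    rw [← L.law_action hM X, h, L'.law_action hM X]
  exact VGraph.Hom.hom_eq_of_mk_eq strAction_eq a b

namespace GammaFamily.RestrictsTo

theorem family_unique {l l' : GammaFamily.{w} M T} {τ : CoherenceFamily M T}
    (h : l.RestrictsTo τ) (h' : l'.RestrictsTo τ) : l = l' :=
  funext fun G => funext fun _ => funext fun _ =>
    gamma_hom_ext_one (X := (graphMonad T).obj G) fun x =>
      (h.gammaIncl_comp G x).trans (h'.gammaIncl_comp G x).symm

theorem coherence_unique (hM : IsDistributive.{w} M.E) {l : GammaFamily.{w} M T}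
    {τ τ' : CoherenceFamily M T} (h : l.RestrictsTo τ) (h' : l.RestrictsTo τ') : τ = τ' := by
  funext n X
  obtain ⟨G, p, rfl, isIso_gammaIncl, -⟩ := exists_path hM X
  exact (cancel_mono (T.map (gammaIncl M.E G (ObjSeq.ofVtx p)))).1
    ((h.gammaIncl_comp G (ObjSeq.ofVtx p)).symm.trans (h'.gammaIncl_comp G (ObjSeq.ofVtx p)))

end GammaFamily.RestrictsTo

theorem tmap_gammaUnitHom_gammaIncl₂_gammaMulHom (hM : IsDistributive.{w} M.E) (G : VGraph.{w} V)
    {a b : G.obj} (x : ObjSeq G.obj a b) :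
    tmap M.E (fun i : Fin x.len => gammaUnitHom M G (x.vtx i.castSucc) (x.vtx i.succ)) ≫
        gammaIncl₂ M.E G x ≫ gammaMulHom M hM G a b =
      gammaIncl M.E G x := by
  refine (comp_whisker (gammaIncl_map M.E (gammaUnit M G) x).symm _).trans ?_
  exact (whisker_eq _ (gamma_right_unit M hM G a b)).trans (Category.comp_id _)

namespace MonoidalCoherence

/-- The maps `Γ(E) G(T) X ⟶ G(T) Γ(E) X` with components `T(k_x) τ`. -/
noncomputable def gammaFamily (c : MonoidalCoherence M T) : GammaFamily.{w} M T :=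
  fun G _ _ => Sigma.desc fun x => c.τ (homs G x) ≫ T.map (gammaIncl M.E G x)

theorem gammaFamily_restrictsTo (c : MonoidalCoherence M T) :
    c.gammaFamily.{w}.RestrictsTo fun _ X => c.τ X :=
  ⟨c.natural, fun _ _ _ _ => Sigma.ι_desc _ _⟩

theorem liftingData_law_app (hM : IsDistributive.{w} M.E) (c : MonoidalCoherence M T)
    (G : VGraph.{w} V) : (c.liftingData.law hM).app G = c.gammaFamily.app G := by
  refine VGraph.hom_ext fun a b => gamma_hom_ext_one (X := (graphMonad T).obj G) fun x => ?_
  have natural_unit := c.natural fun i : Fin x.len =>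
    gammaUnitHom M G (x.vtx i.castSucc) (x.vtx i.succ)
  have map_unit_mul := (T.map_comp _ _).symm.trans
    (congrArg T.map (tmap_gammaUnitHom_gammaIncl₂_gammaMulHom hM G x))
  refine Eq.trans ?_ (c.gammaFamily_restrictsTo.gammaIncl_comp G x).symm
  refine (comp_whisker (gammaIncl_map M.E ((graphMonad T).map (gammaUnit M G)) x) _).trans ?_
  refine (whisker_eq _ ((c.liftStruct (ECat.free hM G)).toECat.gammaIncl_actionHom x)).trans ?_
  exact (comp_whisker natural_unit _).trans (whisker_eq _ map_unit_mul)

/-- The distributive law of `G(T)` over `Γ(E)` determined by a monoidal monad coherence. -/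
noncomputable def toLaw (hM : IsDistributive.{w} M.E) (c : MonoidalCoherence M T) :
    IdOnObjDistributiveLaw.{w} M T hM :=
  ⟨c.liftingData.law hM, fun _ => rfl⟩

theorem toLaw_injective (hM : IsDistributive.{w} M.E) :
    Function.Injective (toLaw hM : MonoidalCoherence M T → _) := by
  intro c c' h
  have gammaFamily_eq : c.gammaFamily = c'.gammaFamily := by
    funext G a b
    have app_eq : c.gammaFamily.app G = c'.gammaFamily.app G := by
      rw [← c.liftingData_law_app hM, ← c'.liftingData_law_app hM]
      exact congrArg (fun d : IdOnObjDistributiveLaw.{w} M T hM => d.1.app G) h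
    exact VGraph.Hom.hom_eq_of_mk_eq app_eq a b
  have τ_eq := c.gammaFamily_restrictsTo.coherence_unique hM
    (gammaFamily_eq ▸ c'.gammaFamily_restrictsTo)
  exact MonoidalCoherence.ext (funext fun n => funext (congrFun (congrFun τ_eq n)))

theorem toLaw_surjective (hM : IsDistributive.{w} M.E) :
    Function.Surjective (toLaw hM : MonoidalCoherence M T → _) := by
  intro d
  obtain ⟨l, hl, app_eq⟩ := exists_isGammaLaw hM d
  obtain ⟨c, hc⟩ := hl.exists_coherence
  refine ⟨c, Subtype.ext (DistributiveLaw.ext (funext fun G => ?_))⟩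
  exact (c.liftingData_law_app hM G).trans
    ((congrArg (·.app G) (c.gammaFamily_restrictsTo.family_unique hc)).trans (app_eq G).symm)

end MonoidalCoherence

/-- Monoidal monad coherences correspond to distributive laws of `G(T)` over `Γ(E)`. -/
noncomputable def lawEquiv (hM : IsDistributive.{w} M.E) (T : Monad V) :
    MonoidalCoherence M T ≃ IdOnObjDistributiveLaw.{w} M T hM :=
  Equiv.ofBijective (MonoidalCoherence.toLaw hM)
    ⟨MonoidalCoherence.toLaw_injective hM, MonoidalCoherence.toLaw_surjective hM⟩

theorem liftingData_toLifting_bijective (hM : IsDistributive.{w} M.E) (T : Monad V) :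
    Function.Bijective fun c : MonoidalCoherence M T => c.liftingData.{w}.toLifting := by
  refine ⟨fun c c' h => MonoidalCoherence.toLaw_injective hM (Subtype.ext ?_), fun L => ?_⟩
  · exact congrArg (fun L : LiftingData M (graphMonad T) => L.law hM)
      (LiftingData.toLifting_injective h)
  · obtain ⟨L, rfl⟩ := LiftingData.toLifting_surjective L
    obtain ⟨c, toLaw_c⟩ := MonoidalCoherence.toLaw_surjective hM ⟨L.law hM, fun _ => rfl⟩
    exact ⟨c, congrArg LiftingData.toLifting
      (LiftingData.eq_of_law_eq hM (congrArg Subtype.val toLaw_c))⟩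

/-- Monoidal monad coherences correspond to liftings of `G(T)` to `E`-categories. -/
noncomputable def liftingEquiv (hM : IsDistributive.{w} M.E) (T : Monad V) :
    MonoidalCoherence M T ≃ Lifting.{w} M (graphMonad T) :=
  Equiv.ofBijective _ (liftingData_toLifting_bijective hM T)

end Equivalences

section SingleComposition

theorem hom_eq_homs_single {V : Type u} (G : VGraph.{w} V) (a b : G.obj) (i : Fin 1) :
    G.hom a b = homs G (ObjSeq.single a b) i :=
  congrArg₂ G.hom (ObjSeq.single_castSucc a b i).symm (ObjSeq.single_succ a b i).symm

variable {V : Type u} [Category.{v} V]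

theorem Multitensor.tcast_substLeft (M : Multitensor V) {n : ℕ} {X Y : Fin n → V}
    (h : ∀ i, X i = Y i) :
    tmap M.E (fun _ : Fin 1 => tcast M.E rfl h) ≫ M.substLeft Y =
      M.substLeft X ≫ tcast M.E rfl h := by
  obtain rfl : X = Y := funext h
  exact (eq_whisker (tmap_id M.E _) _).trans
    ((Category.id_comp _).trans (Category.comp_id _).symm)

theorem tmap_singleCast_subst (M : Multitensor V) (G : VGraph.{w} V) {a b : G.obj}
    (x : ObjSeq G.obj a b) :
    tmap M.E (fun i => singleCast M.E G (x.vtx i.castSucc) (x.vtx i.succ)) ≫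
        M.subst (fun _ => 1) (fun i => homs G (ObjSeq.single (x.vtx i.castSucc) (x.vtx i.succ))) =
      M.subst (fun _ => 1) (fun i _ => homs G x i) ≫
        tcast M.E rfl (fun l => hom_eq_homs_single G _ _ (finSigmaFinEquiv.symm l).2) :=
  (eq_whisker (tmap_eqToHom M.E fun _ => tobj_congr M.E rfl (hom_eq_homs_single G _ _)) _).trans
    (subst_tcast (E := M.E) M.subst rfl (n := fun _ => 1) (n' := fun _ => 1) (fun _ => rfl)
      (fun _ => hom_eq_homs_single G _ _) _ rfl _)

namespace ECat

variable {M : Multitensor V}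

theorem eq_of_toHom_eq_eqToHom {X Y : ECat.{w} M} (f : X ⟶ Y) (h : X.graph = Y.graph)
    (hf : f.toHom = eqToHom h) : X = Y := by
  obtain ⟨G, comp, _, _⟩ := X
  obtain ⟨G', comp', _, _⟩ := Y
  dsimp only at h
  subst h
  have comp_eq : ∀ {a b : G.obj} (x : ObjSeq G.obj a b), comp x = comp' x := fun {a b} x => by
    have comm := f.comm x
    rw [hf] at comm
    exact (Category.comp_id _).symm.trans (comm.trans
      ((eq_whisker (tmap_id M.E _) _).trans (Category.id_comp _)))
  obtain rfl : @comp = @comp' := funext fun a => funext fun b => funext fun x => comp_eq x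
  rfl

theorem tcast_comp_congr (X : ECat.{w} M) {a b : X.graph.obj} {x y : ObjSeq X.graph.obj a b}
    (h : x = y) {n : ℕ} {Z : Fin n → V} (hx : n = x.len) (hy : n = y.len)
    (hZx : ∀ i, Z i = homs X.graph x (Fin.cast hx i))
    (hZy : ∀ i, Z i = homs X.graph y (Fin.cast hy i)) :
    tcast M.E hx hZx ≫ X.comp x = tcast M.E hy hZy ≫ X.comp y := by
  subst h
  rfl

theorem comp_eqToHom (X : ECat.{w} M) {a b a' b' : X.graph.obj} (x : ObjSeq X.graph.obj a b)
    (ha : a = a') (hb : b = b') (h : X.graph.hom a b = X.graph.hom a' b') :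
    X.comp x ≫ eqToHom h = X.comp (x.copy ha hb) := by
  subst ha hb
  exact Category.comp_id _

theorem tmap_comp_singleCast (X : ECat.{w} M) {a b : X.graph.obj} (x : ObjSeq X.graph.obj a b) :
    tmap M.E (fun _ : Fin 1 => X.comp x) ≫ singleCast M.E X.graph a b =
      tmap M.E fun i : Fin 1 => X.comp (x.copy (ObjSeq.single_castSucc a b i).symm
        (ObjSeq.single_succ a b i).symm) := by
  let y : (ObjSeq.single a b).Inner := fun i =>
    x.copy (ObjSeq.single_castSucc a b i).symm (ObjSeq.single_succ a b i).symm
  refine (tcast_tmap M.E (X := fun _ : Fin 1 => seqTensor M.E X.graph x)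
    (Y := fun i => seqTensor M.E X.graph (y i)) rfl (fun _ => rfl) _ _
    (fun i => X.comp (y i)) fun i => ?_).trans (Category.id_comp _)
  exact (X.comp_eqToHom x (ObjSeq.single_castSucc a b i).symm
    (ObjSeq.single_succ a b i).symm _).trans (Category.id_comp _).symm

theorem tmap_comp_comp_single (X : ECat.{w} M) {a b : X.graph.obj} (x : ObjSeq X.graph.obj a b) :
    tmap M.E (fun _ : Fin 1 => X.comp x) ≫ singleCast M.E X.graph a b ≫
        X.comp (ObjSeq.single a b) =
      M.substLeft (homs X.graph x) ≫ X.comp x := by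
  let y : (ObjSeq.single a b).Inner := fun i =>
    x.copy (ObjSeq.single_castSucc a b i).symm (ObjSeq.single_succ a b i).symm
  have tmap_comp_comp : tmap M.E (fun i => X.comp (y i)) ≫ X.comp (ObjSeq.single a b) =
      M.subst (fun _ => x.len) (fun _ => homs X.graph x) ≫
        tcast M.E (by simp) (flat_unit_left (homs X.graph x)) ≫ X.comp x :=
    (X.subst_comp (ObjSeq.single a b) y).trans (whisker_eq _
      (X.tcast_comp_congr (ObjSeq.concat_single_left x) _ _ _ _))
  exact (Category.assoc _ _ _).symm.trans ((eq_whisker (X.tmap_comp_singleCast x) _).trans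
    (tmap_comp_comp.trans (Category.assoc _ _ _).symm))

theorem tmap_comp_single_comp (X : ECat.{w} M) {a b : X.graph.obj} (x : ObjSeq X.graph.obj a b) :
    tmap M.E (fun i : Fin x.len => singleCast M.E X.graph (x.vtx i.castSucc) (x.vtx i.succ) ≫
        X.comp (ObjSeq.single (x.vtx i.castSucc) (x.vtx i.succ))) ≫ X.comp x =
      M.substRight (homs X.graph x) ≫ X.comp x := by
  let y : x.Inner := fun i => ObjSeq.single (x.vtx i.castSucc) (x.vtx i.succ)
  have tcast_comp : tcast M.E rfl
      (fun l => hom_eq_homs_single X.graph _ _ (finSigmaFinEquiv.symm l).2) ≫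
        concatCast M.E X.graph x y ≫ X.comp (x.concat y) =
      tcast M.E (by simp) (flat_unit_right (homs X.graph x)) ≫ X.comp x :=
    (Category.assoc _ _ _).symm.trans ((eq_whisker (tcast_trans M.E _ _ _ _) _).trans
      (X.tcast_comp_congr (ObjSeq.concat_single_right x) _ _ _ _))
  calc
    _ = tmap M.E (fun i => singleCast M.E X.graph (x.vtx i.castSucc) (x.vtx i.succ)) ≫
          tmap M.E (fun i => X.comp (y i)) ≫ X.comp x := by
      rw [← tmap_comp, Category.assoc]
    _ = M.subst (fun _ => 1) (fun i _ => homs X.graph x i) ≫ tcast M.E rfl _ ≫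
          concatCast M.E X.graph x y ≫ X.comp (x.concat y) :=
      (whisker_eq _ (X.subst_comp x y)).trans
        (comp_whisker (tmap_singleCast_subst M X.graph x) _)
    _ = M.subst (fun _ => 1) (fun i _ => homs X.graph x i) ≫
          tcast M.E (by simp) (flat_unit_right (homs X.graph x)) ≫ X.comp x :=
      whisker_eq _ tcast_comp
    _ = M.substRight (homs X.graph x) ≫ X.comp x := (Category.assoc _ _ _).symm

theorem singleCast_seqTensorMap_comp (X : ECat.{w} M) {G : VGraph.{w} V} (f : G ⟶ X.graph)
    (a b : G.obj) :
    singleCast M.E G a b ≫ seqTensorMap M.E f (ObjSeq.single a b) ≫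
        X.comp ((ObjSeq.single a b).map f.obj) =
      tmap M.E (fun _ : Fin 1 => f.hom a b) ≫ singleCast M.E X.graph (f.obj a) (f.obj b) ≫
        X.comp (ObjSeq.single (f.obj a) (f.obj b)) := by
  have map_single : (ObjSeq.single a b).map f.obj = ObjSeq.single (f.obj a) (f.obj b) :=
    ObjSeq.ext_of rfl fun i => (congrArg f.obj (ObjSeq.single_succ a b i)).trans
      (ObjSeq.single_succ (f.obj a) (f.obj b) i).symm
  have homs_eq : ∀ i : Fin 1, X.graph.hom (f.obj a) (f.obj b) =
      homs X.graph ((ObjSeq.single a b).map f.obj) i := fun i => congrArg₂ X.graph.hom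
    (congrArg f.obj (ObjSeq.single_castSucc a b i)).symm
    (congrArg f.obj (ObjSeq.single_succ a b i)).symm
  have tmap_hom : singleCast M.E G a b ≫ seqTensorMap M.E f (ObjSeq.single a b) =
      tmap M.E (fun _ : Fin 1 => f.hom a b) ≫ tcast M.E rfl homs_eq :=
    (tcast_tmap M.E rfl _ _ _ _ fun i => VGraph.hom_eqToHom f
      (ObjSeq.single_castSucc a b i).symm (ObjSeq.single_succ a b i).symm _ _).symm
  exact (comp_whisker tmap_hom _).trans
    (whisker_eq _ (X.tcast_comp_congr map_single _ _ _ _))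

end ECat

end SingleComposition

theorem exists_inverse_of_bijective_obj {C D : Type*} [Category C] [Category D] (Φ : C ⥤ D)
    [Φ.Full] [Φ.Faithful] (h : Function.Bijective Φ.obj) :
    ∃ Ψ : D ⥤ C, Φ ⋙ Ψ = 𝟭 C ∧ Ψ ⋙ Φ = 𝟭 D := by
  let e := Equiv.ofBijective Φ.obj h
  have obj_symm : ∀ Y, Φ.obj (e.symm Y) = Y := e.apply_symm_apply
  let Ψ : D ⥤ C :=
    { obj := e.symm
      map := fun {X Y} f => Φ.preimage (eqToHom (obj_symm X) ≫ f ≫ eqToHom (obj_symm Y).symm)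
      map_id := fun X => Φ.map_injective (by simp)
      map_comp := fun f g => Φ.map_injective (by simp) }
  have map_conj {X Y : C} (f : X ⟶ Y) :
      Φ.map (eqToHom (e.symm_apply_apply X) ≫ f ≫ eqToHom (e.symm_apply_apply Y).symm) =
        eqToHom (obj_symm _) ≫ Φ.map f ≫ eqToHom (obj_symm _).symm := by
    rw [Φ.map_comp, Φ.map_comp, eqToHom_map, eqToHom_map]
    rfl
  exact ⟨Ψ,
    CategoryTheory.Functor.ext e.symm_apply_apply fun X Y f =>
      Φ.map_injective ((Φ.map_preimage _).trans (map_conj f).symm),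
    CategoryTheory.Functor.ext obj_symm fun X Y f => Φ.map_preimage _⟩

section Algebras

variable {V : Type u} [Category.{v} V] {M : Multitensor V} {T : Monad V}

namespace CompositeMultitensor

variable (s : CompositeMultitensor M T)

section ECat

variable (X : ECat.{w} s.toMultitensor)

theorem unit_comp (a b : X.graph.obj) :
    M.unit (X.graph.hom a b) ≫ T.η.app _ ≫ T.map (singleCast M.E X.graph a b) ≫
      X.comp (ObjSeq.single a b) = 𝟙 _ := by
  have unit_comp := X.unit_comp a b
  rw [show singleCast s.toMultitensor.E X.graph a b = T.map (singleCast M.E X.graph a b) from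
    tcast_compTensor _ _] at unit_comp
  exact (Category.assoc _ _ _).symm.trans unit_comp

theorem map_tmap_comp_comp {a b : X.graph.obj} (x : ObjSeq X.graph.obj a b) (y : x.Inner) :
    T.map (tmap M.E fun i => X.comp (y i)) ≫ X.comp x =
      s.subst (fun i => (y i).len) (fun i => homs X.graph (y i)) ≫
        T.map (concatCast M.E X.graph x y) ≫ X.comp (x.concat y) := by
  rw [← show concatCast s.toMultitensor.E X.graph x y = T.map (concatCast M.E X.graph x y) from
    tcast_compTensor _ _]
  exact X.subst_comp x y

/-- The action `T X(a,b) ⟶ X(a,b)` on the homs of a `T E`-category `X`: the composition of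
sequences of length one, restricted along `T u`. -/
def homAction (a b : X.graph.obj) : T.obj (X.graph.hom a b) ⟶ X.graph.hom a b :=
  T.map (M.unit (X.graph.hom a b)) ≫ T.map (singleCast M.E X.graph a b) ≫
    X.comp (ObjSeq.single a b)

theorem map_tmap_comp_single {a b : X.graph.obj} (x : ObjSeq X.graph.obj a b) :
    T.map (tmap M.E fun _ : Fin 1 => X.comp x) ≫ T.map (singleCast M.E X.graph a b) ≫
        X.comp (ObjSeq.single a b) =
      s.substLeft (homs X.graph x) ≫ X.comp x := by
  rw [← show singleCast s.toMultitensor.E X.graph a b = T.map (singleCast M.E X.graph a b) from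
    tcast_compTensor _ _]
  exact X.tmap_comp_comp_single x

theorem map_tmap_single_comp {a b : X.graph.obj} (x : ObjSeq X.graph.obj a b) :
    T.map (tmap M.E fun i : Fin x.len =>
        T.map (singleCast M.E X.graph (x.vtx i.castSucc) (x.vtx i.succ)) ≫
          X.comp (ObjSeq.single (x.vtx i.castSucc) (x.vtx i.succ))) ≫ X.comp x =
      s.substRight (homs X.graph x) ≫ X.comp x := by
  simp only [← show ∀ a b, singleCast s.toMultitensor.E X.graph a b =
    T.map (singleCast M.E X.graph a b) from fun _ _ => tcast_compTensor _ _]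
  exact X.tmap_comp_single_comp x

theorem map_tmap_hom_comp_single {G : VGraph.{w} V} (f : G ⟶ X.graph) (a b : G.obj) :
    T.map (tmap M.E fun _ : Fin 1 => f.hom a b) ≫
        T.map (singleCast M.E X.graph (f.obj a) (f.obj b)) ≫
          X.comp (ObjSeq.single (f.obj a) (f.obj b)) =
      T.map (singleCast M.E G a b) ≫ T.map (seqTensorMap M.E f (ObjSeq.single a b)) ≫
        X.comp ((ObjSeq.single a b).map f.obj) := by
  simp only [← show ∀ (H : VGraph.{w} V) a b, singleCast s.toMultitensor.E H a b =
    T.map (singleCast M.E H a b) from fun _ _ _ => tcast_compTensor _ _]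
  exact (X.singleCast_seqTensorMap_comp f a b).symm

theorem map_comp_homAction {a b : X.graph.obj} (x : ObjSeq X.graph.obj a b) :
    T.map (X.comp x) ≫ s.homAction X a b =
      T.map (M.unit _) ≫ s.substLeft (homs X.graph x) ≫ X.comp x := by
  rw [homAction, ← s.map_tmap_comp_single]
  exact comp_whisker (map_unit_natural (M := M) (X.comp x)) _

theorem η_homAction (a b : X.graph.obj) :
    T.η.app (X.graph.hom a b) ≫ s.homAction X a b = 𝟙 _ :=
  (comp_whisker (T.η.naturality (M.unit (X.graph.hom a b))) _).symm.trans (s.unit_comp X a b)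

theorem map_η_comp_homAction {a b : X.graph.obj} (x : ObjSeq X.graph.obj a b) :
    T.map (T.η.app ((M.E x.len).obj (homs X.graph x)) ≫ X.comp x) ≫ s.homAction X a b =
      X.comp x := by
  rw [T.map_comp, Category.assoc]
  refine (whisker_eq _ (s.map_comp_homAction X x)).trans ?_
  rw [reassoc_of% map_unit_natural (M := M) (T := T)]
  simp only [Functor.id_obj]
  rw [reassoc_of% s.map_unit_η_substLeft]

theorem map_tmap_homAction_comp {a b : X.graph.obj} (x : ObjSeq X.graph.obj a b) :
    T.map (tmap M.E fun i => s.homAction X (x.vtx i.castSucc) (x.vtx i.succ)) ≫ X.comp x =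
      T.map (tmap M.E fun i => T.map (M.unit (homs X.graph x i))) ≫
        s.substRight (homs X.graph x) ≫ X.comp x := by
  rw [← s.map_tmap_single_comp, reassoc_of% map_tmap_comp (M := M) (T := T)]
  rfl

theorem μ_homAction (a b : X.graph.obj) :
    T.μ.app (X.graph.hom a b) ≫ s.homAction X a b =
      T.map (s.homAction X a b) ≫ s.homAction X a b := by
  have singleCast_substLeft :
      T.map (tmap M.E fun _ : Fin 1 => T.map (singleCast M.E X.graph a b)) ≫
          s.substLeft (homs X.graph (ObjSeq.single a b)) =
        s.substLeft (fun _ : Fin 1 => X.graph.hom a b) ≫ T.map (singleCast M.E X.graph a b) := by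
    rw [← show tcast s.toMultitensor.E rfl (hom_eq_homs_single X.graph a b) =
      T.map (singleCast M.E X.graph a b) from tcast_compTensor _ _]
    exact s.toMultitensor.tcast_substLeft (hom_eq_homs_single X.graph a b)
  symm
  calc
    _ = T.map (T.map (M.unit _)) ≫ T.map (T.map (singleCast M.E X.graph a b)) ≫
          T.map (X.comp (ObjSeq.single a b)) ≫ s.homAction X a b := by
      conv_lhs => rw [homAction]
      rw [T.map_comp, T.map_comp, Category.assoc, Category.assoc]
      rfl
    _ = T.map (T.map (M.unit _)) ≫ T.map (T.map (singleCast M.E X.graph a b)) ≫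
          T.map (M.unit _) ≫ s.substLeft (homs X.graph (ObjSeq.single a b)) ≫
            X.comp (ObjSeq.single a b) :=
      whisker_eq _ (whisker_eq _ (s.map_comp_homAction X _))
    _ = T.map (M.unit _) ≫ T.map (tmap M.E fun _ : Fin 1 => T.map (M.unit _)) ≫
          s.substLeft (fun _ : Fin 1 => X.graph.hom a b) ≫
            T.map (singleCast M.E X.graph a b) ≫ X.comp (ObjSeq.single a b) := by
      rw [reassoc_of% map_unit_natural (M := M) (T := T),
        reassoc_of% map_unit_natural (M := M) (T := T), reassoc_of% singleCast_substLeft]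
    _ = T.μ.app (X.graph.hom a b) ≫ s.homAction X a b := by
      rw [homAction, reassoc_of% s.map_unit_map_unit_substLeft]

theorem unit_η_comp (a b : X.graph.obj) :
    M.unit (X.graph.hom a b) ≫ singleCast M.E X.graph a b ≫
      T.η.app ((M.E 1).obj (homs X.graph (ObjSeq.single a b))) ≫ X.comp (ObjSeq.single a b) =
        𝟙 _ :=
  (whisker_eq _ (comp_whisker (T.η.naturality (singleCast M.E X.graph a b)) _)).trans
    (s.unit_comp X a b)

theorem tmap_η_comp_η_comp {a b : X.graph.obj} (x : ObjSeq X.graph.obj a b) (y : x.Inner) :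
    tmap M.E (fun i => T.η.app ((M.E (y i).len).obj (homs X.graph (y i))) ≫ X.comp (y i)) ≫
        T.η.app ((M.E x.len).obj (homs X.graph x)) ≫ X.comp x =
      M.subst (fun i => (y i).len) (fun i => homs X.graph (y i)) ≫ concatCast M.E X.graph x y ≫
        T.η.app ((M.E (x.concat y).len).obj (homs X.graph (x.concat y))) ≫
          X.comp (x.concat y) := by
  calc
    _ = T.η.app _ ≫ T.map (tmap M.E fun i => T.η.app _) ≫
          T.map (tmap M.E fun i => X.comp (y i)) ≫ X.comp x := by
      rw [← tmap_comp, Category.assoc]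
      exact (whisker_eq _ (comp_whisker (T.η.naturality (tmap M.E fun i => X.comp (y i))) _)).trans
        (comp_whisker (T.η.naturality (tmap M.E fun i => T.η.app _)) _)
    _ = T.η.app _ ≫ T.map (M.subst (fun i => (y i).len) fun i => homs X.graph (y i)) ≫
          T.map (concatCast M.E X.graph x y) ≫ X.comp (x.concat y) := by
      rw [s.map_tmap_comp_comp, reassoc_of% s.map_η_subst]
      rfl
    _ = _ :=
      (comp_whisker (T.η.naturality (M.subst _ _)).symm _).trans
        (whisker_eq _ (comp_whisker (T.η.naturality (concatCast M.E X.graph x y)).symm _))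

/-- The `E`-category underlying a `T E`-category, obtained by restriction along `η E`. -/
abbrev restrict : ECat.{w} M where
  graph := X.graph
  comp x := T.η.app ((M.E x.len).obj (homs X.graph x)) ≫ X.comp x
  unit_comp := s.unit_η_comp X
  subst_comp := s.tmap_η_comp_η_comp X

theorem homAction_naturality {X Y : ECat.{w} s.toMultitensor} (f : X ⟶ Y) (a b : X.graph.obj) :
    T.map (f.toHom.hom a b) ≫ s.homAction Y (f.toHom.obj a) (f.toHom.obj b) =
      s.homAction X a b ≫ f.toHom.hom a b :=
  calc
    _ = T.map (M.unit _) ≫ T.map (tmap M.E fun _ : Fin 1 => f.toHom.hom a b) ≫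
          T.map (singleCast M.E Y.graph _ _) ≫ Y.comp (ObjSeq.single _ _) :=
      comp_whisker (map_unit_natural (f.toHom.hom a b)) _
    _ = T.map (M.unit _) ≫ T.map (singleCast M.E X.graph a b) ≫
          T.map (seqTensorMap M.E f.toHom (ObjSeq.single a b)) ≫
            Y.comp ((ObjSeq.single a b).map f.toHom.obj) :=
      whisker_eq _ (s.map_tmap_hom_comp_single Y f.toHom a b)
    _ = T.map (M.unit _) ≫ T.map (singleCast M.E X.graph a b) ≫
          X.comp (ObjSeq.single a b) ≫ f.toHom.hom a b :=
      whisker_eq _ (whisker_eq _ (f.comm (ObjSeq.single a b)).symm)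
    _ = s.homAction X a b ≫ f.toHom.hom a b :=
      (whisker_eq _ (Category.assoc _ _ _).symm).trans (Category.assoc _ _ _).symm

theorem isFunctor_restrict {X Y : ECat.{w} s.toMultitensor} (f : X ⟶ Y) :
    ECat.IsFunctor (s.restrict X) (s.restrict Y) f.toHom := fun _ _ x =>
  ((Category.assoc _ _ _).trans (whisker_eq _ (f.comm x))).trans
    (comp_whisker (T.η.naturality (seqTensorMap M.E f.toHom x)).symm _)

theorem isFunctor_of_restrict {X Y : ECat.{w} s.toMultitensor} {f : X.graph ⟶ Y.graph}
    (hf : ECat.IsFunctor (s.restrict X) (s.restrict Y) f)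
    (hact : ∀ a b, T.map (f.hom a b) ≫ s.homAction Y (f.obj a) (f.obj b) =
      s.homAction X a b ≫ f.hom a b) :
    ECat.IsFunctor X Y f := fun a b x =>
  calc
    _ = T.map ((s.restrict X).comp x) ≫ s.homAction X a b ≫ f.hom a b :=
      (eq_whisker (s.map_η_comp_homAction X x).symm _).trans (Category.assoc _ _ _)
    _ = T.map ((s.restrict X).comp x) ≫ T.map (f.hom a b) ≫ s.homAction Y (f.obj a) (f.obj b) :=
      whisker_eq _ (hact a b).symm
    _ = T.map (seqTensorMap M.E f x) ≫ T.map ((s.restrict Y).comp (x.map f.obj)) ≫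
          s.homAction Y (f.obj a) (f.obj b) :=
      comp_whisker ((T.map_comp _ _).symm.trans ((congrArg T.map (hf x)).trans (T.map_comp _ _))) _
    _ = _ := whisker_eq _ (s.map_η_comp_homAction Y (x.map f.obj))

end ECat

end CompositeMultitensor

namespace MonoidalCoherence

variable (c : MonoidalCoherence M T)

/-- A `T`-algebra structure on each hom of the `E`-category `Y` for which the actions form an
`E`-functor. Since the unit law forces structure maps to be the identity on objects, these are the
algebra structures on `Y` for the lifted monad. -/
@[ext]
structure HomAlgebra (Y : ECat.{w} M) where
  act : ∀ a b, T.obj (Y.graph.hom a b) ⟶ Y.graph.hom a b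
  unit : ∀ a b, T.η.app (Y.graph.hom a b) ≫ act a b = 𝟙 _
  assoc : ∀ a b, T.μ.app (Y.graph.hom a b) ≫ act a b = T.map (act a b) ≫ act a b
  comm : ∀ {a b : Y.graph.obj} (x : ObjSeq Y.graph.obj a b),
    c.τ (homs Y.graph x) ≫ T.map (Y.comp x) ≫ act a b =
      tmap M.E (fun i => act (x.vtx i.castSucc) (x.vtx i.succ)) ≫ Y.comp x

theorem τ_map_comp_homAction (X : ECat.{w} c.composite.toMultitensor) {a b : X.graph.obj}
    (x : ObjSeq X.graph.obj a b) :
    c.τ (homs X.graph x) ≫ T.map ((c.composite.restrict X).comp x) ≫ c.composite.homAction X a b =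
      tmap M.E (fun i => c.composite.homAction X (x.vtx i.castSucc) (x.vtx i.succ)) ≫
        (c.composite.restrict X).comp x :=
  calc
    _ = c.τ (homs X.graph x) ≫ X.comp x :=
      whisker_eq _ (c.composite.map_η_comp_homAction X x)
    _ = T.η.app _ ≫ T.map (tmap M.E fun i => T.map (M.unit (homs X.graph x i))) ≫
          c.composite.substRight (homs X.graph x) ≫ X.comp x :=
      (eq_whisker (c.composite_τ (homs X.graph x)).symm _).trans
        ((Category.assoc _ _ _).trans (whisker_eq _ (Category.assoc _ _ _)))
    _ = T.η.app _ ≫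
          T.map (tmap M.E fun i =>
            c.composite.homAction X (x.vtx i.castSucc) (x.vtx i.succ)) ≫ X.comp x :=
      whisker_eq _ (c.composite.map_tmap_homAction_comp X x).symm
    _ = _ := (comp_whisker (T.η.naturality _) _).symm

/-- The actions of `T` on the homs of a `T E`-category. -/
def homAlgebra (X : ECat.{w} c.composite.toMultitensor) :
    c.HomAlgebra (c.composite.restrict X) where
  act := c.composite.homAction X
  unit := c.composite.η_homAction X
  assoc := c.composite.μ_homAction X
  comm := c.τ_map_comp_homAction X

namespace HomAlgebra

variable {c} {Y : ECat.{w} M} (A : c.HomAlgebra Y)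

/-- The algebra for the lifted monad whose structure map is the identity on objects and the given
actions on homs. -/
def toAlgebra : c.liftingData.{w}.monad.Algebra where
  A := Y
  a := ⟨⟨id, A.act⟩, fun x => (Category.assoc _ _ _).trans (A.comm x)⟩
  unit := ECat.Hom.ext (VGraph.hom_ext A.unit)
  assoc := ECat.Hom.ext (VGraph.hom_ext A.assoc)

theorem η_map_comp {a b : Y.graph.obj} (x : ObjSeq Y.graph.obj a b) :
    T.η.app (seqTensor M.E Y.graph x) ≫ T.map (Y.comp x) ≫ A.act a b = Y.comp x :=
  (comp_whisker (T.η.naturality (Y.comp x)).symm _).trans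
    ((whisker_eq _ (A.unit a b)).trans (Category.comp_id _))

theorem unit_map_comp (a b : Y.graph.obj) :
    M.unit (Y.graph.hom a b) ≫ T.η.app _ ≫ T.map (singleCast M.E Y.graph a b) ≫
      T.map (Y.comp (ObjSeq.single a b)) ≫ A.act a b = 𝟙 _ :=
  calc
    _ = M.unit (Y.graph.hom a b) ≫ singleCast M.E Y.graph a b ≫ T.η.app _ ≫
          T.map (Y.comp (ObjSeq.single a b)) ≫ A.act a b :=
      whisker_eq _ (comp_whisker (T.η.naturality _).symm _)
    _ = 𝟙 _ := by
      rw [A.η_map_comp, Y.unit_comp]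

theorem map_tmap_map_comp {a b : Y.graph.obj} (x : ObjSeq Y.graph.obj a b) (y : x.Inner) :
    T.map (tmap M.E fun i =>
        T.map (Y.comp (y i)) ≫ A.act (x.vtx i.castSucc) (x.vtx i.succ)) ≫
        T.map (Y.comp x) ≫ A.act a b =
      T.map (c.τ fun i => seqTensor M.E Y.graph (y i)) ≫ T.μ.app _ ≫
        T.map (M.subst (fun i => (y i).len) fun i => homs Y.graph (y i)) ≫
          T.map (concatCast M.E Y.graph x y) ≫ T.map (Y.comp (x.concat y)) ≫ A.act a b := by
  calc
    _ = T.map (tmap M.E fun i => T.map (Y.comp (y i))) ≫ T.map (c.τ (homs Y.graph x)) ≫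
          T.map (T.map (Y.comp x)) ≫ T.map (A.act a b) ≫ A.act a b := by
      have map_comm := congrArg T.map (A.comm x)
      simp only [T.map_comp] at map_comm
      rw [← reassoc_of% map_tmap_comp (M := M) (T := T), ← reassoc_of% map_comm]
    _ = T.map (tmap M.E fun i => T.map (Y.comp (y i))) ≫ T.map (c.τ (homs Y.graph x)) ≫
          T.μ.app _ ≫ T.map (Y.comp x) ≫ A.act a b := by
      rw [← A.assoc, T.mu_naturality_assoc]
    _ = T.map (c.τ fun i => seqTensor M.E Y.graph (y i)) ≫ T.μ.app _ ≫
          T.map (tmap M.E fun i => Y.comp (y i)) ≫ T.map (Y.comp x) ≫ A.act a b := by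
      rw [← T.map_comp_assoc, c.natural fun i => Y.comp (y i), T.map_comp_assoc,
        T.mu_naturality_assoc]
    _ = _ := by
      rw [← T.map_comp_assoc, Y.subst_comp, T.map_comp, T.map_comp]
      simp only [Category.assoc]

/-- The `T E`-category with the homs of `Y` and compositions `T(κ_x)` followed by the action. -/
def toECat : ECat.{w} c.composite.toMultitensor where
  graph := Y.graph
  comp {a b} x := T.map (Y.comp x) ≫ A.act a b
  unit_comp a b := by
    rw [show singleCast c.composite.toMultitensor.E Y.graph a b =
      T.map (singleCast M.E Y.graph a b) from tcast_compTensor _ _]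
    exact (Category.assoc _ _ _).trans (A.unit_map_comp a b)
  subst_comp {a b} x y := by
    rw [show concatCast c.composite.toMultitensor.E Y.graph x y =
      T.map (concatCast M.E Y.graph x y) from tcast_compTensor _ _]
    exact (A.map_tmap_map_comp x y).trans ((whisker_eq _ (Category.assoc _ _ _).symm).trans
      (Category.assoc _ _ _).symm)

theorem homAction_toECat (a b : Y.graph.obj) :
    c.composite.homAction A.toECat a b = A.act a b := by
  have map_unit_comp := congrArg T.map (Y.unit_comp a b)
  rw [T.map_comp, T.map_comp, T.map_id] at map_unit_comp
  exact (whisker_eq _ (Category.assoc _ _ _).symm).trans ((Category.assoc _ _ _).symm.trans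
    ((eq_whisker map_unit_comp _).trans (Category.id_comp _)))

theorem toAlgebra_congr {G : VGraph.{w} V} {S S' : ECatStruct M G}
    {A : c.HomAlgebra S.toECat} {A' : c.HomAlgebra S'.toECat}
    (hcomp : ∀ {a b : G.obj} (x : ObjSeq G.obj a b), S.comp x = S'.comp x)
    (hact : ∀ a b, A.act a b = A'.act a b) : A.toAlgebra = A'.toAlgebra := by
  obtain ⟨comp, _, _⟩ := S
  obtain ⟨comp', _, _⟩ := S'
  obtain rfl : @comp = @comp' := funext fun a => funext fun b => funext fun x => hcomp x
  rw [HomAlgebra.ext (funext fun a => funext fun b => hact a b)]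

theorem toAlgebra_homAlgebra_toECat : (c.homAlgebra A.toECat).toAlgebra = A.toAlgebra :=
  toAlgebra_congr
    (S := ⟨(c.composite.restrict A.toECat).comp, (c.composite.restrict A.toECat).unit_comp,
      (c.composite.restrict A.toECat).subst_comp⟩)
    (S' := ⟨Y.comp, Y.unit_comp, Y.subst_comp⟩) A.η_map_comp A.homAction_toECat

theorem exists_toAlgebra_eq (B : c.liftingData.{w}.monad.Algebra) :
    ∃ A : c.HomAlgebra B.A, A.toAlgebra = B := by
  obtain ⟨Y, ⟨a, comm⟩, unit, assoc⟩ := B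
  have obj_eq : a.obj = id := congrArg (fun f : Y ⟶ Y => f.toHom.obj) unit
  obtain ⟨act, rfl⟩ :=
    VGraph.exists_eq_mk (X := (graphMonad T).obj Y.graph) (Y := Y.graph) a obj_eq
  exact ⟨⟨act,
    VGraph.Hom.hom_eq_of_mk_eq (X := Y.graph) (Y := Y.graph) (congrArg ECat.Hom.toHom unit),
    VGraph.Hom.hom_eq_of_mk_eq (X := (graphMonad T).obj ((graphMonad T).obj Y.graph))
      (Y := Y.graph) (congrArg ECat.Hom.toHom assoc),
    fun x => (Category.assoc _ _ _).symm.trans (comm x)⟩, rfl⟩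

end HomAlgebra

/-- The comparison functor from `T E`-categories to algebras for the lifted monad. -/
def comparison : ECat.{w} c.composite.toMultitensor ⥤ c.liftingData.{w}.monad.Algebra where
  obj X := (c.homAlgebra X).toAlgebra
  map f :=
    { f := ⟨f.toHom, fun x => c.composite.isFunctor_restrict f x⟩
      h := ECat.Hom.ext (VGraph.hom_ext (c.composite.homAction_naturality f)) }
  map_id _ := Monad.Algebra.Hom.ext rfl
  map_comp _ _ := Monad.Algebra.Hom.ext rfl

instance : c.comparison.{w}.Faithful where
  map_injective h := ECat.Hom.ext
    (congrArg (fun f : Monad.Algebra.Hom _ _ => ECat.Hom.toHom f.f) h)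

instance : c.comparison.{w}.Full where
  map_surjective {X Y} g :=
    ⟨⟨g.f.toHom, fun x => c.composite.isFunctor_of_restrict (fun _ _ x => g.f.comm x)
      (VGraph.Hom.hom_eq_of_mk_eq (X := (graphMonad T).obj X.graph) (Y := Y.graph)
        (congrArg ECat.Hom.toHom g.h)) x⟩, rfl⟩

theorem comparison_obj_injective : Function.Injective c.comparison.{w}.obj := fun X Y h => by
  let U : c.liftingData.{w}.monad.Algebra ⥤ VGraph.{w} V := Monad.forget _ ⋙ ECat.forget M
  refine ECat.eq_of_toHom_eq_eqToHom (c.comparison.preimage (eqToHom h)) (congrArg U.obj h) ?_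
  exact (congrArg U.map (c.comparison.map_preimage (eqToHom h))).trans (eqToHom_map U h)

theorem comparison_obj_surjective : Function.Surjective c.comparison.{w}.obj := fun B => by
  obtain ⟨A, hA⟩ := HomAlgebra.exists_toAlgebra_eq B
  exact ⟨A.toECat, A.toAlgebra_homAlgebra_toECat.trans hA⟩

end MonoidalCoherence

end Algebras

end EnrichedMultitensor

theorem mainTheorem5 {V : Type u} [Category.{v} V] (M : Multitensor V) (T : Monad V) :
    ∃ e₁₂ : MonoidalCoherence M T ≃ CompositeMultitensor M T,
      (∀ (c : MonoidalCoherence M T) {m : ℕ} (n : Fin m → ℕ) (Z : ∀ i, Fin (n i) → V),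
        (e₁₂ c).subst n Z =
          T.map (c.τ fun i => (M.E (n i)).obj (Z i)) ≫ T.μ.app _ ≫ T.map (M.subst n Z)) ∧
      ∀ [HasCoproducts.{w} V] (hM : IsDistributive.{w} M.E),
        ∃ (e₁₃ : MonoidalCoherence M T ≃ IdOnObjDistributiveLaw.{w} M T hM)
          (e₁₄ : MonoidalCoherence M T ≃ Lifting.{w} M (graphMonad.{w} T)),
          (∀ (c : MonoidalCoherence M T) (X : VGraph.{w} V),
            (e₁₃ c).1.app X =
              ⟨id, fun _ _ => Sigma.desc fun x => c.τ (homs X x) ≫ T.map (gammaIncl M.E X x)⟩) ∧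
          (∀ (c : MonoidalCoherence M T) (X : ECat.{w} M), ∃ hu hs,
            (e₁₄ c).monad.obj X =
              ⟨(graphMonad T).obj X.graph,
                fun x => c.τ (homs X.graph x) ≫ T.map (X.comp x), hu, hs⟩) ∧
          ∀ c : MonoidalCoherence M T,
            ∃ (Φ : ECat.{w} (e₁₂ c).toMultitensor ⥤ (e₁₄ c).monad.Algebra)
              (Ψ : (e₁₄ c).monad.Algebra ⥤ ECat.{w} (e₁₂ c).toMultitensor),
              Φ ⋙ Ψ = 𝟭 _ ∧ Ψ ⋙ Φ = 𝟭 _ ∧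
              Φ ⋙ Monad.forget _ ⋙ ECat.forget M = ECat.forget (e₁₂ c).toMultitensor := by
  refine ⟨compositeEquiv M T, fun c m n Z => rfl, fun hM => ?_⟩
  refine ⟨lawEquiv hM T, liftingEquiv hM T, fun c G => c.liftingData_law_app hM G, fun c X =>
    ⟨(c.liftStruct X).unit_comp, (c.liftStruct X).subst_comp, rfl⟩, fun c => ?_⟩
  obtain ⟨inverse, comparison_inverse, inverse_comparison⟩ :=
    exists_inverse_of_bijective_obj c.comparison
      ⟨c.comparison_obj_injective, c.comparison_obj_surjective⟩
  exact ⟨c.comparison, inverse, comparison_inverse, inverse_comparison, rfl⟩
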